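/- Let $k$ be a field and let $n\ge 1$ be an integer. For $m\ge 0$ put $Q^m=\operatorname{Spec} k[t_0,\dots,t_m]/(\sum_i t_i)$, with the face maps $\partial_j:Q^{m-1}\to Q^m$ given by $\partial_j^*(t_i)=t_i$ for $i<j$, $\partial_j^*(t_j)=0$, $\partial_j^*(t_i)=t_{i-1}$ for $i>j$; a face of $Q^m$ is a subscheme $\{t_i=0,\ i\in S\}$. Let $\mathcal{SZ}^p(k,m)$ be the free abelian group on the integral closed subschemes of codimension $p$ of $Q^m$ which do not contain the vertex $\{0\}$ and which meet every face in codimension $\ge p$ (in the face). Restriction of cycles to the faces gives $\partial=\sum_j(-1)^j\partial_j:\mathcal{SZ}^p(k,m)\to\mathcal{SZ}^p(k,m-1)$ and a complex $\mathcal{SZ}^p(k,\bullet)$; let $SH^p(k,m)$ be its $m$-th homology group. For $a\in k^\times$ let $a\star$ be the map on $SH^p(k,m)$ induced by the automorphism $(t_0,\dots,t_m)\mapsto(t_0/a,\dots,t_m/a)$ of $Q^m$. Let $\Omega^{n-1}_k$ be the absolute Kähler differential $(n-1)$-forms of $k$. There is exactly one homomorphism of groups $$\varphi:\Omega^{n-1}_k\to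 SH^n(k,n)$$ such that $\varphi(a\,\omega)=a\star\varphi(\omega)$ for all $a\in k^\times$, $\omega\in\Omega_k^{n-1}$, and $$\varphi\bigl(d\log b_1\wedge\dots\wedge d\log b_{n-1}\bigr)=\Bigl[\Bigl(-1,\frac{b_1}{c},\dots,\frac{b_{n-1}}{c},-\frac1c\Bigr)\Bigr],\qquad c=-1+\sum_{i=1}^{n-1}b_i,$$ for all $b_1,\dots,b_{n-1}\in k^\times$ with $c\ne0$. This map $\varphi$ is surjective. In particular, the abelian group $SH^n(k,n)$ is generated by the classes of the $k$-rational points $(u_0,\dots,u_n)$ of $Q^n$ with all $u_i\neq 0$. -/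

import Mathlib

open scoped BigOperators KaehlerDifferential

noncomputable section

namespace AdditiveChow

universe u

/-! ### Fundamental cycles of closed subschemes of an affine scheme -/

section FundamentalCycle

variable {B : Type*} [CommRing B]

/-- The length of the local ring of the closed subscheme `V(I)` of `Spec B` at the point `q`.
It is used only at generic points of `V(I)` with `B` Noetherian, where it is finite. -/
def multiplicity (I q : Ideal B) [q.IsPrime] : ℕ :=
  (Module.length
    (Localization.AtPrime q ⧸ I.map (algebraMap B (Localization.AtPrime q)))
    (Localization.AtPrime q ⧸ I.map (algebraMap B (Localization.AtPrime q)))).toNat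

open Classical in
/-- The fundamental cycle of the closed subscheme `V(I)` of `Spec B`: the sum of its irreducible
components (that is, of the minimal primes over `I`), each counted with its multiplicity. -/
def fundamentalCycle [IsNoetherianRing B] (I : Ideal B) : PrimeSpectrum B →₀ ℤ :=
  Finsupp.ofSupportFinite
    (fun q => if q.asIdeal ∈ I.minimalPrimes then (multiplicity I q.asIdeal : ℤ) else 0)
    (((I.finite_minimalPrimes_of_isNoetherianRing B).preimage
      (fun _ _ _ _ h => PrimeSpectrum.ext h)).subset (fun q hq => by
        by_contra h
        exact hq (if_neg h)))

end FundamentalCycle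

/-! ### The cosimplicial scheme `Q` -/

section Q

variable (k : Type u) [Field k]

/-- The coordinate ring `k[t_0, …, t_n] / (∑ t_i)` of `Q^n`. -/
def Q (n : ℕ) : Type u :=
  MvPolynomial (Fin (n + 1)) k ⧸
    Ideal.span {(∑ i, MvPolynomial.X i : MvPolynomial (Fin (n + 1)) k)}

instance (n : ℕ) : CommRing (Q k n) := inferInstanceAs (CommRing (MvPolynomial _ k ⧸ _))

instance (n : ℕ) : Algebra k (Q k n) := inferInstanceAs (Algebra k (MvPolynomial _ k ⧸ _))

instance (n : ℕ) : IsNoetherianRing (Q k n) :=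
  inferInstanceAs (IsNoetherianRing (MvPolynomial (Fin (n + 1)) k ⧸ _))

/-- The quotient map `k[t_0, …, t_n] → k[t_0, …, t_n] / (∑ t_i)`. -/
def Q.mk (n : ℕ) : MvPolynomial (Fin (n + 1)) k →ₐ[k] Q k n :=
  Ideal.Quotient.mkₐ k (Ideal.span {(∑ i, MvPolynomial.X i : MvPolynomial (Fin (n + 1)) k)})

theorem Q.mk_surjective (n : ℕ) : Function.Surjective (Q.mk k n) :=
  Ideal.Quotient.mkₐ_surjective k _

theorem Q.ker_mk (n : ℕ) : RingHom.ker (Q.mk k n) =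
    Ideal.span {(∑ i, MvPolynomial.X i : MvPolynomial (Fin (n + 1)) k)} :=
  Ideal.Quotient.mkₐ_ker k _

variable {k}

/-- The coordinate functions on `Q^n`. -/
def t {n : ℕ} (i : Fin (n + 1)) : Q k n :=
  Q.mk k n (MvPolynomial.X i)

/-- The sum of the coordinates vanishes on `Q^n`. -/
theorem sum_t (n : ℕ) : ∑ i, (t i : Q k n) = 0 := by
  unfold t
  rw [← map_sum, ← RingHom.mem_ker, Q.ker_mk]
  exact Ideal.subset_span rfl

/-- The `k`-algebra homomorphism out of the coordinate ring of `Q^n` which sends `t_i` to `v_i`,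
for a family `v` with sum zero. -/
def lift {n : ℕ} {A : Type*} [CommRing A] [Algebra k A] (v : Fin (n + 1) → A)
    (hv : ∑ i, v i = 0) : Q k n →ₐ[k] A :=
  Ideal.Quotient.liftₐ (Ideal.span {(∑ i, MvPolynomial.X i : MvPolynomial (Fin (n + 1)) k)})
    (MvPolynomial.aeval v) (fun a ha => by
      have h : Ideal.span {(∑ i, MvPolynomial.X i : MvPolynomial (Fin (n + 1)) k)} ≤
          RingHom.ker (MvPolynomial.aeval v : MvPolynomial (Fin (n + 1)) k →ₐ[k] A) := by
        rw [Ideal.span_le, Set.singleton_subset_iff, SetLike.mem_coe, RingHom.mem_ker]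
        simpa using hv
      exact h ha)

theorem lift_mk {n : ℕ} {A : Type*} [CommRing A] [Algebra k A] (v : Fin (n + 1) → A)
    (hv : ∑ i, v i = 0) (p : MvPolynomial (Fin (n + 1)) k) :
    lift v hv (Q.mk k n p) = MvPolynomial.aeval v p := rfl

theorem lift_t {n : ℕ} {A : Type*} [CommRing A] [Algebra k A] (v : Fin (n + 1) → A)
    (hv : ∑ i, v i = 0) (i : Fin (n + 1)) : lift v hv (t i : Q k n) = v i := by
  unfold t
  rw [lift_mk, MvPolynomial.aeval_X]

theorem algHom_ext {n : ℕ} {A : Type*} [CommRing A] [Algebra k A] {f g : Q k n →ₐ[k] A}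
    (h : ∀ i, f (t i) = g (t i)) : f = g := by
  have hc : f.comp (Q.mk k n) = g.comp (Q.mk k n) := MvPolynomial.algHom_ext h
  ext x
  obtain ⟨p, rfl⟩ := Q.mk_surjective k n x
  exact congrArg (fun F => F p) hc

/-- The pull-back of functions along the `j`-th face map `Q^n → Q^(n+1)`: it sends `t_i` to `t_i`
for `i < j`, to `0` for `i = j`, and to `t_(i-1)` for `i > j`. -/
def face {n : ℕ} (j : Fin (n + 2)) : Q k (n + 1) →ₐ[k] Q k n :=
  lift (Fin.insertNth (α := fun _ => Q k n) j 0 t) (by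
    rw [Fin.sum_univ_succAbove _ j]
    simp [sum_t])

theorem face_t {n : ℕ} (j : Fin (n + 2)) (i : Fin (n + 2)) :
    face j (t i : Q k (n + 1)) = Fin.insertNth (α := fun _ => Q k n) j 0 t i :=
  lift_t _ _ i

theorem sum_smul_t (n : ℕ) (a : k) : ∑ i, a • (t i : Q k n) = 0 := by
  rw [← Finset.smul_sum, sum_t, smul_zero]

/-- The pull-back of functions along the automorphism
`(t_0, …, t_n) ↦ a ⋆ (t_0, …, t_n) = (t_0 / a, …, t_n / a)` of `Q^n`. -/
def scale {n : ℕ} (a : kˣ) : Q k n ≃ₐ[k] Q k n :=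
  AlgEquiv.ofAlgHom
    (lift (fun i => (a : k)⁻¹ • t i) (sum_smul_t n _))
    (lift (fun i => (a : k) • t i) (sum_smul_t n _))
    (algHom_ext fun i => by
      simp [lift_t, smul_smul])
    (algHom_ext fun i => by
      simp [lift_t, smul_smul])

theorem scale_t {n : ℕ} (a : kˣ) (i : Fin (n + 1)) :
    scale a (t i : Q k n) = (a : k)⁻¹ • t i :=
  lift_t _ (sum_smul_t n _) i

theorem face_scale {n : ℕ} (j : Fin (n + 2)) (a : kˣ) (x : Q k (n + 1)) :
    face j (scale a x) = scale a (face j x) := by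
  have h : (face j).comp (scale a : Q k (n + 1) ≃ₐ[k] Q k (n + 1)).toAlgHom =
      (scale a : Q k n ≃ₐ[k] Q k n).toAlgHom.comp (face j) := by
    apply algHom_ext
    intro i
    simp only [AlgHom.comp_apply, AlgEquiv.toAlgHom_apply, scale_t, map_smul, face_t]
    refine Fin.succAboveCases j ?_ (fun m => ?_) i
    · simp
    · rw [Fin.insertNth_apply_succAbove, scale_t]
  have h2 := AlgHom.congr_fun h x
  simpa only [AlgHom.comp_apply, AlgEquiv.toAlgHom_apply] using h2

/-- `face j`, as a homomorphism of rings. -/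
abbrev faceHom {n : ℕ} (j : Fin (n + 2)) : Q k (n + 1) →+* Q k n :=
  (face j : Q k (n + 1) →ₐ[k] Q k n).toRingHom

/-- `scale a`, as an isomorphism of rings. -/
abbrev scaleEquiv {n : ℕ} (a : kˣ) : Q k n ≃+* Q k n :=
  (scale a : Q k n ≃ₐ[k] Q k n).toRingEquiv

end Q

/-! ### The cycle complex and the additive Chow groups -/

section Complex

variable (k : Type u) [Field k]

/-- Algebraic cycles on `Q^n`: finite integral combinations of integral closed subschemes `V(P)`,
which are given by their generic points `P`. -/
abbrev Cycle (n : ℕ) : Type u := PrimeSpectrum (Q k n) →₀ ℤ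

/-- The coordinate ring of the face `V(t_i, i ∈ S)` of `Q^n`. -/
abbrev FaceRing {n : ℕ} (S : Finset (Fin (n + 1))) : Type u :=
  Q k n ⧸ Ideal.span ((t : Fin (n + 1) → Q k n) '' S)

variable {k}

/-- `V(P)` is an integral closed subscheme of `Q^n` of codimension `p` in good position. -/
structure IsGood (p : ℕ) {n : ℕ} (P : PrimeSpectrum (Q k n)) : Prop where
  /-- `V(P)` has codimension `p` in `Q^n`. -/
  height_eq : P.asIdeal.height = p
  /-- `V(P)` does not contain the vertex `{0}`. -/
  vertex : ¬ P.asIdeal ≤ Ideal.span (Set.range (t : Fin (n + 1) → Q k n))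
  /-- For each face `F = V(t_i, i ∈ S)` of `Q^n`, every point of `F` that lies on `V(P)` has
  codimension at least `p` in `F`. -/
  face : ∀ S : Finset (Fin (n + 1)), S.Nonempty →
    ∀ q : PrimeSpectrum (FaceRing k S),
      P.asIdeal ≤ q.asIdeal.comap (Ideal.Quotient.mk _) → (p : ℕ∞) ≤ Ideal.height (R := FaceRing k S) q.asIdeal

variable (k)

/-- The group `SZ^p(k, n)`, freely generated by the integral closed subschemes of codimension `p`
of `Q^n` in good position. -/
def goodCycles (p n : ℕ) : AddSubgroup (Cycle k n) :=
  (Finsupp.supported ℤ ℤ {P : PrimeSpectrum (Q k n) | IsGood p P}).toAddSubgroup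

variable {k}

/-- The restriction of cycles to the `j`-th face. It sends `V(P)` to the fundamental cycle of its
scheme-theoretic inverse image. For `V(P)` in good position, `t_j` is a nonzero divisor modulo `P`,
hence the higher `Tor` groups vanish and this is the intersection product of `V(P)` with the
face. -/
def restrict {n : ℕ} (j : Fin (n + 2)) : Cycle k (n + 1) →+ Cycle k n :=
  Finsupp.liftAddHom fun P =>
    zmultiplesHom _ (fundamentalCycle (P.asIdeal.map (faceHom j)))

variable (k)

/-- The boundary map `∂ = ∑ (-1)^j ∂_j` on cycles on `Q^n`; it is zero on `Q^0`. -/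
def boundary : (n : ℕ) → (Cycle k n →+ Cycle k (n - 1))
  | 0 => 0
  | n + 1 => ∑ j : Fin (n + 2), (-1 : ℤ) ^ (j : ℕ) • (restrict j : Cycle k (n + 1) →+ Cycle k n)

/-- The kernel of `∂` on `SZ^p(k, n)`. -/
def closedCycles (p n : ℕ) : AddSubgroup (Cycle k n) :=
  goodCycles k p n ⊓ (boundary k n).ker

/-- The image of `∂` on `SZ^p(k, n + 1)`. -/
def boundaries (p n : ℕ) : AddSubgroup (Cycle k n) :=
  (goodCycles k p (n + 1)).map (boundary k (n + 1))

/-- The additive Chow group `SH^p(k, n)`, the `n`-th homology group of the complex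
`SZ^p(k, •)`: the kernel of `∂` on `SZ^p(k, n)` modulo the image of `∂` on `SZ^p(k, n + 1)`. (The
restrictions of cycles in good position to the faces are again in good position, and `∂ ∘ ∂ = 0`
on them, so the image lies in the kernel and `addSubgroupOf` loses nothing.) -/
abbrev SH (p n : ℕ) : Type u :=
  closedCycles k p n ⧸ (boundaries k p n).addSubgroupOf (closedCycles k p n)

end Complex

/-! ### The action of the multiplicative group -/

section Star

variable {k : Type u} [Field k]

/-- The automorphism `x ↦ a ⋆ x` of `Q^n` on points of the underlying space. -/
def starPoint {n : ℕ} (a : kˣ) (P : PrimeSpectrum (Q k n)) : PrimeSpectrum (Q k n) :=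
  PrimeSpectrum.comap ((scaleEquiv a : Q k n ≃+* Q k n) : Q k n →+* Q k n) P

/-- The action `z ↦ a ⋆ z` on cycles on `Q^n`, by transport along the automorphism `x ↦ a ⋆ x`. -/
def starCycle {n : ℕ} (a : kˣ) : Cycle k n →+ Cycle k n :=
  Finsupp.mapDomain.addMonoidHom (starPoint a)

theorem length_self_eq {B C : Type*} [CommRing B] [CommRing C] (e : B ≃+* C) :
    Module.length B B = Module.length C C := by
  rw [Module.length_eq_height, Module.length_eq_height]
  have h := Order.height_orderIso (e.symm.idealComapOrderIso) (⊤ : Ideal B)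
  rw [← h, OrderIso.map_top]

theorem multiplicity_comap {B C : Type*} [CommRing B] [CommRing C] (e : B ≃+* C) (I q : Ideal C)
    [q.IsPrime] (q' : Ideal B) [q'.IsPrime] (h : q' = q.comap e) :
    multiplicity (I.comap (e : B →+* C)) q' = multiplicity I q := by
  unfold multiplicity
  congr 1
  refine length_self_eq (Ideal.quotientEquiv _ _ (Localization.localRingEquiv q' q e h) ?_)
  rw [Ideal.map_map]
  have : RingHom.comp (Localization.localRingEquiv q' q e h : _ →+* Localization.AtPrime q)
        (algebraMap B (Localization.AtPrime q')) =
      (algebraMap C (Localization.AtPrime q)).comp (e : B →+* C) := by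
    ext x
    exact Localization.localRingHom_to_map q' q (e : B →+* C) h x
  rw [this, ← Ideal.map_map]
  congr 1
  exact (Ideal.map_comap_of_surjective _ e.surjective I).symm

theorem fundamentalCycle_comap {B C : Type*} [CommRing B] [CommRing C] [IsNoetherianRing B]
    [IsNoetherianRing C] (e : B ≃+* C) (I : Ideal C) :
    fundamentalCycle (I.comap (e : B →+* C)) =
      Finsupp.mapDomain (PrimeSpectrum.comap (e : B →+* C)) (fundamentalCycle I) := by
  have hinj : Function.Injective (PrimeSpectrum.comap (e : B →+* C)) :=
    PrimeSpectrum.comap_injective_of_surjective _ e.surjective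
  ext q
  obtain ⟨q, rfl⟩ : ∃ q', PrimeSpectrum.comap (e : B →+* C) q' = q := by
    refine ⟨PrimeSpectrum.comap (e.symm : C →+* B) q, ?_⟩
    ext x
    simp
  rw [Finsupp.mapDomain_apply hinj]
  simp only [fundamentalCycle, Finsupp.ofSupportFinite_coe]
  rw [multiplicity_comap e I q.asIdeal (PrimeSpectrum.comap (e : B →+* C) q).asIdeal rfl]
  have : (PrimeSpectrum.comap (e : B →+* C) q).asIdeal ∈ (I.comap (e : B →+* C)).minimalPrimes ↔
      q.asIdeal ∈ I.minimalPrimes := by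
    rw [Ideal.comap_minimalPrimes_eq_of_surjective e.surjective]
    constructor
    · rintro ⟨r, hr, h⟩
      rwa [← Ideal.comap_injective_of_surjective _ e.surjective h]
    · intro h
      exact ⟨_, h, rfl⟩
  by_cases hq : q.asIdeal ∈ I.minimalPrimes
  · rw [if_pos hq, if_pos (this.2 hq)]
  · rw [if_neg hq, if_neg (fun h => hq (this.1 h))]

theorem starPoint_asIdeal {n : ℕ} (a : kˣ) (P : PrimeSpectrum (Q k n)) :
    (starPoint a P).asIdeal = P.asIdeal.comap (scaleEquiv a) := rfl

theorem mem_starPoint {n : ℕ} (a : kˣ) (P : PrimeSpectrum (Q k n)) (x : Q k n) :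
    x ∈ (starPoint a P).asIdeal ↔ scaleEquiv a x ∈ P.asIdeal := Iff.rfl

/-- An ideal generated by coordinates is stable under scaling. -/
theorem map_scale_span {n : ℕ} (a : kˣ) (S : Set (Fin (n + 1))) :
    (Ideal.span ((t : Fin (n + 1) → Q k n) '' S)).map ((scaleEquiv a : Q k n ≃+* Q k n) : Q k n →+* Q k n) =
    Ideal.span ((t : Fin (n + 1) → Q k n) '' S) := by
  have key : ∀ i : Fin (n + 1), ((scaleEquiv a : Q k n ≃+* Q k n) : Q k n →+* Q k n) (t i) =
      algebraMap k (Q k n) (a : k)⁻¹ * t i := fun i => by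
    rw [← Algebra.smul_def]
    exact scale_t a i
  apply le_antisymm
  · rw [Ideal.map_span, Ideal.span_le]
    rintro _ ⟨_, ⟨i, hi, rfl⟩, rfl⟩
    rw [key, SetLike.mem_coe]
    exact Ideal.mul_mem_left _ _ (Ideal.subset_span ⟨i, hi, rfl⟩)
  · rw [Ideal.span_le]
    rintro _ ⟨i, hi, rfl⟩
    have h : (t i : Q k n) =
        algebraMap k (Q k n) (a : k) * ((scaleEquiv a : Q k n ≃+* Q k n) : Q k n →+* Q k n) (t i) := by
      rw [key, ← mul_assoc, ← map_mul, mul_inv_cancel₀ a.ne_zero, map_one, one_mul]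
    rw [SetLike.mem_coe, h]
    exact Ideal.mul_mem_left _ _ (Ideal.mem_map_of_mem _ (Ideal.subset_span ⟨i, hi, rfl⟩))

theorem IsGood.star {p n : ℕ} {P : PrimeSpectrum (Q k n)} (h : IsGood p P) (a : kˣ) :
    IsGood p (starPoint a P) where
  height_eq := by
    rw [starPoint_asIdeal, RingEquiv.height_comap, h.height_eq]
  vertex := fun hle => by
    apply h.vertex
    rw [← Set.image_univ] at hle ⊢
    intro x hx
    obtain ⟨y, rfl⟩ := (scaleEquiv a : Q k n ≃+* Q k n).surjective x
    have h1 := hle ((mem_starPoint a P y).2 hx)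
    have h2 := Ideal.mem_map_of_mem ((scaleEquiv a : Q k n ≃+* Q k n) : Q k n →+* Q k n) h1
    rw [map_scale_span] at h2
    exact h2
  face := fun S hS q hq => by
    let J := Ideal.span ((t : Fin (n + 1) → Q k n) '' S)
    obtain ⟨e, he⟩ : ∃ e : FaceRing k S ≃+* FaceRing k S, ∀ y,
        e (Ideal.Quotient.mk J y) = Ideal.Quotient.mk J (scaleEquiv a y) :=
      ⟨Ideal.quotientEquiv J J (scaleEquiv a) (map_scale_span a _).symm, fun _ => rfl⟩
    have h1 := h.face S hS (PrimeSpectrum.comap (e.symm : FaceRing k S →+* FaceRing k S) q)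
      (fun x hx => by
        obtain ⟨y, rfl⟩ := (scaleEquiv a : Q k n ≃+* Q k n).surjective x
        have h2 := hq ((mem_starPoint a P y).2 hx)
        rw [Ideal.mem_comap] at h2 ⊢
        rw [← he, PrimeSpectrum.comap_asIdeal, Ideal.mem_comap, RingEquiv.coe_toRingHom,
          RingEquiv.symm_apply_apply]
        exact h2)
    have h3 := RingEquiv.height_comap (R := FaceRing k S) (S := FaceRing k S) e.symm q.asIdeal
    exact h1.trans_eq h3

theorem map_face_star {n : ℕ} (j : Fin (n + 2)) (a : kˣ) (P : PrimeSpectrum (Q k (n + 1))) :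
    (starPoint a P).asIdeal.map (faceHom j) =
      (P.asIdeal.map (faceHom j)).comap ((scaleEquiv a : Q k n ≃+* Q k n) : Q k n →+* Q k n) := by
  have hf : ∀ x : Q k (n + 1), faceHom j (scaleEquiv a x) = scaleEquiv a (faceHom j x) :=
    fun x => face_scale j a x
  apply le_antisymm
  · rw [Ideal.map_le_iff_le_comap]
    intro x hx
    rw [Ideal.mem_comap, Ideal.mem_comap, RingEquiv.coe_toRingHom, ← hf]
    exact Ideal.mem_map_of_mem _ ((mem_starPoint a P x).1 hx)
  · have h1 : P.asIdeal.map (faceHom j) ≤ ((starPoint a P).asIdeal.map (faceHom j)).comap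
          ((scaleEquiv a : Q k n ≃+* Q k n).symm : Q k n →+* Q k n) := by
      rw [Ideal.map_le_iff_le_comap]
      intro x hx
      obtain ⟨y, rfl⟩ := (scaleEquiv a : Q k (n + 1) ≃+* Q k (n + 1)).surjective x
      rw [Ideal.mem_comap, Ideal.mem_comap, RingEquiv.coe_toRingHom, hf,
        RingEquiv.symm_apply_apply]
      exact Ideal.mem_map_of_mem _ ((mem_starPoint a P y).2 hx)
    intro x hx
    have h2 := h1 (Ideal.mem_comap.1 hx)
    rwa [Ideal.mem_comap, RingEquiv.coe_toRingHom, RingEquiv.coe_toRingHom,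
      RingEquiv.symm_apply_apply] at h2

theorem restrict_single {n : ℕ} (j : Fin (n + 2)) (P : PrimeSpectrum (Q k (n + 1))) (m : ℤ) :
    restrict j (Finsupp.single P m) =
      m • fundamentalCycle (P.asIdeal.map (faceHom j)) := by
  simp [restrict]

theorem starCycle_single {n : ℕ} (a : kˣ) (P : PrimeSpectrum (Q k n)) (m : ℤ) :
    starCycle a (Finsupp.single P m) = Finsupp.single (starPoint a P) m :=
  Finsupp.mapDomain_single

theorem restrict_star {n : ℕ} (j : Fin (n + 2)) (a : kˣ) (z : Cycle k (n + 1)) :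
    restrict j (starCycle a z) = starCycle a (restrict j z) := by
  induction z using Finsupp.induction_linear with
  | zero => simp
  | add x y hx hy => simp only [map_add, hx, hy]
  | single P m =>
    rw [starCycle_single, restrict_single, restrict_single, map_zsmul, map_face_star,
      fundamentalCycle_comap]
    rfl

theorem boundary_star {n : ℕ} (a : kˣ) (z : Cycle k n) :
    boundary k n (starCycle a z) = starCycle a (boundary k n z) := by
  cases n with
  | zero => simp [boundary]
  | succ n =>
    simp only [boundary, AddMonoidHom.finsetSum_apply, AddMonoidHom.smul_apply, restrict_star]
    rw [map_sum]
    exact Finset.sum_congr rfl fun j _ => (map_zsmul _ _ _).symm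

theorem goodCycles_star {p n : ℕ} (a : kˣ) {z : Cycle k n} (hz : z ∈ goodCycles k p n) :
    starCycle a z ∈ goodCycles k p n := by
  classical
  intro P hP
  obtain ⟨P', hP', rfl⟩ := Finset.mem_image.1 (Finsupp.mapDomain_support hP)
  exact IsGood.star (hz hP') a

theorem closedCycles_star {p n : ℕ} (a : kˣ) {z : Cycle k n} (hz : z ∈ closedCycles k p n) :
    starCycle a z ∈ closedCycles k p n := by
  refine ⟨goodCycles_star a hz.1, ?_⟩
  have h : boundary k n z = 0 := hz.2
  change boundary k n (starCycle a z) = 0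
  rw [boundary_star, h, map_zero]

theorem boundaries_star {p n : ℕ} (a : kˣ) {z : Cycle k n} (hz : z ∈ boundaries k p n) :
    starCycle a z ∈ boundaries k p n := by
  obtain ⟨w, hw, rfl⟩ := hz
  exact ⟨starCycle a w, goodCycles_star a hw, boundary_star a w⟩

/-- The action `x ↦ a ⋆ x` of `a ∈ kˣ` on `SH^p(k, n)`. -/
def star {p n : ℕ} (a : kˣ) : SH k p n →+ SH k p n :=
  QuotientAddGroup.map _ _
    (((starCycle a).comp (closedCycles k p n).subtype).codRestrict (closedCycles k p n)
      (fun z => closedCycles_star a z.2))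
    (fun _ hz => boundaries_star a hz)

end Star

/-! ### Rational points -/

section Points

variable {k : Type u} [Field k]

/-- The `k`-rational point of `Q^n` with coordinates `v`, as the kernel of the evaluation at
`v`. -/
def ratPoint {n : ℕ} (v : Fin (n + 1) → k) (hv : ∑ i, v i = 0) : PrimeSpectrum (Q k n) :=
  ⟨RingHom.ker (lift v hv : Q k n →ₐ[k] k), RingHom.ker_isPrime _⟩

theorem lift_algebraMap_sub_mem {n : ℕ} (v : Fin (n + 1) → k) (hv : ∑ i, v i = 0)
    (x : Q k n) : algebraMap k (Q k n) (lift v hv x) - x ∈ (ratPoint v hv).asIdeal := by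
  change lift v hv _ = 0
  rw [map_sub, AlgHom.commutes]
  exact sub_self _

/-- A rational point without zero coordinates lies on no face. -/
theorem eq_top_of_ratPoint_le {n : ℕ} {A : Type*} [CommRing A] (v : Fin (n + 1) → k)
    (hv : ∑ i, v i = 0) (f : Q k n →+* A) (J : Ideal A) (i : Fin (n + 1)) (hi : v i ≠ 0)
    (h : (ratPoint v hv).asIdeal ≤ J.comap f) (ht : f (t i) ∈ J) : J = ⊤ := by
  have h1 := h (lift_algebraMap_sub_mem v hv (t i))
  rw [Ideal.mem_comap, map_sub, lift_t] at h1
  have h2 := J.add_mem h1 ht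
  rw [sub_add_cancel] at h2
  exact J.eq_top_of_isUnit_mem h2 (((IsUnit.mk0 _ hi).map (algebraMap k (Q k n))).map f)

/-- The height of a rational point of affine space is the dimension. -/
theorem height_ker_aeval : ∀ {n : ℕ} (v : Fin n → k),
    (RingHom.ker (MvPolynomial.aeval v : MvPolynomial (Fin n) k →ₐ[k] k)).height = n
  | 0, v => by
    have : RingHom.ker (MvPolynomial.aeval v : MvPolynomial (Fin 0) k →ₐ[k] k) = ⊥ := by
      rw [eq_bot_iff]
      intro x hx
      obtain ⟨c, rfl⟩ := MvPolynomial.C_surjective (Fin 0) x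
      rw [RingHom.mem_ker, MvPolynomial.aeval_C] at hx
      have hc : c = 0 := hx
      simp [hc]
    rw [this]
    simp
  | n + 1, v => by
    let e : Polynomial (MvPolynomial (Fin n) k) ≃+* MvPolynomial (Fin (n + 1)) k :=
      (MvPolynomial.finSuccEquiv k n).symm.toRingEquiv
    let M := RingHom.ker (MvPolynomial.aeval v : MvPolynomial (Fin (n + 1)) k →ₐ[k] k)
    let p := RingHom.ker
      (MvPolynomial.aeval (fun i => v i.succ) : MvPolynomial (Fin n) k →ₐ[k] k)
    have hM : M.IsMaximal := RingHom.ker_isMaximal_of_surjective _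
      (fun c => ⟨MvPolynomial.C c, by simp⟩)
    have hp : p.IsMaximal := RingHom.ker_isMaximal_of_surjective _
      (fun c => ⟨MvPolynomial.C c, by simp⟩)
    have hP : (M.comap e).IsMaximal := Ideal.comap_isMaximal_of_equiv e
    have hC : ∀ x : MvPolynomial (Fin n) k, MvPolynomial.aeval v (e (Polynomial.C x)) =
        MvPolynomial.aeval (fun i => v i.succ) x := by
      intro x
      induction x using MvPolynomial.induction_on with
      | C c =>
        have h : e (Polynomial.C (MvPolynomial.C c)) = MvPolynomial.C c := by
          change (MvPolynomial.finSuccEquiv k n).symm _ = _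
          exact RingHom.congr_fun (MvPolynomial.finSuccEquiv_comp_C_eq_C (R := k) n) c
        rw [h, MvPolynomial.aeval_C, MvPolynomial.aeval_C]
      | add p q hp hq => simp only [map_add, hp, hq]
      | mul_X p i hp =>
        have h : e (Polynomial.C (MvPolynomial.X i)) = MvPolynomial.X i.succ := by
          change (MvPolynomial.finSuccEquiv k n).symm _ = _
          rw [AlgEquiv.symm_apply_eq, MvPolynomial.finSuccEquiv_X_succ]
        simp only [map_mul, hp, h, MvPolynomial.aeval_X]
    have hover : (M.comap e).LiesOver p := ⟨by
      ext x
      change MvPolynomial.aeval (fun i => v i.succ) x = 0 ↔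
        MvPolynomial.aeval v (e (Polynomial.C x)) = 0
      rw [hC]⟩
    have h1 := Polynomial.height_eq_height_add_one p (M.comap e)
    have h2 : p.height = n := height_ker_aeval _
    rw [RingEquiv.height_comap, h2] at h1
    exact_mod_cast h1

theorem height_ratPoint {n : ℕ} (v : Fin (n + 1) → k) (hv : ∑ i, v i = 0) :
    (ratPoint v hv).asIdeal.height = n := by
  set r : MvPolynomial (Fin (n + 1)) k := ∑ i, MvPolynomial.X i with hr
  have hr0 : r ≠ 0 := by
    intro h
    have h1 := congrArg (MvPolynomial.aeval (Pi.single 0 1 : Fin (n + 1) → k)) h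
    simp [hr, map_sum] at h1
  have hker : (ratPoint v hv).asIdeal.comap (Q.mk k n) =
      RingHom.ker (MvPolynomial.aeval v : MvPolynomial (Fin (n + 1)) k →ₐ[k] k) := rfl
  apply le_antisymm
  · have h1 := ringKrullDim_succ_le_of_surjective (Q.mk k n : MvPolynomial (Fin (n + 1)) k →+* Q k n)
      (Q.mk_surjective k n) (mem_nonZeroDivisors_of_ne_zero hr0) (by
        have := sum_t (k := k) n
        unfold t at this
        rw [← map_sum] at this
        exact this)
    rw [MvPolynomial.ringKrullDim_of_isNoetherianRing, ringKrullDim_eq_zero_of_field, zero_add] at h1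
    have h2 := (add_le_add_left
      (Ideal.height_le_ringKrullDim_of_ne_top (ratPoint v hv).isPrime.ne_top) 1).trans h1
    rw [Nat.card_eq_fintype_card, Fintype.card_fin] at h2
    have h3 : (ratPoint v hv).asIdeal.height + 1 ≤ (n : ℕ∞) + 1 := by exact_mod_cast h2
    exact (ENat.add_le_add_iff_right (by simp)).1 h3
  · have h1 : (RingHom.ker (MvPolynomial.aeval v :
        MvPolynomial (Fin (n + 1)) k →ₐ[k] k)).height = (n + 1 : ℕ) := height_ker_aeval v
    have hmem : r ∈ RingHom.ker (MvPolynomial.aeval v : MvPolynomial (Fin (n + 1)) k →ₐ[k] k) := by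
      rw [RingHom.mem_ker, hr, map_sum]
      simpa using hv
    have hpr : (RingHom.ker
        (MvPolynomial.aeval v : MvPolynomial (Fin (n + 1)) k →ₐ[k] k)).IsPrime :=
      RingHom.ker_isPrime _
    have h2 : (RingHom.ker (MvPolynomial.aeval v : MvPolynomial (Fin (n + 1)) k →ₐ[k] k)).height ≤
        ((RingHom.ker (MvPolynomial.aeval v : MvPolynomial (Fin (n + 1)) k →ₐ[k] k)).map
          (Q.mk k n)).height + 1 := Ideal.height_le_height_add_one_of_mem hmem
    rw [h1, ← hker, Ideal.map_comap_of_surjective _ (Q.mk_surjective k n)] at h2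
    have h3 : (n : ℕ∞) + 1 ≤ (ratPoint v hv).asIdeal.height + 1 := by exact_mod_cast h2
    exact (ENat.add_le_add_iff_right (by simp)).1 h3

theorem isGood_ratPoint {n : ℕ} (v : Fin (n + 1) → k) (hv : ∑ i, v i = 0)
    (h0 : ∀ i, v i ≠ 0) : IsGood n (ratPoint v hv) where
  height_eq := height_ratPoint v hv
  vertex := fun h => by
    have h1 := eq_top_of_ratPoint_le v hv (RingHom.id _)
      (Ideal.span (Set.range (t : Fin (n + 1) → Q k n))) 0 (h0 0) h
      (Ideal.subset_span ⟨0, rfl⟩)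
    have h2 : Ideal.span (Set.range (t : Fin (n + 1) → Q k n)) ≤
        RingHom.ker (lift (fun _ => (0 : k)) (by simp) : Q k n →ₐ[k] k) := by
      rw [Ideal.span_le]
      rintro _ ⟨i, rfl⟩
      exact lift_t _ (by simp) i
    exact RingHom.ker_ne_top _ (top_le_iff.1 (h1 ▸ h2))
  face := fun S hS q hq => by
    obtain ⟨i, hi⟩ := hS
    refine absurd (eq_top_of_ratPoint_le v hv _ _ i (h0 i) hq ?_) q.isPrime.ne_top
    have : Ideal.Quotient.mk (Ideal.span ((t : Fin (n + 1) → Q k n) '' S)) (t i) = 0 :=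
      Ideal.Quotient.eq_zero_iff_mem.2 (Ideal.subset_span ⟨i, hi, rfl⟩)
    rw [this]
    exact zero_mem _

theorem fundamentalCycle_top {B : Type*} [CommRing B] [IsNoetherianRing B] :
    fundamentalCycle (⊤ : Ideal B) = 0 := by
  ext q
  have : q.asIdeal ∉ (⊤ : Ideal B).minimalPrimes := fun h =>
    q.isPrime.ne_top (top_le_iff.1 h.1.2)
  simp only [fundamentalCycle, Finsupp.ofSupportFinite_coe, if_neg this, Finsupp.coe_zero, Pi.zero_apply]

theorem ratPoint_mem {n : ℕ} (v : Fin (n + 2) → k) (hv : ∑ i, v i = 0)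
    (h0 : ∀ i, v i ≠ 0) :
    (Finsupp.single (ratPoint v hv) 1 : Cycle k (n + 1)) ∈ closedCycles k (n + 1) (n + 1) := by
  refine ⟨Finsupp.single_mem_supported ℤ (1 : ℤ) (isGood_ratPoint v hv h0), ?_⟩
  change boundary k (n + 1) _ = 0
  simp only [boundary, AddMonoidHom.finsetSum_apply, AddMonoidHom.smul_apply]
  refine Finset.sum_eq_zero fun j _ => ?_
  have h : (ratPoint v hv).asIdeal.map (faceHom j) = ⊤ := by
    refine eq_top_of_ratPoint_le v hv (faceHom j) _ j (h0 j) Ideal.le_comap_map ?_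
    have h1 : faceHom j (t j : Q k (n + 1)) = 0 := by
      have := face_t (k := k) j j
      rwa [Fin.insertNth_apply_same] at this
    rw [h1]
    exact zero_mem _
  rw [restrict_single, h, fundamentalCycle_top, smul_zero, smul_zero]

/-- The class in `SH^(n+1)(k, n+1)` of the `k`-rational point of `Q^(n+1)` with coordinates `v`,
which is in good position as soon as no coordinate is zero. -/
def pointClass {n : ℕ} (v : Fin (n + 2) → k) (hv : ∑ i, v i = 0) (h0 : ∀ i, v i ≠ 0) :
    SH k (n + 1) (n + 1) :=
  QuotientAddGroup.mk ⟨Finsupp.single (ratPoint v hv) 1, ratPoint_mem v hv h0⟩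

end Points

/-! ### Differential forms and the map `φ` -/

section Phi

variable (k : Type u) [Field k]

/-- The absolute Kähler differential forms `Ω^n_k` of the field `k`. -/
abbrev Forms (n : ℕ) : Type u := ⋀[k]^n Ω[k⁄ℤ]

variable {k}

/-- The form `d log b = b⁻¹ db`. -/
def dlog (b : kˣ) : Ω[k⁄ℤ] := ((b⁻¹ : kˣ) : k) • KaehlerDifferential.D ℤ k (b : k)

/-- The form `d log b_1 ∧ … ∧ d log b_n`. -/
def dlogWedge {n : ℕ} (b : Fin n → kˣ) : Forms k n :=
  exteriorPower.ιMulti k n fun i => dlog (b i)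

/-- The coordinates `(-1, b_1 / c, …, b_n / c, -1 / c)`, where `c = -1 + ∑ b_i`. -/
def symbolPoint {n : ℕ} (b : Fin n → kˣ) : Fin (n + 2) → k :=
  Fin.cons (-1) (Fin.snoc (α := fun _ => k)
    (fun i => (b i : k) / (-1 + ∑ i, (b i : k))) (-1 / (-1 + ∑ i, (b i : k))))

theorem symbolPoint_sum {n : ℕ} (b : Fin n → kˣ) (hc : -1 + ∑ i, (b i : k) ≠ 0) :
    ∑ i, symbolPoint b i = 0 := by
  simp only [symbolPoint, Fin.sum_univ_succ (n := n + 1), Fin.cons_zero, Fin.cons_succ,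
    Fin.sum_univ_castSucc, Fin.snoc_castSucc, Fin.snoc_last]
  rw [← Finset.sum_div]
  field_simp
  ring

theorem symbolPoint_ne_zero {n : ℕ} (b : Fin n → kˣ) (hc : -1 + ∑ i, (b i : k) ≠ 0)
    (i : Fin (n + 2)) : symbolPoint b i ≠ 0 := by
  refine Fin.cases ?_ (fun i => ?_) i
  · simp [symbolPoint]
  · refine Fin.lastCases ?_ (fun i => ?_) i
    · simp [symbolPoint, hc]
    · simp [symbolPoint, hc]

/-- `φ` is the `k`-linear map `Ω^n_k → SH^(n+1)(k, n+1)` with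
`φ(a d log b_1 ∧ … ∧ d log b_n) = a ⋆ (-1, b_1 / c, …, b_n / c, -1 / c)`, where
`c = -1 + ∑ b_i` (for `c = 0` the form `d log b_1 ∧ … ∧ d log b_n` is zero). The action of `k` on
the target extends that of `kˣ` by `0 ⋆ x = 0`. -/
structure IsPhi {n : ℕ} (φ : Forms k n →+ SH k (n + 1) (n + 1)) : Prop where
  map_smul : ∀ (a : kˣ) (ω : Forms k n), φ ((a : k) • ω) = star a (φ ω)
  map_dlogWedge : ∀ (b : Fin n → kˣ) (hc : -1 + ∑ i, (b i : k) ≠ 0),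
    φ (dlogWedge b) = pointClass (symbolPoint b) (symbolPoint_sum b hc) (symbolPoint_ne_zero b hc)

end Phi

end AdditiveChow

end

open scoped BigOperators KaehlerDifferential

noncomputable section

namespace AdditiveChow

universe u

/-! ### Heights of kernels of evaluation homomorphisms -/

section Height

/-! In degree `n + 1`, cycles in good position are sums of closed points off all faces, and the
relations are boundaries of curves in Q^(n+2). Every relation used here comes from a curve
parametrized by a line or a punctured line over a finite extension of `k`, with pairwise coprime
coordinates. By the projection formula (`IsGoodCurve.exists_smul_fundamentalCycle`) a multiple of
the image curve has as boundary the alternating sum of the zeros of its coordinates, so the image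
need be neither normal nor birational to its parameter line.

A point `v` is described by its tail sums R_m = ∑_{i ≥ m} v_i. If an inner tail sum vanishes, so
does the class (`torusClass_eq_zero_of_sum_Ioi`). Otherwise `v` is determined by x = 1 / R_1 and β_i
= 1 - R_i / R_(i+1), and its class `formClass k x β` is to be the image of x d log β_1 ∧ … ∧ d log
β_n. Two families of curves give what is needed. Scaling a tail (`torusClass_scaleTail_add`) shows
that the class is additive in x and takes products in each β_i to sums. Exchanging two neighbouring
coordinates changes the sign (`torusClass_add_swap`). For the first two coordinates this is the
relation a d log a + (1 - a) d log (1 - a) = 0; for later ones it is d log (x / (1 - b)) ∧ d log b +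
d log (b / (1 - x)) ∧ d log x = 0.

The first relation says that a ↦ a · (symbol of a) is a derivation, which yields a map out of Ω; the
second forces the symbol to be alternating over an infinite field (`add_swap_eq_zero_of_adjacent`).
Thus φ exists (`exists_alternatingMap_of_adjacent`). Its values on the prescribed points are right
because passing from b_i to β_i = -b_i / (-1 + ∑_{l > i} b_l) is a unitriangular substitution on
logarithmic forms (`dlogWedge_eq`). Uniqueness holds because these forms span.

For surjectivity, closed points reduce to rational points by induction on the degree
(`pointCycle_mem_rationalCycles`): a point over K = L[α] is the only point on one face of a curve
over the line over L whose zeros on the other faces have smaller degree. This needs `k` infinite, or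
n = 0, where an explicit curve serves. For `k` finite and n ≥ 1 both sides vanish: a class killed by
both q - 1 and q is zero. -/

theorem height_le_height_map_C {B : Type*} [CommRing B] [IsNoetherianRing B] (p : Ideal B)
    [p.IsPrime] : p.height ≤ (p.map (Polynomial.C : B →+* Polynomial B)).height := by
  have hP : (p.map (Polynomial.C : B →+* Polynomial B)).IsPrime :=
    Ideal.isPrime_map_C_of_isPrime
  have : (p.map (Polynomial.C : B →+* Polynomial B)).LiesOver p := ⟨by
    ext x
    rw [Ideal.mem_comap, Polynomial.algebraMap_eq, Ideal.mem_map_C_iff]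
    refine ⟨fun hx i => ?_, fun h => by simpa using h 0⟩
    rw [Polynomial.coeff_C]
    split_ifs
    · exact hx
    · exact p.zero_mem⟩
  rw [Ideal.height_eq_height_add_of_liesOver_of_hasGoingDown p
    (p.map (Polynomial.C : B →+* Polynomial B))]
  exact le_self_add

/-- The kernel of an evaluation of polynomials over a domain at algebraic elements has height at
least the number of variables. -/
theorem le_height_ker_aeval {B R : Type*} [CommRing B] [IsDomain B] [IsNoetherianRing B]
    [CommRing R] [IsDomain R] [Algebra B R] (hinj : Function.Injective (algebraMap B R)) :
    ∀ {m : ℕ} (v : Fin m → R), (∀ i, IsAlgebraic B (v i)) →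
    (m : ℕ∞) ≤ (RingHom.ker (MvPolynomial.aeval v : MvPolynomial (Fin m) B →ₐ[B] R)).height
  | 0, _, _ => by simp
  | m + 1, v, hv => by
    let e : Polynomial (MvPolynomial (Fin m) B) ≃+* MvPolynomial (Fin (m + 1)) B :=
      (MvPolynomial.finSuccEquiv B m).symm.toRingEquiv
    let P := RingHom.ker (MvPolynomial.aeval v : MvPolynomial (Fin (m + 1)) B →ₐ[B] R)
    let p := RingHom.ker
      (MvPolynomial.aeval (fun i => v i.succ) : MvPolynomial (Fin m) B →ₐ[B] R)
    have hP : P.IsPrime := RingHom.ker_isPrime _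
    have hp : p.IsPrime := RingHom.ker_isPrime _
    have hPe : (P.comap e).IsPrime := Ideal.comap_isPrime e P
    have hpC : (p.map (Polynomial.C : _ →+* Polynomial (MvPolynomial (Fin m) B))).IsPrime :=
      Ideal.isPrime_map_C_of_isPrime
    have hev : ∀ x, MvPolynomial.aeval v (e x) =
        Polynomial.eval₂ (MvPolynomial.aeval (fun i => v i.succ) :
          MvPolynomial (Fin m) B →ₐ[B] R).toRingHom (v 0) x := by
      intro x
      obtain ⟨y, rfl⟩ := (MvPolynomial.finSuccEquiv B m).surjective x
      have h1 : e (MvPolynomial.finSuccEquiv B m y) = y :=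
        (MvPolynomial.finSuccEquiv B m).symm_apply_apply y
      rw [h1]
      induction y using MvPolynomial.induction_on with
      | C c => simp [MvPolynomial.finSuccEquiv_apply]
      | add p q hp hq => simp only [map_add, Polynomial.eval₂_add,
          hp ((MvPolynomial.finSuccEquiv B m).symm_apply_apply p),
          hq ((MvPolynomial.finSuccEquiv B m).symm_apply_apply q)]
      | mul_X p i hp =>
        rw [map_mul, map_mul, Polynomial.eval₂_mul,
          hp ((MvPolynomial.finSuccEquiv B m).symm_apply_apply p), MvPolynomial.aeval_X]
        congr 1
        refine Fin.cases ?_ (fun i => ?_) i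
        · simp [MvPolynomial.finSuccEquiv_X_zero]
        · simp [MvPolynomial.finSuccEquiv_X_succ]
    -- An algebraic equation of `v 0` lies in the kernel but not in the extension of `p`, since `B`
    -- injects into `R`. Each variable therefore adds one to the height.
    have hlt : p.map Polynomial.C < P.comap e := by
      refine lt_of_le_of_ne ?_ ?_
      · rw [Ideal.map_le_iff_le_comap]
        intro x hx
        change MvPolynomial.aeval v (e (Polynomial.C x)) = 0
        rw [hev, Polynomial.eval₂_C]
        exact hx
      · intro heq
        obtain ⟨f, hf0, hf⟩ := hv 0
        have h1 : f.map (MvPolynomial.C : B →+* MvPolynomial (Fin m) B) ∈ P.comap e := by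
          change MvPolynomial.aeval v (e _) = 0
          rw [hev, Polynomial.eval₂_map]
          rw [Polynomial.aeval_def] at hf
          have hc : ((MvPolynomial.aeval (fun i => v i.succ) :
              MvPolynomial (Fin m) B →ₐ[B] R).toRingHom).comp MvPolynomial.C =
              algebraMap B R := RingHom.ext fun x => by simp
          rw [hc]
          exact hf
        rw [← heq, Ideal.mem_map_C_iff] at h1
        apply hf0
        ext i
        have h2 := h1 i
        rw [Polynomial.coeff_map, RingHom.mem_ker, MvPolynomial.aeval_C] at h2
        exact hinj (by simpa using h2)
    have h1 := Ideal.height_add_one_le_of_lt_of_isPrime hlt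
    have h2 : (m : ℕ∞) ≤ p.height := le_height_ker_aeval hinj _ (fun i => hv i.succ)
    rw [RingEquiv.height_comap] at h1
    push_cast
    exact (add_le_add (h2.trans (height_le_height_map_C p)) le_rfl).trans h1

/-- A variant of `le_height_ker_aeval` over a field, where one of the elements is allowed to be
transcendental. -/
theorem le_height_ker_aeval_of_transcendental {k R : Type u} [Field k] [CommRing R] [IsDomain R]
    [Algebra k R] {m : ℕ} (v : Fin (m + 1) → R) (hdim : Algebra.trdeg k R ≤ 1)
    (j : Fin (m + 1)) (hj : Transcendental k (v j)) :
    (m : ℕ∞) ≤ (RingHom.ker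
      (MvPolynomial.aeval v : MvPolynomial (Fin (m + 1)) k →ₐ[k] R)).height := by
  -- The transcendental element is absorbed into the base: over k[X] with X ↦ `v j` all other
  -- elements are algebraic, because the transcendence degree is at most one.
  let : Algebra (Polynomial k) R := (Polynomial.aeval (v j)).toRingHom.toAlgebra
  have hmap : ∀ p : Polynomial k, algebraMap (Polynomial k) R p = Polynomial.aeval (v j) p :=
    fun _ => rfl
  have hinj : Function.Injective (algebraMap (Polynomial k) R) :=
    transcendental_iff_injective.1 hj
  have hai : AlgebraicIndependent k (fun _ : PUnit.{u + 1} => v j) :=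
    (algebraicIndependent_unique_type_iff (x := fun _ : PUnit.{u + 1} => v j)).2 hj
  have hb := hai.isTranscendenceBasis_of_trdeg_le_of_finite (by simpa using hdim)
  have halg : ∀ x : R, IsAlgebraic (Polynomial k) x := by
    intro x
    have h1 := hb.isAlgebraic.isAlgebraic x
    obtain ⟨p, hp0, hp⟩ := h1
    let e : Polynomial k →ₐ[k] Algebra.adjoin k (Set.range fun _ : PUnit.{u + 1} => v j) :=
      Polynomial.aeval ⟨v j, Algebra.subset_adjoin ⟨PUnit.unit, rfl⟩⟩
    have hes : Function.Surjective e := by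
      rintro ⟨y, hy⟩
      have hy' : y ∈ Algebra.adjoin k {v j} := by simpa using hy
      rw [Algebra.adjoin_singleton_eq_range_aeval] at hy'
      obtain ⟨q, hq⟩ := hy'
      refine ⟨q, Subtype.ext (Eq.trans ?_ hq)⟩
      change (Algebra.adjoin k _).val (Polynomial.aeval _ q) = _
      rw [← Polynomial.aeval_algHom_apply]
      rfl
    obtain ⟨q, hq⟩ := Polynomial.map_surjective e.toRingHom hes p
    refine ⟨q, ?_, ?_⟩
    · rintro rfl
      simp at hq
      exact hp0 hq.symm
    · rw [← hq] at hp
      rw [Polynomial.aeval_def] at hp ⊢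
      rw [Polynomial.eval₂_map] at hp
      have hc : (algebraMap (Algebra.adjoin k (Set.range fun _ : PUnit.{u + 1} => v j)) R).comp
          e.toRingHom = algebraMap (Polynomial k) R := by
        ext y
        · change (Algebra.adjoin k _).val (e (Polynomial.C y)) = Polynomial.aeval (v j) _
          simp [e]
        · change (Algebra.adjoin k _).val (e Polynomial.X) = Polynomial.aeval (v j) _
          simp [e]
      rw [hc] at hp
      exact hp
  have h1 := le_height_ker_aeval hinj (fun i => v (j.succAbove i)) (fun i => halg _)
  -- The variable with index `j` is moved into the coefficients.
  let e : MvPolynomial (Fin (m + 1)) k ≃ₐ[k] MvPolynomial (Fin m) (Polynomial k) :=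
    (MvPolynomial.renameEquiv k (finSuccEquiv' j)).trans (MvPolynomial.optionEquivRight k (Fin m))
  have hcomp : ∀ x, MvPolynomial.aeval (fun i => v (j.succAbove i)) (e x) =
      MvPolynomial.aeval v x := by
    intro x
    induction x using MvPolynomial.induction_on with
    | C c =>
      have : e (MvPolynomial.C c) = MvPolynomial.C (Polynomial.C c) := by simp [e]
      rw [this, MvPolynomial.aeval_C, MvPolynomial.aeval_C, hmap, Polynomial.aeval_C]
    | add p q hp hq => simp only [map_add, hp, hq]
    | mul_X p i hp =>
      rw [map_mul, map_mul, map_mul, hp]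
      congr 1
      rw [MvPolynomial.aeval_X]
      refine Fin.succAboveCases j ?_ (fun i => ?_) i
      · have : e (MvPolynomial.X j) = MvPolynomial.C Polynomial.X := by simp [e]
        rw [this, MvPolynomial.aeval_C, hmap, Polynomial.aeval_X]
      · have : e (MvPolynomial.X (j.succAbove i)) = MvPolynomial.X i := by simp [e]
        rw [this, MvPolynomial.aeval_X]
  have h2 : RingHom.ker (MvPolynomial.aeval v : MvPolynomial (Fin (m + 1)) k →ₐ[k] R) =
      (RingHom.ker (MvPolynomial.aeval (fun i => v (j.succAbove i)) :
        MvPolynomial (Fin m) (Polynomial k) →ₐ[Polynomial k] R)).comap e.toRingEquiv := by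
    ext x
    change MvPolynomial.aeval v x = 0 ↔ MvPolynomial.aeval _ (e x) = 0
    rw [hcomp]
  rw [h2, RingEquiv.height_comap]
  exact h1

variable {k : Type u} [Field k]

/-- The dimension of `Q^n` is at most `n`. -/
theorem Q.height_le {n : ℕ} {I : Ideal (Q k n)} (hI : I ≠ ⊤) : I.height ≤ n := by
  set r : MvPolynomial (Fin (n + 1)) k := ∑ i, MvPolynomial.X i with hr
  have hr0 : r ≠ 0 := by
    intro h
    have h1 := congrArg (MvPolynomial.aeval (Pi.single 0 1 : Fin (n + 1) → k)) h
    simp [hr, map_sum] at h1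
  have h1 := ringKrullDim_succ_le_of_surjective (Q.mk k n : MvPolynomial (Fin (n + 1)) k →+* Q k n)
    (Q.mk_surjective k n) (mem_nonZeroDivisors_of_ne_zero hr0) (by
      have := sum_t (k := k) n
      unfold t at this
      rw [← map_sum] at this
      exact this)
  rw [MvPolynomial.ringKrullDim_of_isNoetherianRing, ringKrullDim_eq_zero_of_field, zero_add] at h1
  have h2 := (add_le_add_left (Ideal.height_le_ringKrullDim_of_ne_top hI) 1).trans h1
  rw [Nat.card_eq_fintype_card, Fintype.card_fin] at h2
  have h3 : I.height + 1 ≤ (n : ℕ∞) + 1 := by exact_mod_cast h2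
  exact (ENat.add_le_add_iff_right (by simp)).1 h3

theorem lift_apply_t {n : ℕ} {R : Type*} [CommRing R] [Algebra k R] (f : Q k n →ₐ[k] R) :
    ∑ i, f (t i) = 0 := by
  rw [← map_sum, sum_t, map_zero]

/-- Q^n is cut out of affine space by the single equation ∑ t_i = 0, and one equation lowers the
height by at most one. -/
theorem height_ker_aeval_le {n : ℕ} {R : Type*} [CommRing R] [IsDomain R] [Algebra k R]
    (f : Q k n →ₐ[k] R) :
    (RingHom.ker (MvPolynomial.aeval (fun i => f (t i)) :
      MvPolynomial (Fin (n + 1)) k →ₐ[k] R)).height ≤ (RingHom.ker f).height + 1 := by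
  have hf : ∀ x, f (Q.mk k n x) = MvPolynomial.aeval (fun i => f (t i)) x := fun x => by
    have : f.comp (Q.mk k n) = MvPolynomial.aeval (fun i => f (t i)) :=
      MvPolynomial.algHom_ext fun i => by rw [MvPolynomial.aeval_X]; rfl
    exact AlgHom.congr_fun this x
  have hmem : (∑ i, MvPolynomial.X i : MvPolynomial (Fin (n + 1)) k) ∈
      RingHom.ker (MvPolynomial.aeval (fun i => f (t i)) :
        MvPolynomial (Fin (n + 1)) k →ₐ[k] R) := by
    rw [RingHom.mem_ker, map_sum]
    simpa using lift_apply_t f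
  have hker : (RingHom.ker f).comap (Q.mk k n) = RingHom.ker
      (MvPolynomial.aeval (fun i => f (t i)) : MvPolynomial (Fin (n + 1)) k →ₐ[k] R) := by
    ext x
    rw [Ideal.mem_comap, RingHom.mem_ker, RingHom.mem_ker, hf]
  have hpr : (RingHom.ker (MvPolynomial.aeval (fun i => f (t i)) :
      MvPolynomial (Fin (n + 1)) k →ₐ[k] R)).IsPrime := RingHom.ker_isPrime _
  have h2 : (RingHom.ker (MvPolynomial.aeval (fun i => f (t i)) :
      MvPolynomial (Fin (n + 1)) k →ₐ[k] R)).height ≤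
      ((RingHom.ker (MvPolynomial.aeval (fun i => f (t i)) :
        MvPolynomial (Fin (n + 1)) k →ₐ[k] R)).map (Q.mk k n)).height + 1 :=
    Ideal.height_le_height_add_one_of_mem hmem
  rw [← hker, Ideal.map_comap_of_surjective _ (Q.mk_surjective k n)] at h2
  rw [← hker]
  exact h2

theorem Q.le_height_ker {n : ℕ} {R : Type*} [CommRing R] [IsDomain R] [Algebra k R]
    [Algebra.IsAlgebraic k R] (f : Q k n →ₐ[k] R) : (n : ℕ∞) ≤ (RingHom.ker f).height := by
  have h1 := (le_height_ker_aeval (algebraMap k R).injective (fun i => f (t i))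
    (fun i => Algebra.IsAlgebraic.isAlgebraic _)).trans (height_ker_aeval_le f)
  have h3 : (n : ℕ∞) + 1 ≤ (RingHom.ker f).height + 1 := by exact_mod_cast h1
  exact (ENat.add_le_add_iff_right (by simp)).1 h3

/-- Of the `n + 2` variables, one is lost to the transcendental coordinate and one to the relation ∑
t_i = 0. -/
theorem Q.le_height_ker_of_transcendental {n : ℕ} {R : Type u} [CommRing R] [IsDomain R]
    [Algebra k R] (hdim : Algebra.trdeg k R ≤ 1) (f : Q k (n + 1) →ₐ[k] R) (j : Fin (n + 2))
    (hj : Transcendental k (f (t j))) : (n : ℕ∞) ≤ (RingHom.ker f).height := by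
  have h1 := (le_height_ker_aeval_of_transcendental (fun i => f (t i)) hdim j hj).trans
    (height_ker_aeval_le f)
  have h3 : (n : ℕ∞) + 1 ≤ (RingHom.ker f).height + 1 := by exact_mod_cast h1
  exact (ENat.add_le_add_iff_right (by simp)).1 h3

instance (n : ℕ) : Algebra.FiniteType k (Q k n) :=
  Algebra.FiniteType.of_surjective (Q.mk k n) (Q.mk_surjective k n)

/-- The height of a maximal ideal of the coordinate ring of `Q^n` is `n`. -/
theorem Q.height_eq_of_isMaximal {n : ℕ} (q : Ideal (Q k n)) [hq : q.IsMaximal] :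
    q.height = n := by
  refine le_antisymm (Q.height_le hq.ne_top) ?_
  let := Ideal.Quotient.field q
  have hft : Algebra.FiniteType k (Q k n ⧸ q) :=
    Algebra.FiniteType.of_surjective (Ideal.Quotient.mkₐ k q) Ideal.Quotient.mk_surjective
  have : Module.Finite k (Q k n ⧸ q) := finite_of_finite_type_of_isJacobsonRing k (Q k n ⧸ q)
  have h := Q.le_height_ker (Ideal.Quotient.mkₐ k q)
  have hk : RingHom.ker (Ideal.Quotient.mkₐ k q) = q := Ideal.mk_ker
  rwa [hk] at h

end Height

/-! ### Curves in good position -/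

section Face

variable {k : Type u} [Field k]

theorem face_t_self {n : ℕ} (j : Fin (n + 2)) : face j (t j : Q k (n + 1)) = 0 := by
  rw [face_t, Fin.insertNth_apply_same]

theorem face_t_succAbove {n : ℕ} (j : Fin (n + 2)) (i : Fin (n + 1)) :
    face j (t (j.succAbove i) : Q k (n + 1)) = t i := by
  rw [face_t, Fin.insertNth_apply_succAbove]

theorem range_algHom_eq_top {n : ℕ} {A : Type*} [CommRing A] [Algebra k A] (f : A →ₐ[k] Q k n)
    (h : ∀ i, t i ∈ f.range) : f.range = ⊤ := by
  rw [eq_top_iff]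
  rintro x -
  obtain ⟨p, rfl⟩ := Q.mk_surjective k n x
  induction p using MvPolynomial.induction_on with
  | C c => exact ⟨algebraMap k A c, f.commutes c⟩
  | add p q hp hq => rw [map_add]; exact add_mem hp hq
  | mul_X p i hp => rw [map_mul]; exact mul_mem hp (h i)

theorem face_surjective {n : ℕ} (j : Fin (n + 2)) :
    Function.Surjective (face j : Q k (n + 1) →ₐ[k] Q k n) := by
  rw [← AlgHom.range_eq_top]
  exact range_algHom_eq_top _ fun i => ⟨_, face_t_succAbove j i⟩

theorem ker_face {n : ℕ} (j : Fin (n + 2)) :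
    RingHom.ker (face j : Q k (n + 1) →ₐ[k] Q k n) = Ideal.span {t j} := by
  apply le_antisymm
  · let J : Ideal (Q k (n + 1)) := Ideal.span {t j}
    have hj : Ideal.Quotient.mkₐ k J (t j) = 0 :=
      Ideal.Quotient.eq_zero_iff_mem.2 (Ideal.subset_span rfl)
    have hs : ∑ i, Ideal.Quotient.mkₐ k J (t (j.succAbove i)) = 0 := by
      have h := lift_apply_t (Ideal.Quotient.mkₐ k J)
      rwa [Fin.sum_univ_succAbove _ j, hj, zero_add] at h
    have hcomp : (lift _ hs).comp (face j) = Ideal.Quotient.mkₐ k J := by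
      apply algHom_ext
      intro i
      refine Fin.succAboveCases j ?_ (fun i => ?_) i
      · rw [AlgHom.comp_apply, face_t_self, map_zero, hj]
      · rw [AlgHom.comp_apply, face_t_succAbove, lift_t]
    intro x hx
    have h := AlgHom.congr_fun hcomp x
    rw [AlgHom.comp_apply, (RingHom.mem_ker).1 hx, map_zero] at h
    exact Ideal.Quotient.eq_zero_iff_mem.1 h.symm
  · rw [Ideal.span_le, Set.singleton_subset_iff]
    exact face_t_self j

/-- The height of a maximal ideal of the coordinate ring of a facet of `Q^(n+1)` is `n`. -/
theorem height_faceRing_singleton {n : ℕ} (j : Fin (n + 2))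
    (q : Ideal (FaceRing k ({j} : Finset (Fin (n + 2))))) [hq : q.IsMaximal] :
    q.height = n := by
  let J : Ideal (Q k (n + 1)) :=
    Ideal.span ((t : Fin (n + 2) → Q k (n + 1)) '' ({j} : Finset (Fin (n + 2))))
  have hJ : J = RingHom.ker (face j : Q k (n + 1) →ₐ[k] Q k n) := by
    rw [ker_face]
    simp [J]
  let e : FaceRing k ({j} : Finset (Fin (n + 2))) ≃+* Q k n :=
    (Ideal.quotEquivOfEq hJ).trans (RingHom.quotientKerEquivOfSurjective (face_surjective j))
  have hm : (q.comap e.symm).IsMaximal := Ideal.comap_isMaximal_of_equiv e.symm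
  have h1 := RingEquiv.height_comap e.symm q
  rw [← h1]
  exact Q.height_eq_of_isMaximal _

theorem span_range_t_ne_top {n : ℕ} :
    Ideal.span (Set.range (t : Fin (n + 1) → Q k n)) ≠ ⊤ := by
  have h2 : Ideal.span (Set.range (t : Fin (n + 1) → Q k n)) ≤
      RingHom.ker (lift (fun _ => (0 : k)) (by simp) : Q k n →ₐ[k] k) := by
    rw [Ideal.span_le]
    rintro _ ⟨i, rfl⟩
    exact lift_t _ (by simp) i
  intro h
  exact RingHom.ker_ne_top _ (top_le_iff.1 (h ▸ h2))

end Face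

section Curve

variable {k : Type u} [Field k]

/-- A parametrized curve in `Q^(n+1)` which is in good position with respect to the faces: a
finite-type one-dimensional domain `R`, integral over the image of the coordinate ring, such that
the coordinates are nonzero and pairwise coprime. -/
structure IsGoodCurve {n : ℕ} {R : Type u} [CommRing R] [Algebra k R]
    (f : Q k (n + 1) →ₐ[k] R) : Prop where
  finiteType : Algebra.FiniteType k R
  isIntegral : (f : Q k (n + 1) →+* R).IsIntegral
  trdeg_le : Algebra.trdeg k R ≤ 1
  ne_zero : ∀ j, f (t j) ≠ 0
  isCoprime : ∀ i j, i ≠ j → IsCoprime (f (t i)) (f (t j))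
  exists_not_isUnit : ∃ j, ¬ IsUnit (f (t j))

variable {n : ℕ} {R : Type u} [CommRing R] [Algebra k R] {f : Q k (n + 1) →ₐ[k] R}

theorem exists_isPrime_comap_eq (hint : (f : Q k (n + 1) →+* R).IsIntegral)
    (q : Ideal (Q k (n + 1))) [q.IsPrime] (h : RingHom.ker f ≤ q) :
    ∃ N : Ideal R, N.IsPrime ∧ N.comap f = q := by
  let := (f : Q k (n + 1) →+* R).toAlgebra
  have : Algebra.IsIntegral (Q k (n + 1)) R := ⟨hint⟩
  obtain ⟨N, -, hN, hNq⟩ := Ideal.exists_ideal_over_prime_of_isIntegral q (⊥ : Ideal R) h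
  exact ⟨N, hN, hNq⟩

theorem isMaximal_comap (hint : (f : Q k (n + 1) →+* R).IsIntegral) (N : Ideal R)
    [N.IsMaximal] : (N.comap f).IsMaximal := by
  let := (f : Q k (n + 1) →+* R).toAlgebra
  have : Algebra.IsIntegral (Q k (n + 1)) R := ⟨hint⟩
  exact Ideal.isMaximal_comap_of_isIntegral_of_isMaximal (R := Q k (n + 1)) N

theorem isUnit_of_isAlgebraic [IsDomain R] {x : R} (h : IsAlgebraic k x) (hx : x ≠ 0) : IsUnit x := by
  obtain ⟨r, hr, h1⟩ := h.exists_nonzero_dvd (mem_nonZeroDivisors_of_ne_zero hx)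
  exact isUnit_of_dvd_unit h1 ((IsUnit.mk0 r hr).map (algebraMap k R))

namespace IsGoodCurve

/-- A prime of `R` over such a point would contain two coprime coordinates. The curve thus avoids
all faces of codimension at least two. -/
theorem eq_of_mem (hf : IsGoodCurve f) {q : Ideal (Q k (n + 1))} (hq : q ≠ ⊤)
    (h : RingHom.ker f ≤ q) {i j : Fin (n + 2)} (hi : t i ∈ q) (hj : t j ∈ q) : i = j := by
  by_contra hij
  obtain ⟨M, hM, hqM⟩ := Ideal.exists_le_maximal q hq
  obtain ⟨N, hN, rfl⟩ := exists_isPrime_comap_eq hf.isIntegral M (h.trans hqM)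
  obtain ⟨a, b, hab⟩ := hf.isCoprime i j hij
  refine hN.ne_top ((Ideal.eq_top_iff_one _).2 ?_)
  rw [← hab]
  exact add_mem (N.mul_mem_left _ (hqM hi)) (N.mul_mem_left _ (hqM hj))

/-- A prime of `R` over `q` contains a nonzero coordinate, so it is maximal, and maximality descends
along the integral map. -/
theorem isMaximal [Ring.DimensionLEOne R] (hf : IsGoodCurve f) (q : Ideal (Q k (n + 1)))
    [q.IsPrime] (h : RingHom.ker f ≤ q) {j : Fin (n + 2)} (hj : t j ∈ q) : q.IsMaximal := by
  obtain ⟨N, hN, rfl⟩ := exists_isPrime_comap_eq hf.isIntegral q h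
  have hN0 : N ≠ ⊥ := by
    rintro rfl
    exact hf.ne_zero j hj
  have := Ring.DimensionLEOne.maximalOfPrime hN0 hN
  exact isMaximal_comap hf.isIntegral N

variable [IsDomain R]

/-- A coordinate which is not a unit does both jobs: a maximal ideal through it strictly contains
the kernel, which bounds the height from above, and it is transcendental, since nonzero algebraic
elements are units, which bounds the height from below. -/
theorem height_ker (hf : IsGoodCurve f) : (RingHom.ker f).height = n := by
  obtain ⟨j, hj⟩ := hf.exists_not_isUnit
  apply le_antisymm
  · obtain ⟨M, hM, hjM⟩ := exists_max_ideal_of_mem_nonunits hj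
    have hpr : (RingHom.ker f).IsPrime := RingHom.ker_isPrime _
    have hpr' : (M.comap f).IsPrime := Ideal.comap_isPrime f M
    have hlt : RingHom.ker f < M.comap f := by
      refine lt_of_le_of_ne ?_ ?_
      · intro x hx
        rw [Ideal.mem_comap, (RingHom.mem_ker).1 hx]
        exact M.zero_mem
      · intro h
        have h1 : t j ∈ M.comap f := hjM
        rw [← h] at h1
        exact hf.ne_zero j h1
    have h1 := (Ideal.height_add_one_le_of_lt_of_isPrime hlt).trans (Q.height_le hpr'.ne_top)
    push_cast at h1
    exact (ENat.add_le_add_iff_right (by simp)).1 h1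
  · exact Q.le_height_ker_of_transcendental hf.trdeg_le f j
      (fun h => hj (isUnit_of_isAlgebraic h (hf.ne_zero j)))

/-- The image of a good parametrized curve is in good position. -/
theorem isGood [Ring.DimensionLEOne R] (hf : IsGoodCurve f) :
    IsGood n (⟨RingHom.ker f, RingHom.ker_isPrime _⟩ : PrimeSpectrum (Q k (n + 1))) where
  height_eq := hf.height_ker
  vertex := fun h => by
    have h1 := hf.eq_of_mem span_range_t_ne_top h
      (Ideal.subset_span ⟨0, rfl⟩) (Ideal.subset_span ⟨1, rfl⟩)
    exact absurd h1 (by simp)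
  face := fun S hS q hq => by
    obtain ⟨j, hjS⟩ := hS
    have hmem : ∀ i ∈ S, t i ∈ q.asIdeal.comap (Ideal.Quotient.mk
        (Ideal.span ((t : Fin (n + 2) → Q k (n + 1)) '' S))) := fun i hi => by
      have h0 : Ideal.Quotient.mk (Ideal.span ((t : Fin (n + 2) → Q k (n + 1)) '' S)) (t i) = 0 :=
        Ideal.Quotient.eq_zero_iff_mem.2 (Ideal.subset_span ⟨i, hi, rfl⟩)
      rw [Ideal.mem_comap, h0]
      exact zero_mem _
    have hpr : (q.asIdeal.comap (Ideal.Quotient.mk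
        (Ideal.span ((t : Fin (n + 2) → Q k (n + 1)) '' S)))).IsPrime :=
      Ideal.comap_isPrime _ _
    -- Only facets can meet the curve, and there the codimension of a closed point is exactly `n`.
    have hS' : S = {j} := by
      ext i
      rw [Finset.mem_singleton]
      refine ⟨fun hi => hf.eq_of_mem hpr.ne_top hq (hmem i hi) (hmem j hjS), ?_⟩
      rintro rfl
      exact hjS
    have hmax := hf.isMaximal _ hq (hmem j hjS)
    have hqm : q.asIdeal.IsMaximal := by
      have := Ideal.IsMaximal.map_of_surjective_of_ker_le
        (f := Ideal.Quotient.mk (Ideal.span ((t : Fin (n + 2) → Q k (n + 1)) '' S)))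
        Ideal.Quotient.mk_surjective
        (m := q.asIdeal.comap (Ideal.Quotient.mk
          (Ideal.span ((t : Fin (n + 2) → Q k (n + 1)) '' S)))) (Ideal.comap_mono bot_le)
      rwa [Ideal.map_comap_of_surjective _ Ideal.Quotient.mk_surjective] at this
    subst hS'
    exact (height_faceRing_singleton j q.asIdeal).ge

end IsGoodCurve

end Curve

/-! ### Local lengths of modules -/

section LocalLength

variable {A : Type*} [CommRing A]

/-- The length, over `A`, of the localization of a module at a prime. -/
def localLength (q : Ideal A) [q.IsPrime] (N : Type*) [AddCommGroup N] [Module A N] : ℕ∞ :=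
  Module.length A (LocalizedModule q.primeCompl N)

variable (q : Ideal A) [q.IsPrime]
variable {N M P : Type*} [AddCommGroup N] [Module A N] [AddCommGroup M] [Module A M]
  [AddCommGroup P] [Module A P]

theorem localLength_eq_of_isLocalizedModule (f : N →ₗ[A] M) [IsLocalizedModule q.primeCompl f] :
    localLength q N = Module.length A M :=
  LinearEquiv.length_eq (IsLocalizedModule.iso q.primeCompl f)

theorem localLength_eq_add (f : N →ₗ[A] M) (g : M →ₗ[A] P) (hf : Function.Injective f)
    (hg : Function.Surjective g) (H : Function.Exact f g) :
    localLength q M = localLength q N + localLength q P :=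
  Module.length_eq_add_of_exact
    (IsLocalizedModule.map q.primeCompl (LocalizedModule.mkLinearMap q.primeCompl N)
      (LocalizedModule.mkLinearMap q.primeCompl M) f)
    (IsLocalizedModule.map q.primeCompl (LocalizedModule.mkLinearMap q.primeCompl M)
      (LocalizedModule.mkLinearMap q.primeCompl P) g)
    (IsLocalizedModule.map_injective q.primeCompl _ _ f hf)
    (IsLocalizedModule.map_surjective q.primeCompl _ _ g hg)
    (IsLocalizedModule.map_exact q.primeCompl _ _ _ f g H)

theorem localLength_eq_zero_of_subsingleton [Subsingleton N] : localLength q N = 0 := by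
  have : Subsingleton (LocalizedModule q.primeCompl N) := by
    refine ⟨fun x y => ?_⟩
    induction x using LocalizedModule.induction_on with
    | h m s =>
      induction y using LocalizedModule.induction_on with
      | h m' s' => rw [Subsingleton.elim m 0, Subsingleton.elim m' 0,
          LocalizedModule.zero_mk, LocalizedModule.zero_mk]
  exact Module.length_eq_zero

theorem localLength_congr (e : N ≃ₗ[A] M) : localLength q N = localLength q M := by
  have h := localLength_eq_add q (e : N →ₗ[A] M) (0 : M →ₗ[A] PUnit.{1}) e.injective
    (fun x => ⟨0, Subsingleton.elim _ _⟩) (fun x => ⟨fun _ => e.surjective x, fun _ => rfl⟩)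
  rw [h, localLength_eq_zero_of_subsingleton q (N := PUnit.{1}), add_zero]

theorem localLength_le_of_surjective (g : M →ₗ[A] P) (hg : Function.Surjective g) :
    localLength q P ≤ localLength q M := by
  rw [localLength_eq_add q (LinearMap.ker g).subtype g (Submodule.subtype_injective _) hg
    (LinearMap.exact_subtype_ker_map g)]
  exact le_add_self

theorem localLength_pi (m : ℕ) : localLength q (Fin m → N) = m * localLength q N := by
  induction m with
  | zero => rw [localLength_eq_zero_of_subsingleton]; simp
  | succ m ih =>
    have e : (Fin (m + 1) → N) ≃ₗ[A] N × (Fin m → N) := (Fin.consLinearEquiv A fun _ => N).symm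
    rw [localLength_congr q e, localLength_eq_add q (LinearMap.inl A N (Fin m → N))
      (LinearMap.snd A N (Fin m → N)) LinearMap.inl_injective LinearMap.snd_surjective
      .inl_snd, ih]
    push_cast
    ring

theorem localLength_eq_zero_of_smul_eq_zero {s : A} (hs : s ∉ q) (h : ∀ x : N, s • x = 0) :
    localLength q N = 0 := by
  have : Subsingleton (LocalizedModule q.primeCompl N) := by
    refine subsingleton_of_forall_eq 0 fun x => ?_
    induction x using LocalizedModule.induction_on with
    | h m s' =>
      rw [← LocalizedModule.zero_mk s', LocalizedModule.mk_eq]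
      refine ⟨⟨s, hs⟩, ?_⟩
      rw [smul_zero, smul_zero]
      change s • (s' : A) • m = 0
      exact h _
  exact Module.length_eq_zero

/-- On a module killed by the maximal ideal `q` the elements outside `q` act bijectively, so the
module is its own localization. -/
theorem localLength_eq_length [hq : q.IsMaximal] (h : ∀ a ∈ q, ∀ x : N, a • x = 0) :
    localLength q N = Module.length A N := by
  have : IsLocalizedModule q.primeCompl (LinearMap.id : N →ₗ[A] N) := by
    refine ⟨fun s => ?_, fun y => ⟨(y, 1), by simp⟩, fun h => ⟨1, by simpa using h⟩⟩
    obtain ⟨b, c, hc, hbc⟩ := Ideal.IsMaximal.exists_inv hq s.2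
    have h1 : ∀ x : N, b • (s : A) • x = x := fun x => by
      rw [smul_smul]
      have h2 : (b * s + c) • x = x := by rw [hbc, one_smul]
      rwa [add_smul, h c hc, add_zero] at h2
    rw [Module.End.isUnit_iff]
    refine ⟨fun x y hxy => ?_, fun x => ⟨b • x, ?_⟩⟩
    · rw [← h1 x, ← h1 y]
      exact congrArg (b • ·) hxy
    · change (s : A) • b • x = x
      rw [smul_comm, h1]
  exact localLength_eq_of_isLocalizedModule q (LinearMap.id : N →ₗ[A] N)

/-- The Herbrand quotient of multiplication by `a` depends only on a submodule with finite local
colength. -/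
theorem localLength_quotient_eq_of_injective (a : A) (h : N →ₗ[A] M) (hinj : Function.Injective h)
    (ha : Function.Injective (LinearMap.lsmul A M a))
    (hfin : localLength q (M ⧸ LinearMap.range h) ≠ ⊤) :
    localLength q (N ⧸ LinearMap.range (LinearMap.lsmul A N a)) =
      localLength q (M ⧸ LinearMap.range (LinearMap.lsmul A M a)) := by
  -- M / a h(N) is filtered in two ways, through h(N) and through a M. As `a` is injective on M, the
  -- piece a M / a h(N) is a copy of M / h(N), which cancels by finiteness.
  set K : Submodule A M := (LinearMap.range (LinearMap.lsmul A N a)).map h with hK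
  have hKh : K ≤ LinearMap.range h := by
    rintro _ ⟨y, -, rfl⟩
    exact ⟨y, rfl⟩
  have hKa : K ≤ LinearMap.range (LinearMap.lsmul A M a) := by
    rintro _ ⟨_, ⟨y, rfl⟩, rfl⟩
    exact ⟨h y, by simp⟩
  have h1 : localLength q (M ⧸ K) =
      localLength q (N ⧸ LinearMap.range (LinearMap.lsmul A N a)) +
        localLength q (M ⧸ LinearMap.range h) := by
    refine localLength_eq_add q
      (Submodule.mapQ _ K h (Submodule.le_comap_map h _))
      (Submodule.mapQ K (LinearMap.range h) LinearMap.id hKh) ?_ ?_ ?_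
    · rw [← LinearMap.ker_eq_bot, Submodule.ker_mapQ, hK, Submodule.comap_map_eq_of_injective hinj]
      simp
    · intro x
      obtain ⟨x, rfl⟩ := Submodule.Quotient.mk_surjective _ x
      exact ⟨Submodule.Quotient.mk x, rfl⟩
    · intro x
      obtain ⟨x, rfl⟩ := Submodule.Quotient.mk_surjective _ x
      constructor
      · intro hx
        obtain ⟨y, rfl⟩ := (Submodule.Quotient.mk_eq_zero _).1 hx
        exact ⟨Submodule.Quotient.mk y, rfl⟩
      · rintro ⟨y, hy⟩
        obtain ⟨y, rfl⟩ := Submodule.Quotient.mk_surjective _ y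
        rw [← hy]
        exact (Submodule.Quotient.mk_eq_zero _).2 ⟨y, rfl⟩
  have h2 : localLength q (M ⧸ K) =
      localLength q (M ⧸ LinearMap.range h) +
        localLength q (M ⧸ LinearMap.range (LinearMap.lsmul A M a)) := by
    have hle : LinearMap.range h ≤ K.comap (LinearMap.lsmul A M a) := by
      rintro _ ⟨y, rfl⟩
      exact ⟨a • y, ⟨y, rfl⟩, by simp⟩
    refine localLength_eq_add q
      (Submodule.mapQ _ K (LinearMap.lsmul A M a) hle)
      (Submodule.mapQ K _ LinearMap.id hKa) ?_ ?_ ?_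
    · rw [injective_iff_map_eq_zero]
      intro x hx
      obtain ⟨x, rfl⟩ := Submodule.Quotient.mk_surjective _ x
      obtain ⟨_, ⟨y, rfl⟩, hy⟩ := (Submodule.Quotient.mk_eq_zero _).1 hx
      refine (Submodule.Quotient.mk_eq_zero _).2 ⟨y, ha ?_⟩
      rw [← hy]
      simp
    · intro x
      obtain ⟨x, rfl⟩ := Submodule.Quotient.mk_surjective _ x
      exact ⟨Submodule.Quotient.mk x, rfl⟩
    · intro x
      obtain ⟨x, rfl⟩ := Submodule.Quotient.mk_surjective _ x
      constructor
      · intro hx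
        obtain ⟨y, rfl⟩ := (Submodule.Quotient.mk_eq_zero _).1 hx
        exact ⟨Submodule.Quotient.mk y, rfl⟩
      · rintro ⟨y, hy⟩
        obtain ⟨y, rfl⟩ := Submodule.Quotient.mk_surjective _ y
        rw [← hy]
        exact (Submodule.Quotient.mk_eq_zero _).2 ⟨y, rfl⟩
  rw [h1, add_comm] at h2
  exact le_antisymm ((ENat.add_le_add_iff_left hfin).1 h2.le)
    ((ENat.add_le_add_iff_left hfin).1 h2.ge)

end LocalLength

section FiniteCover

variable {A R : Type*} [CommRing A] [CommRing R] [Algebra A R]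

/-- Multiplication by `x` gives the exact sequence 0 → R/y → R/xy → R/x → 0. -/
theorem localLength_quotient_mul [IsDomain R] (q : Ideal A) [q.IsPrime] {x y : R} (hx : x ≠ 0) :
    localLength q (R ⧸ Ideal.span {x * y}) =
      localLength q (R ⧸ Ideal.span {y}) + localLength q (R ⧸ Ideal.span {x}) := by
  have hle : (Ideal.span {y}).restrictScalars A ≤
      ((Ideal.span {x * y}).restrictScalars A).comap (LinearMap.mulLeft A x) := by
    intro z hz
    obtain ⟨c, rfl⟩ := Ideal.mem_span_singleton.1 hz
    exact Ideal.mem_span_singleton.2 ⟨c, by simp [mul_assoc]⟩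
  have hle' : (Ideal.span {x * y}).restrictScalars A ≤
      ((Ideal.span {x}).restrictScalars A).comap LinearMap.id := by
    intro z hz
    obtain ⟨c, rfl⟩ := Ideal.mem_span_singleton.1 hz
    exact Ideal.mem_span_singleton.2 ⟨y * c, by simp [mul_assoc]⟩
  rw [← localLength_congr q (Submodule.Quotient.restrictScalarsEquiv A (Ideal.span {x * y})),
    ← localLength_congr q (Submodule.Quotient.restrictScalarsEquiv A (Ideal.span {y})),
    ← localLength_congr q (Submodule.Quotient.restrictScalarsEquiv A (Ideal.span {x}))]
  refine localLength_eq_add q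
    (Submodule.mapQ ((Ideal.span {y}).restrictScalars A)
      ((Ideal.span {x * y}).restrictScalars A) (LinearMap.mulLeft A x) hle)
    (Submodule.mapQ ((Ideal.span {x * y}).restrictScalars A)
      ((Ideal.span {x}).restrictScalars A) LinearMap.id hle') ?_ ?_ ?_
  · rw [injective_iff_map_eq_zero]
    intro z hz
    obtain ⟨z, rfl⟩ := Submodule.Quotient.mk_surjective _ z
    obtain ⟨c, hc⟩ := Ideal.mem_span_singleton.1 ((Submodule.Quotient.mk_eq_zero _).1 hz)
    refine (Submodule.Quotient.mk_eq_zero _).2 (Ideal.mem_span_singleton.2 ⟨c, ?_⟩)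
    rw [mul_assoc] at hc
    exact mul_left_cancel₀ hx hc
  · intro z
    obtain ⟨z, rfl⟩ := Submodule.Quotient.mk_surjective _ z
    exact ⟨Submodule.Quotient.mk z, rfl⟩
  · intro z
    obtain ⟨z, rfl⟩ := Submodule.Quotient.mk_surjective _ z
    constructor
    · intro hz
      obtain ⟨c, rfl⟩ := Ideal.mem_span_singleton.1 ((Submodule.Quotient.mk_eq_zero _).1 hz)
      exact ⟨Submodule.Quotient.mk c, rfl⟩
    · rintro ⟨c, hc⟩
      obtain ⟨c, rfl⟩ := Submodule.Quotient.mk_surjective _ c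
      rw [← hc]
      exact (Submodule.Quotient.mk_eq_zero _).2 (Ideal.mem_span_singleton.2 ⟨c, rfl⟩)

theorem localLength_quotient_isUnit (q : Ideal A) [q.IsPrime] {x : R} (hx : IsUnit x) :
    localLength q (R ⧸ Ideal.span {x}) = 0 := by
  have : Subsingleton (R ⧸ Ideal.span {x}) := by
    rw [Ideal.span_singleton_eq_top.2 hx]
    exact Ideal.Quotient.subsingleton_iff.2 rfl
  exact localLength_eq_zero_of_subsingleton q

theorem localLength_quotient_prod [IsDomain R] (q : Ideal A) [q.IsPrime] (l : Multiset R)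
    (hl : ∀ x ∈ l, x ≠ 0) : localLength q (R ⧸ Ideal.span {l.prod}) =
      (l.map fun x => localLength q (R ⧸ Ideal.span {x})).sum := by
  induction l using Multiset.induction_on with
  | empty => simpa using localLength_quotient_isUnit q (isUnit_one (M := R))
  | cons x l ih =>
    rw [Multiset.prod_cons, localLength_quotient_mul q (hl x (Multiset.mem_cons_self x l)),
      ih fun y hy => hl y (Multiset.mem_cons_of_mem hy), Multiset.map_cons, Multiset.sum_cons,
      add_comm]

theorem localLength_quotient_eq_sum [IsDomain R] (q : Ideal A) [q.IsPrime] {x : R}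
    (l : Multiset R) (hl : ∀ x ∈ l, x ≠ 0) (hx : Associated l.prod x) :
    localLength q (R ⧸ Ideal.span {x}) =
      (l.map fun x => localLength q (R ⧸ Ideal.span {x})).sum := by
  rw [← localLength_quotient_prod q l hl, Ideal.span_singleton_eq_span_singleton.2 hx]

theorem localLength_quotient_ne_top [IsDomain R] [IsPrincipalIdealRing R] (q : Ideal A) [q.IsPrime]
    (h : ∀ x : R, Prime x → localLength q (R ⧸ Ideal.span {x}) ≠ ⊤) {x : R} (hx : x ≠ 0) :
    localLength q (R ⧸ Ideal.span {x}) ≠ ⊤ := by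
  induction x using UniqueFactorizationMonoid.induction_on_prime with
  | h₁ => exact absurd rfl hx
  | h₂ x hu => rw [localLength_quotient_isUnit q hu]; simp
  | h₃ a p ha hp ih =>
    rw [localLength_quotient_mul q hp.ne_zero]
    exact WithTop.add_ne_top.2 ⟨ih ha, h p hp⟩

/-- A maximal linearly independent family over the image D of `A` spans a free submodule with
torsion cokernel. The cokernel is finitely generated, so one nonzero element of D kills it. -/
theorem exists_free_submodule [IsNoetherianRing A] [IsDomain R] [Module.Finite A R] :
    ∃ (m : ℕ) (h : (Fin m → A ⧸ RingHom.ker (algebraMap A R)) →ₗ[A] R),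
      Function.Injective h ∧ ∃ x : R, x ≠ 0 ∧ ∀ y, x * y ∈ LinearMap.range h := by
  let D := A ⧸ RingHom.ker (algebraMap A R)
  let : Algebra D R := (RingHom.kerLift (algebraMap A R)).toAlgebra
  have : IsScalarTower A D R := IsScalarTower.of_algebraMap_eq fun x => rfl
  have hinj : Function.Injective (algebraMap D R) := RingHom.kerLift_injective _
  have : FaithfulSMul D R := (faithfulSMul_iff_algebraMap_injective D R).2 hinj
  have : IsDomain D := hinj.isDomain (algebraMap D R)
  have : Module.Finite D R := Module.Finite.of_restrictScalars_finite A D R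
  obtain ⟨v, hv⟩ := exists_linearIndependent_of_le_finrank (R := D) (M := R) le_rfl
  let h : (Fin (Module.finrank D R) → D) →ₗ[D] R := Fintype.linearCombination D v
  refine ⟨Module.finrank D R, h.restrictScalars A, ?_, ?_⟩
  · rw [LinearMap.coe_restrictScalars]
    exact hv.fintypeLinearCombination_injective
  · have hr : LinearMap.range h = Submodule.span D (Set.range v) :=
      Fintype.range_linearCombination D v
    have h0 : Module.finrank D (R ⧸ LinearMap.range h) = 0 := by
      have h1 := rank_quotient_add_rank_of_isDomain (LinearMap.range h)
      have h2 : Module.finrank D (LinearMap.range h) = Module.finrank D R := by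
        rw [hr, finrank_span_eq_card hv, Fintype.card_fin]
      have h3 : Module.finrank D (R ⧸ LinearMap.range h) + Module.finrank D (LinearMap.range h) =
          Module.finrank D R := by
        have h4 := congrArg Cardinal.toNat h1
        rwa [Cardinal.toNat_add (Module.rank_lt_aleph0 D _) (Module.rank_lt_aleph0 D _)] at h4
      omega
    rw [Module.finrank_eq_zero_iff_isTorsion] at h0
    obtain ⟨d, hd, hd0⟩ := Submodule.annihilator_top_inter_nonZeroDivisors h0
    refine ⟨algebraMap D R d, ?_, fun y => ?_⟩
    · intro h
      exact nonZeroDivisors.ne_zero hd0 (hinj (by rw [h, map_zero]))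
    · have := Submodule.mem_annihilator.1 hd (Submodule.Quotient.mk y) trivial
      rw [← Submodule.Quotient.mk_smul, Submodule.Quotient.mk_eq_zero, Algebra.smul_def] at this
      exact this

/-- The projection formula for principal divisors: the divisor of a function on a curve pulls
back to the normalization with the degree as a factor. -/
theorem exists_localLength_quotient_eq_mul [IsNoetherianRing A] [IsDomain R]
    [Module.Finite A R] : ∃ m : ℕ, ∀ (q : Ideal A) [q.IsPrime],
      (∀ x : R, x ≠ 0 → localLength q (R ⧸ Ideal.span {x}) ≠ ⊤) →
      ∀ a : A, algebraMap A R a ≠ 0 →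
      localLength q (R ⧸ Ideal.span {algebraMap A R a}) =
        m * localLength q (A ⧸ (RingHom.ker (algebraMap A R) ⊔ Ideal.span {a})) := by
  obtain ⟨m, h, hh, x, hx0, hx⟩ := exists_free_submodule (A := A) (R := R)
  refine ⟨m, fun q _ hfin a ha => ?_⟩
  -- The cokernel of the free submodule is a quotient of R / x, hence of finite local length.
  have hfin' : localLength q (R ⧸ LinearMap.range h) ≠ ⊤ := by
    have hle : (Ideal.span {x}).restrictScalars A ≤ (LinearMap.range h).comap LinearMap.id := by
      intro z hz
      obtain ⟨c, rfl⟩ := Ideal.mem_span_singleton.1 hz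
      exact hx c
    refine ne_top_of_le_ne_top (hfin x hx0) (localLength_le_of_surjective q
      (Submodule.mapQ ((Ideal.span {x}).restrictScalars A) _ LinearMap.id hle) ?_)
    intro z
    obtain ⟨z, rfl⟩ := Submodule.Quotient.mk_surjective _ z
    exact ⟨Submodule.Quotient.mk z, rfl⟩
  have hainj : Function.Injective (LinearMap.lsmul A R a) := by
    intro y z hyz
    simp only [LinearMap.lsmul_apply, Algebra.smul_def] at hyz
    exact mul_left_cancel₀ ha hyz
  have key := localLength_quotient_eq_of_injective q a h hh hainj hfin'
  let J := RingHom.ker (algebraMap A R) ⊔ Ideal.span {a}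
  have e1 : (R ⧸ LinearMap.range (LinearMap.lsmul A R a)) ≃ₗ[A]
      (R ⧸ (Ideal.span {algebraMap A R a}).restrictScalars A) := by
    refine Submodule.quotEquivOfEq _ _ ?_
    ext z
    rw [Submodule.restrictScalars_mem, Ideal.mem_span_singleton]
    constructor
    · rintro ⟨c, rfl⟩
      exact ⟨c, by simp [Algebra.smul_def]⟩
    · rintro ⟨c, rfl⟩
      exact ⟨c, by simp [Algebra.smul_def]⟩
  let g : (Fin m → A ⧸ RingHom.ker (algebraMap A R)) →ₗ[A] (Fin m → A ⧸ J) :=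
    LinearMap.pi fun i => (Submodule.factor le_sup_left).comp (LinearMap.proj i)
  have hg : Function.Surjective g := by
    intro z
    choose w hw using fun i => Ideal.Quotient.mk_surjective (z i)
    refine ⟨fun i => Ideal.Quotient.mk _ (w i), funext fun i => ?_⟩
    rw [← hw]
    rfl
  have hker : LinearMap.ker g = LinearMap.range (LinearMap.lsmul A _ a) := by
    ext z
    constructor
    · intro hz
      choose w hw using fun i => Ideal.Quotient.mk_surjective (z i)
      have h1 : ∀ i, ∃ c, z i = a • c := by
        intro i
        have h2 : Ideal.Quotient.mk J (w i) = 0 := by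
          have h3 := congrFun (LinearMap.mem_ker.1 hz) i
          change Submodule.factor (le_sup_left : _ ≤ J) (z i) = 0 at h3
          rw [← hw] at h3
          exact h3
        obtain ⟨y, hy, _, hc, hyc⟩ := Submodule.mem_sup.1 (Ideal.Quotient.eq_zero_iff_mem.1 h2)
        obtain ⟨c, rfl⟩ := Ideal.mem_span_singleton.1 hc
        refine ⟨Ideal.Quotient.mk _ c, ?_⟩
        rw [← hw, ← hyc, map_add, Ideal.Quotient.eq_zero_iff_mem.2 hy, zero_add]
        rfl
      choose c hc using h1
      exact ⟨c, funext fun i => (hc i).symm⟩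
    · rintro ⟨c, rfl⟩
      rw [LinearMap.mem_ker]
      ext i
      obtain ⟨w, hw⟩ := Ideal.Quotient.mk_surjective (c i)
      change Submodule.factor (le_sup_left : _ ≤ J) (a • c i) = 0
      rw [← hw]
      exact Ideal.Quotient.eq_zero_iff_mem.2 (Ideal.mul_mem_right _ _
        (Ideal.mem_sup_right (Ideal.mem_span_singleton_self a)))
  -- For the free module D^m the cokernel of `a` is a power of D / a, and this produces the factor
  -- `m`, which depends on neither `q` nor `a`.
  have e2 := (Submodule.quotEquivOfEq _ _ hker.symm).trans (g.quotKerEquivOfSurjective hg)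
  have e3 := localLength_congr q e1
  rw [localLength_congr q e2, localLength_pi, e3] at key
  exact key.symm

end FiniteCover

/-! ### Multiplicities as local lengths -/

section Multiplicity

/-- At a closed generic point `q` of V(I) the ideal `q` is nilpotent in the local ring of V(I), so
elements outside `q` already have inverses coming from `B`. Hence `A` maps onto this local ring, and
lengths over it are lengths over `A`. This moves multiplicities on a face to the ambient coordinate
ring. -/
theorem multiplicity_eq_localLength {A B : Type*} [CommRing A] [CommRing B] (g : A →+* B)
    (hg : Function.Surjective g) (I q : Ideal B) [hq : q.IsMaximal] (hqI : q ∈ I.minimalPrimes) :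
    multiplicity I q = (localLength (q.comap g) (A ⧸ I.comap g)).toNat := by
  let : Algebra A B := g.toAlgebra
  let L := Localization.AtPrime q
  let C := L ⧸ I.map (algebraMap B L)
  have halg : ∀ a : A, algebraMap A C a = Ideal.Quotient.mk _ (algebraMap B L (g a)) := fun _ => rfl
  have hsm : ∀ (a : A) (x : C), a • x = algebraMap A C a * x := fun a x => Algebra.smul_def a x
  have hnil : ∀ b ∈ q, ∃ e, algebraMap B L b ^ e ∈ I.map (algebraMap B L) := by
    intro b hb
    have h1 : (I.map (algebraMap B L)).radical = q.map (algebraMap B L) :=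
      IsLocalization.AtPrime.radical_map_of_mem_minimalPrimes L q I hqI
    have h2 : algebraMap B L b ∈ (I.map (algebraMap B L)).radical := by
      rw [h1]
      exact Ideal.mem_map_of_mem _ hb
    exact h2
  have hunit : ∀ s : B, s ∉ q → ∃ b : B,
      algebraMap B L (s * b) - 1 ∈ I.map (algebraMap B L) := by
    intro s hs
    obtain ⟨b, c, hc, hbc⟩ := Ideal.IsMaximal.exists_inv hq hs
    obtain ⟨e, he⟩ := hnil c hc
    -- With c = 1 - b s, the element c - 1 is a multiple of s and divides c^e - 1; as c^e lies in
    -- the ideal, -d is an inverse of s.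
    obtain ⟨d, hd⟩ : s ∣ c ^ e - 1 := by
      have h1 : c = 1 - b * s := by rw [← hbc]; ring
      have h2 : (c - 1) ∣ c ^ e - 1 := sub_one_dvd_pow_sub_one c e
      refine Dvd.dvd.trans ⟨-b, ?_⟩ h2
      rw [h1]
      ring
    refine ⟨-d, ?_⟩
    have h3 : algebraMap B L (s * -d) - 1 = -(algebraMap B L c ^ e) := by
      rw [← map_pow, mul_neg, ← hd]
      simp
    rw [h3]
    exact neg_mem he
  have hsurj : Function.Surjective (algebraMap A C) := by
    intro y
    obtain ⟨y, rfl⟩ := Ideal.Quotient.mk_surjective y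
    obtain ⟨b, s, rfl⟩ := IsLocalization.exists_mk'_eq q.primeCompl y
    obtain ⟨d, hd⟩ := hunit s s.2
    obtain ⟨a, ha⟩ := hg (b * d)
    refine ⟨a, ?_⟩
    rw [halg, ha, ← sub_eq_zero, ← map_sub, Ideal.Quotient.eq_zero_iff_mem]
    have h4 : algebraMap B L (b * d) - IsLocalization.mk' L b s =
        IsLocalization.mk' L b s * (algebraMap B L (s * d) - 1) := by
      rw [mul_sub, mul_one, map_mul, map_mul, ← mul_assoc, IsLocalization.mk'_spec]
    rw [h4]
    exact Ideal.mul_mem_left _ _ hd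
  have hlen : Module.length C C = Module.length A C := (Module.length_eq_of_surjective hsurj).symm
  let φ : (A ⧸ I.comap g) →ₗ[A] C := Submodule.liftQ _ (Algebra.linearMap A C) (by
    intro a ha
    rw [LinearMap.mem_ker, Algebra.linearMap_apply, halg, Ideal.Quotient.eq_zero_iff_mem]
    exact Ideal.mem_map_of_mem _ ha)
  have hφ : ∀ a, φ (Ideal.Quotient.mk _ a) = algebraMap A C a := fun _ => rfl
  have hloc : IsLocalizedModule (q.comap g).primeCompl φ := by
    refine ⟨fun s => ?_, fun y => ?_, fun {x y} hxy => ?_⟩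
    · have hs : IsUnit (algebraMap A C s) := by
        obtain ⟨b, hb⟩ := hunit (g s) s.2
        refine IsUnit.of_mul_eq_one (Ideal.Quotient.mk _ (algebraMap B L b)) ?_
        rw [halg, ← map_mul, ← map_mul, ← sub_eq_zero, ← map_one (Ideal.Quotient.mk _), ← map_sub,
          Ideal.Quotient.eq_zero_iff_mem]
        exact hb
      rw [Module.End.isUnit_iff]
      refine ⟨fun x y hxy => hs.mul_left_cancel ?_, fun x => ?_⟩
      · rw [← hsm, ← hsm]
        exact hxy
      · obtain ⟨v, hv⟩ := hs.exists_right_inv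
        refine ⟨v * x, ?_⟩
        refine (hsm s (v * x)).trans ?_
        rw [← mul_assoc, hv, one_mul]
    · obtain ⟨a, rfl⟩ := hsurj y
      exact ⟨(Ideal.Quotient.mk _ a, 1), by rw [hφ, one_smul]⟩
    · obtain ⟨x, rfl⟩ := Ideal.Quotient.mk_surjective x
      obtain ⟨y, rfl⟩ := Ideal.Quotient.mk_surjective y
      rw [hφ, hφ, ← sub_eq_zero, ← map_sub, halg, Ideal.Quotient.eq_zero_iff_mem,
        IsLocalization.mem_map_algebraMap_iff q.primeCompl] at hxy
      obtain ⟨⟨i, s⟩, his⟩ := hxy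
      rw [← map_mul, IsLocalization.eq_iff_exists q.primeCompl] at his
      obtain ⟨c, hc⟩ := his
      obtain ⟨a, ha⟩ := hg (c * s)
      refine ⟨⟨a, ?_⟩, ?_⟩
      · change g a ∉ q
        rw [ha]
        exact (c * s).2
      · rw [← sub_eq_zero, ← smul_sub, ← map_sub]
        change Ideal.Quotient.mk _ (a * (x - y)) = 0
        rw [Ideal.Quotient.eq_zero_iff_mem, Ideal.mem_comap, map_mul, ha]
        have h5 : (c : B) * s * g (x - y) = c * (g (x - y) * s) := by ring
        rw [h5, hc]
        exact Ideal.mul_mem_left _ _ i.2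
  rw [localLength_eq_of_isLocalizedModule _ φ, ← hlen]
  rfl

end Multiplicity

/-! ### Zero-cycles attached to points with values in extensions -/

section PointCycle

variable {k : Type u} [Field k]

/-- The length of a ring over a subring. -/
def subringLength {K : Type*} [CommRing K] (S : Subring K) : ℕ := (Module.length S K).toNat

theorem length_eq_length_range {A K : Type*} [CommRing A] [CommRing K] [Algebra A K] :
    Module.length A K = Module.length (algebraMap A K).range K := by
  let : Algebra A (algebraMap A K).range := (algebraMap A K).rangeRestrict.toAlgebra
  have : IsScalarTower A (algebraMap A K).range K := IsScalarTower.of_algebraMap_eq fun _ => rfl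
  exact Module.length_eq_of_surjective (algebraMap A K).rangeRestrict_surjective

theorem subringLength_range {A K : Type*} [CommRing A] [CommRing K] [Algebra A K] :
    subringLength (algebraMap A K).range = (Module.length A K).toNat := by
  rw [subringLength, ← length_eq_length_range]

open Classical in
/-- The push-forward to `Q^n` of the `K`-valued point given by `g`: the closed point `ker g`,
counted with the degree of `K` over its residue field. -/
def homCycle {n : ℕ} {K : Type*} [CommRing K] [Algebra k K] (g : Q k n →ₐ[k] K) : Cycle k n :=
  if h : (RingHom.ker g).IsPrime then
    Finsupp.single ⟨RingHom.ker g, h⟩ (subringLength (g : Q k n →+* K).range : ℤ) else 0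

open Classical in
/-- The push-forward to `Q^n` of the `K`-valued point with coordinates `v`. -/
def pointCycle (k : Type u) [Field k] {n : ℕ} {K : Type*} [CommRing K] [Algebra k K]
    (v : Fin (n + 1) → K) : Cycle k n :=
  if hv : ∑ i, v i = 0 then homCycle (lift (k := k) v hv) else 0

theorem pointCycle_of_sum {n : ℕ} {K : Type*} [CommRing K] [Algebra k K]
    {v : Fin (n + 1) → K} (hv : ∑ i, v i = 0) : pointCycle k v = homCycle (lift (k := k) v hv) :=
  dif_pos hv

theorem homCycle_apply {n : ℕ} {K : Type*} [CommRing K] [IsDomain K] [Algebra k K]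
    (g : Q k n →ₐ[k] K) (q : PrimeSpectrum (Q k n)) [Decidable (RingHom.ker g = q.asIdeal)] :
    homCycle g q = if RingHom.ker g = q.asIdeal then
      (subringLength (g : Q k n →+* K).range : ℤ) else 0 := by
  classical
  rw [homCycle, dif_pos (RingHom.ker_isPrime g), Finsupp.single_apply]
  have : (⟨RingHom.ker g, RingHom.ker_isPrime g⟩ : PrimeSpectrum (Q k n)) = q ↔
      RingHom.ker g = q.asIdeal := PrimeSpectrum.ext_iff
  simp only [this]

end PointCycle

/-! ### The boundary of a parametrized curve -/

section Relation

variable {k : Type u} [Field k] {n : ℕ} {R : Type u} [CommRing R] [IsDomain R]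
  [IsPrincipalIdealRing R] [Algebra k R]

/-- By Zariski's lemma R / x is a finite extension field of `k`. Its local length is therefore
finite and is concentrated at the one closed point of Spec A below it. -/
theorem localLength_quotient_prime {A : Type*} [CommRing A] [Algebra k A] [Algebra A R]
    [IsScalarTower k A R] [Algebra.FiniteType k R] [Algebra.IsIntegral A R] (q : Ideal A)
    [q.IsMaximal] {x : R} (hx : Prime x) :
    localLength q (R ⧸ Ideal.span {x}) ≠ ⊤ ∧
    (RingHom.ker (algebraMap A (R ⧸ Ideal.span {x})) = q →
      localLength q (R ⧸ Ideal.span {x}) = Module.length A (R ⧸ Ideal.span {x})) ∧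
    (RingHom.ker (algebraMap A (R ⧸ Ideal.span {x})) ≠ q →
      localLength q (R ⧸ Ideal.span {x}) = 0) := by
  have hmax : (Ideal.span {x}).IsMaximal :=
    PrincipalIdealRing.isMaximal_of_irreducible hx.irreducible
  have hker : RingHom.ker (algebraMap A (R ⧸ Ideal.span {x})) =
      (Ideal.span {x}).comap (algebraMap A R) := by
    ext a
    rw [RingHom.mem_ker, Ideal.mem_comap, ← Ideal.Quotient.eq_zero_iff_mem]
    rfl
  have hkm : (RingHom.ker (algebraMap A (R ⧸ Ideal.span {x}))).IsMaximal := by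
    rw [hker]
    exact Ideal.isMaximal_comap_of_isIntegral_of_isMaximal _
  let := Ideal.Quotient.field (Ideal.span {x})
  have : Algebra.FiniteType k (R ⧸ Ideal.span {x}) :=
    Algebra.FiniteType.of_surjective (Ideal.Quotient.mkₐ k _) Ideal.Quotient.mk_surjective
  have : Module.Finite k (R ⧸ Ideal.span {x}) :=
    finite_of_finite_type_of_isJacobsonRing k (R ⧸ Ideal.span {x})
  have hart : IsArtinian A (R ⧸ Ideal.span {x}) := isArtinian_of_tower k inferInstance
  have hnoe : IsNoetherian A (R ⧸ Ideal.span {x}) := isNoetherian_of_tower k inferInstance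
  have hfin := Module.length_ne_top (R := A) (M := R ⧸ Ideal.span {x})
  have h1 : RingHom.ker (algebraMap A (R ⧸ Ideal.span {x})) = q →
      localLength q (R ⧸ Ideal.span {x}) = Module.length A (R ⧸ Ideal.span {x}) := by
    intro h
    refine localLength_eq_length q fun a ha y => ?_
    rw [← h, RingHom.mem_ker] at ha
    have h2 : a • y = algebraMap A (R ⧸ Ideal.span {x}) a * y := Algebra.smul_def a y
    rw [h2, ha, zero_mul]
  have h0 : RingHom.ker (algebraMap A (R ⧸ Ideal.span {x})) ≠ q →
      localLength q (R ⧸ Ideal.span {x}) = 0 := by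
    intro h
    obtain ⟨s, hs, hsq⟩ : ∃ s ∈ RingHom.ker (algebraMap A (R ⧸ Ideal.span {x})), s ∉ q := by
      by_contra hcon
      push Not at hcon
      exact h (hkm.eq_of_le (Ideal.IsPrime.ne_top inferInstance) hcon)
    refine localLength_eq_zero_of_smul_eq_zero q hsq fun y => ?_
    have h2 : s • y = algebraMap A (R ⧸ Ideal.span {x}) s * y := Algebra.smul_def s y
    rw [h2, (RingHom.mem_ker).1 hs, zero_mul]
  refine ⟨?_, h1, h0⟩
  by_cases h : RingHom.ker (algebraMap A (R ⧸ Ideal.span {x})) = q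
  · rw [h1 h]
    exact hfin
  · rw [h0 h]
    simp

theorem toNat_multiset_sum {ι : Type*} (l : Multiset ι) (g : ι → ℕ∞) (h : ∀ x ∈ l, g x ≠ ⊤) :
    (l.map g).sum ≠ ⊤ ∧ (l.map g).sum.toNat = (l.map fun x => (g x).toNat).sum := by
  induction l using Multiset.induction_on with
  | empty => simp
  | cons x l ih =>
    obtain ⟨h1, h2⟩ := ih fun y hy => h y (Multiset.mem_cons_of_mem hy)
    have h3 := h x (Multiset.mem_cons_self x l)
    rw [Multiset.map_cons, Multiset.sum_cons, Multiset.map_cons, Multiset.sum_cons,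
      ENat.toNat_add h3 h1, h2]
    exact ⟨WithTop.add_ne_top.2 ⟨h3, h1⟩, rfl⟩

variable {f : Q k (n + 1) →ₐ[k] R}

theorem sum_succAbove_eq_zero {j : Fin (n + 2)} {K : Type*} [CommRing K] [Algebra k K]
    (g : Q k (n + 1) →ₐ[k] K) (hj : g (t j) = 0) : ∑ i, g (t (j.succAbove i)) = 0 := by
  have h := lift_apply_t g
  rwa [Fin.sum_univ_succAbove _ j, hj, zero_add] at h

theorem lift_comp_face {j : Fin (n + 2)} {K : Type*} [CommRing K] [Algebra k K]
    (g : Q k (n + 1) →ₐ[k] K) (hj : g (t j) = 0) :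
    (lift (fun i => g (t (j.succAbove i))) (sum_succAbove_eq_zero g hj)).comp (face j) = g := by
  apply algHom_ext
  intro i
  refine Fin.succAboveCases j ?_ (fun i => ?_) i
  · rw [AlgHom.comp_apply, face_t_self, map_zero, hj]
  · rw [AlgHom.comp_apply, face_t_succAbove, lift_t]

namespace IsGoodCurve

/-- The number `m` is the generic rank of `R` over the image of the coordinate ring, so it is the
same for all faces. The coefficients at each point of the face agree by the projection formula
applied to `t j`, split along the prime factors of the coordinate in `R`. -/
theorem exists_smul_fundamentalCycle (hf : IsGoodCurve f) : ∃ m : ℕ, ∀ (j : Fin (n + 2))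
    (l : Multiset R), (∀ x ∈ l, Prime x) → Associated l.prod (f (t j)) →
    (m : ℤ) • fundamentalCycle ((RingHom.ker f).map (faceHom j)) =
      (l.map fun x => pointCycle k
        (fun i => Ideal.Quotient.mk (Ideal.span {x}) (f (t (j.succAbove i))))).sum := by
  classical
  let : Algebra (Q k (n + 1)) R := (f : Q k (n + 1) →+* R).toAlgebra
  have hmap : ∀ a, algebraMap (Q k (n + 1)) R a = f a := fun _ => rfl
  have : IsScalarTower k (Q k (n + 1)) R := IsScalarTower.of_algebraMap_eq fun x =>
    (f.commutes x).symm
  have := hf.finiteType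
  have : Algebra.IsIntegral (Q k (n + 1)) R := ⟨hf.isIntegral⟩
  have : Algebra.FiniteType (Q k (n + 1)) R := Algebra.FiniteType.of_restrictScalars_finiteType k _ _
  have : Module.Finite (Q k (n + 1)) R := Algebra.IsIntegral.finite
  obtain ⟨m, hm⟩ := exists_localLength_quotient_eq_mul (A := Q k (n + 1)) (R := R)
  refine ⟨m, fun j l hl hlj => ?_⟩
  have hsurj : Function.Surjective (faceHom j : Q k (n + 1) →+* Q k n) := face_surjective j
  have hlj' : Associated l.prod (algebraMap (Q k (n + 1)) R (t j)) := hlj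
  set I := (RingHom.ker f).map (faceHom j) with hI
  have hcomap : I.comap (faceHom j) = RingHom.ker f ⊔ Ideal.span {t j} := by
    rw [hI, Ideal.comap_map_of_surjective' _ hsurj]
    congr 1
    exact ker_face j
  have hdvd : ∀ x ∈ l, Ideal.Quotient.mkₐ k (Ideal.span {x}) (f (t j)) = 0 := by
    intro x hx
    refine Ideal.Quotient.eq_zero_iff_mem.2 (Ideal.mem_span_singleton.2 ?_)
    exact (Multiset.dvd_prod hx).trans hlj.dvd
  ext q
  rw [← Finsupp.applyAddHom_apply, ← Finsupp.applyAddHom_apply, map_multiset_sum,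
    Multiset.map_map, Finsupp.applyAddHom_apply]
  have hpt : ∀ x ∈ l, ∃ h : Q k n →ₐ[k] (R ⧸ Ideal.span {x}),
      (∀ a, h (face j a) = algebraMap (Q k (n + 1)) (R ⧸ Ideal.span {x}) a) ∧
      pointCycle k (fun i => Ideal.Quotient.mk (Ideal.span {x}) (f (t (j.succAbove i)))) =
        homCycle h := by
    intro x hx
    let g : Q k (n + 1) →ₐ[k] R ⧸ Ideal.span {x} := (Ideal.Quotient.mkₐ k (Ideal.span {x})).comp f
    have hg : g (t j) = 0 := hdvd x hx
    exact ⟨_, fun a => AlgHom.congr_fun (lift_comp_face g hg) a,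
      pointCycle_of_sum (sum_succAbove_eq_zero g hg)⟩
  have hle : ∀ x ∈ l, ∀ h : Q k n →ₐ[k] (R ⧸ Ideal.span {x}),
      (∀ a, h (face j a) = algebraMap (Q k (n + 1)) (R ⧸ Ideal.span {x}) a) →
      I ≤ RingHom.ker h := by
    intro x hx h hh
    rw [hI, Ideal.map_le_iff_le_comap]
    intro a ha
    change h (face j a) = 0
    rw [hh]
    have h0 : f a = 0 := ha
    change Ideal.Quotient.mk _ (f a) = 0
    rw [h0, map_zero]
  have hdom : ∀ x ∈ l, IsDomain (R ⧸ Ideal.span {x}) := by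
    intro x hx
    have := (Ideal.span_singleton_prime (hl x hx).ne_zero).2 (hl x hx)
    exact Ideal.Quotient.isDomain _
  by_cases hq : I ≤ q.asIdeal
  -- Primes containing `I` correspond to closed points of the curve on the face. They are all
  -- maximal, so each of them is also minimal over `I` and occurs in the fundamental cycle.
  · have hmax' : ∀ r : Ideal (Q k n), r.IsPrime → I ≤ r → r.IsMaximal := by
      intro r hr hIr
      have hrp : (r.comap (faceHom j)).IsPrime := Ideal.comap_isPrime _ _
      have h1 : RingHom.ker f ⊔ Ideal.span {t j} ≤ r.comap (faceHom j) := by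
        rw [← hcomap]
        exact Ideal.comap_mono hIr
      have h2 : (r.comap (faceHom j)).IsMaximal :=
        hf.isMaximal _ (le_sup_left.trans h1)
          (h1 (Ideal.mem_sup_right (Ideal.mem_span_singleton_self _)))
      have h3 := Ideal.IsMaximal.map_of_surjective_of_ker_le
        (f := faceHom j) hsurj (m := r.comap (faceHom j)) (Ideal.comap_mono bot_le)
      rwa [Ideal.map_comap_of_surjective _ hsurj] at h3
    have hqm := hmax' q.asIdeal q.isPrime hq
    have hqI : q.asIdeal ∈ I.minimalPrimes := by
      refine ⟨⟨q.isPrime, hq⟩, fun r hr hrq => ?_⟩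
      exact ((hmax' r hr.1 hr.2).eq_of_le q.isPrime.ne_top hrq).ge
    have hqA : (q.asIdeal.comap (faceHom j)).IsMaximal :=
      Ideal.comap_isMaximal_of_surjective _ hsurj
    have h1 := hm (q.asIdeal.comap (faceHom j))
      (fun x hx => localLength_quotient_ne_top _
        (fun y hy => (localLength_quotient_prime (k := k) _ hy).1) hx) (t j) (hf.ne_zero j)
    rw [localLength_quotient_eq_sum _ l (fun x hx => (hl x hx).ne_zero) hlj'] at h1
    have h2 := congrArg ENat.toNat h1
    rw [ENat.toNat_mul, (toNat_multiset_sum l _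
      (fun x hx => (localLength_quotient_prime (k := k) _ (hl x hx)).1)).2] at h2
    have h3 : multiplicity I q.asIdeal = (localLength (q.asIdeal.comap (faceHom j))
        (Q k (n + 1) ⧸ (RingHom.ker f ⊔ Ideal.span {t j}))).toNat := by
      rw [multiplicity_eq_localLength (faceHom j) hsurj I q.asIdeal hqI]
      congr 2 <;> rw [hcomap]
    have h4 : RingHom.ker (algebraMap (Q k (n + 1)) R) = RingHom.ker f := rfl
    rw [h4, ← h3] at h2
    rw [Finsupp.smul_apply]
    simp only [fundamentalCycle, Finsupp.ofSupportFinite_coe, if_pos hqI]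
    have h5 : (m : ℤ) * (multiplicity I q.asIdeal : ℤ) = ((l.map fun x => (localLength
        (q.asIdeal.comap (faceHom j)) (R ⧸ Ideal.span {x})).toNat).sum : ℕ) := by
      rw [h2]
      simp
    rw [smul_eq_mul, h5, Nat.cast_multiset_sum, Multiset.map_map]
    congr 1
    refine Multiset.map_congr rfl fun x hx => ?_
    obtain ⟨h, hh, hpc⟩ := hpt x hx
    have := hdom x hx
    simp only [Function.comp_apply, Finsupp.applyAddHom_apply]
    rw [hpc, homCycle_apply]
    have hrange : (h : Q k n →+* R ⧸ Ideal.span {x}).range =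
        (algebraMap (Q k (n + 1)) (R ⧸ Ideal.span {x})).range := by
      ext y
      constructor
      · rintro ⟨b, rfl⟩
        obtain ⟨a, rfl⟩ := face_surjective j b
        exact ⟨a, (hh a).symm⟩
      · rintro ⟨a, rfl⟩
        exact ⟨face j a, hh a⟩
    have hkiff : RingHom.ker h = q.asIdeal ↔
        RingHom.ker (algebraMap (Q k (n + 1)) (R ⧸ Ideal.span {x})) =
          q.asIdeal.comap (faceHom j) := by
      have h6 : RingHom.ker (algebraMap (Q k (n + 1)) (R ⧸ Ideal.span {x})) =
          (RingHom.ker h).comap (faceHom j) := by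
        ext a
        rw [RingHom.mem_ker, Ideal.mem_comap, RingHom.mem_ker, ← hh]
        rfl
      rw [h6]
      exact (Ideal.comap_injective_of_surjective _ hsurj).eq_iff.symm
    have h7 := (localLength_quotient_prime (k := k) (q.asIdeal.comap (faceHom j)) (hl x hx)).2
    by_cases hk : RingHom.ker h = q.asIdeal
    · rw [if_pos hk, h7.1 (hkiff.1 hk), hrange, subringLength_range]
    · rw [if_neg hk, h7.2 fun h8 => hk (hkiff.2 h8)]
      simp
  -- At points off the intersection with the face both sides vanish.
  · have h1 : q.asIdeal ∉ I.minimalPrimes := fun h => hq h.1.2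
    rw [Finsupp.smul_apply]
    simp only [fundamentalCycle, Finsupp.ofSupportFinite_coe, if_neg h1, smul_zero]
    symm
    refine Multiset.sum_eq_zero fun y hy => ?_
    obtain ⟨x, hx, rfl⟩ := Multiset.mem_map.1 hy
    obtain ⟨h, hh, hpc⟩ := hpt x hx
    have := hdom x hx
    simp only [Function.comp_apply, Finsupp.applyAddHom_apply]
    rw [hpc, homCycle_apply, if_neg]
    intro h2
    exact hq (h2 ▸ hle x hx h hh)

/-- The boundary of a good parametrized curve, as a combination of points given by the prime
factors of the coordinates. -/
theorem sum_mem_boundaries (hf : IsGoodCurve f) (l : Fin (n + 2) → Multiset R)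
    (hl : ∀ j, ∀ x ∈ l j, Prime x) (hlj : ∀ j, Associated (l j).prod (f (t j))) :
    ∑ j : Fin (n + 2), (-1 : ℤ) ^ (j : ℕ) • ((l j).map fun x => pointCycle k
      (fun i => Ideal.Quotient.mk (Ideal.span {x}) (f (t (j.succAbove i))))).sum ∈
      boundaries k n n := by
  obtain ⟨m, hm⟩ := hf.exists_smul_fundamentalCycle
  refine ⟨Finsupp.single ⟨RingHom.ker f, RingHom.ker_isPrime f⟩ (m : ℤ),
    Finsupp.single_mem_supported ℤ _ hf.isGood, ?_⟩
  simp only [boundary, AddMonoidHom.finsetSum_apply, AddMonoidHom.smul_apply]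
  refine Finset.sum_congr rfl fun j _ => ?_
  rw [restrict_single, ← hm j (l j) (hl j) (hlj j)]

end IsGoodCurve

end Relation

/-! ### Torus points with values in extension fields -/

section PointCycleLemmas

variable {k : Type u} [Field k]

theorem homCycle_comp_algEquiv {n : ℕ} {K L : Type*} [CommRing K] [CommRing L] [Algebra k K]
    [Algebra k L] (e : K ≃ₐ[k] L) (g : Q k n →ₐ[k] K) :
    homCycle (e.toAlgHom.comp g) = homCycle g := by
  have hker : RingHom.ker (e.toAlgHom.comp g) = RingHom.ker g := by
    ext x
    simp [RingHom.mem_ker]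
  have hlen : subringLength (e.toAlgHom.comp g : Q k n →+* L).range =
      subringLength (g : Q k n →+* K).range := by
    let i1 : Algebra (Q k n) K := (g : Q k n →+* K).toAlgebra
    let i2 : Algebra (Q k n) L := (e.toAlgHom.comp g : Q k n →+* L).toAlgebra
    have h1 : (e.toAlgHom.comp g : Q k n →+* L) = algebraMap (Q k n) L := rfl
    have h2 : (g : Q k n →+* K) = algebraMap (Q k n) K := rfl
    rw [h1, h2, subringLength_range, subringLength_range]
    congr 1
    refine (LinearEquiv.length_eq (R := Q k n) { e.toAddEquiv with map_smul' := ?_ }).symm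
    intro a x
    simp only [Algebra.smul_def]
    exact map_mul e (g a) x
  unfold homCycle
  by_cases h : (RingHom.ker g).IsPrime
  · have h' : (RingHom.ker (e.toAlgHom.comp g)).IsPrime := hker ▸ h
    rw [dif_pos h, dif_pos h', hlen]
    congr 1
    exact PrimeSpectrum.ext hker
  · have h' : ¬ (RingHom.ker (e.toAlgHom.comp g)).IsPrime := hker ▸ h
    rw [dif_neg h, dif_neg h']

theorem pointCycle_comp_algEquiv {n : ℕ} {K L : Type*} [CommRing K] [CommRing L] [Algebra k K]
    [Algebra k L] (e : K ≃ₐ[k] L) (v : Fin (n + 1) → K) :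
    pointCycle k (fun i => e (v i)) = pointCycle k v := by
  by_cases hv : ∑ i, v i = 0
  · have hv' : ∑ i, e (v i) = 0 := by rw [← map_sum, hv, map_zero]
    rw [pointCycle_of_sum hv, pointCycle_of_sum hv', ← homCycle_comp_algEquiv e]
    congr 1
    exact algHom_ext fun i => by simp [lift_t]
  · have hv' : ¬ ∑ i, e (v i) = 0 := by
      rw [← map_sum]
      exact fun h => hv ((map_eq_zero_iff e e.injective).1 h)
    rw [pointCycle, pointCycle, dif_neg hv, dif_neg hv']

/-- It replaces the abstract residue field R / x by a field `K` in which the coordinates can be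
computed by evaluation. -/
theorem pointCycle_quotient {n : ℕ} {R K : Type*} [CommRing R] [CommRing K] [Algebra k R]
    [Algebra k K] (ρ : R →ₐ[k] K) (hρ : Function.Surjective ρ) {x : R}
    (hx : RingHom.ker ρ = Ideal.span {x}) (v : Fin (n + 1) → R) :
    pointCycle k (fun i => Ideal.Quotient.mk (Ideal.span {x}) (v i)) =
      pointCycle k (fun i => ρ (v i)) := by
  let e : (R ⧸ Ideal.span {x}) ≃ₐ[k] K :=
    (Ideal.quotientEquivAlgOfEq k hx.symm).trans (Ideal.quotientKerAlgEquivOfSurjective hρ)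
  rw [← pointCycle_comp_algEquiv e]
  rfl

/-- The `K`-valued points of the torus in `Q^n`. -/
structure IsTorusPoint {n : ℕ} {K : Type*} [Field K] (v : Fin (n + 1) → K) : Prop where
  sum_eq : ∑ i, v i = 0
  ne_zero : ∀ i, v i ≠ 0

theorem isMaximal_ker {n : ℕ} {K : Type*} [Field K] [Algebra k K] [Algebra.IsAlgebraic k K]
    (g : Q k n →ₐ[k] K) : (RingHom.ker g).IsMaximal := by
  have : Algebra.IsIntegral k K := ⟨fun x =>
    (Algebra.IsAlgebraic.isAlgebraic x).isIntegral⟩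
  let : Algebra (Q k n) K := (g : Q k n →+* K).toAlgebra
  have : IsScalarTower k (Q k n) K := IsScalarTower.of_algebraMap_eq fun x =>
    (g.commutes x).symm
  have : Algebra.IsIntegral (Q k n) K := Algebra.IsIntegral.tower_top (R := k)
  have := Ideal.isMaximal_comap_of_isIntegral_of_isMaximal (R := Q k n) (⊥ : Ideal K)
  exact this

theorem eq_top_of_ker_le {n : ℕ} {A K : Type*} [CommRing A] [Field K] [Algebra k K]
    [Algebra.IsAlgebraic k K] (g : Q k n →ₐ[k] K) (f : Q k n →+* A) (J : Ideal A)
    {i : Fin (n + 1)} (hi : g (t i) ≠ 0) (h : RingHom.ker g ≤ J.comap f) (ht : f (t i) ∈ J) :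
    J = ⊤ := by
  by_contra hJ
  have h1 : J.comap f ≠ ⊤ := fun h2 => hJ ((Ideal.eq_top_iff_one _).2 (by
    have h3 := (Ideal.eq_top_iff_one _).1 h2
    rwa [Ideal.mem_comap, map_one] at h3))
  have h2 := (isMaximal_ker g).eq_of_le h1 h
  have h3 : t i ∈ RingHom.ker g := by
    rw [h2]
    exact ht
  exact hi h3

/-- A closed point with nonzero coordinates lies on no face, so the conditions on faces are vacuous.
-/
theorem isGood_ker {n : ℕ} {K : Type*} [Field K] [Algebra k K]
    [Algebra.IsAlgebraic k K] (g : Q k n →ₐ[k] K) (h0 : ∀ i, g (t i) ≠ 0) :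
    IsGood n (⟨RingHom.ker g, RingHom.ker_isPrime g⟩ : PrimeSpectrum (Q k n)) where
  height_eq := by
    have := isMaximal_ker g
    exact Q.height_eq_of_isMaximal _
  vertex := fun h => span_range_t_ne_top (eq_top_of_ker_le g (RingHom.id _) _ (h0 0) h
    (Ideal.subset_span ⟨0, rfl⟩))
  face := fun S hS q hq => by
    obtain ⟨i, hi⟩ := hS
    refine absurd (eq_top_of_ker_le g _ _ (h0 i) hq ?_) q.isPrime.ne_top
    have : Ideal.Quotient.mk (Ideal.span ((t : Fin (n + 1) → Q k n) '' S)) (t i) = 0 :=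
      Ideal.Quotient.eq_zero_iff_mem.2 (Ideal.subset_span ⟨i, hi, rfl⟩)
    rw [this]
    exact zero_mem _

/-- Zero-cycles of closed points outside of all faces are closed. -/
theorem single_mem_closedCycles {n : ℕ} {K : Type*} [Field K] [Algebra k K]
    [Algebra.IsAlgebraic k K] (g : Q k (n + 1) →ₐ[k] K) (h0 : ∀ i, g (t i) ≠ 0) (m : ℤ) :
    (Finsupp.single ⟨RingHom.ker g, RingHom.ker_isPrime g⟩ m : Cycle k (n + 1)) ∈
      closedCycles k (n + 1) (n + 1) := by
  refine ⟨Finsupp.single_mem_supported ℤ m (isGood_ker g h0), ?_⟩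
  change boundary k (n + 1) _ = 0
  simp only [boundary, AddMonoidHom.finsetSum_apply, AddMonoidHom.smul_apply]
  refine Finset.sum_eq_zero fun j _ => ?_
  have h : (RingHom.ker g).map (faceHom j) = ⊤ := by
    refine eq_top_of_ker_le g (faceHom j) _ (h0 j) Ideal.le_comap_map ?_
    have h1 : faceHom j (t j : Q k (n + 1)) = 0 := face_t_self j
    rw [h1]
    exact zero_mem _
  rw [restrict_single, h, fundamentalCycle_top, smul_zero, smul_zero]

theorem pointCycle_mem {n : ℕ} {K : Type*} [Field K] [Algebra k K]
    [Algebra.IsAlgebraic k K] {v : Fin (n + 2) → K} (hv : IsTorusPoint v) :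
    pointCycle k v ∈ closedCycles k (n + 1) (n + 1) := by
  rw [pointCycle_of_sum hv.sum_eq, homCycle, dif_pos (RingHom.ker_isPrime _)]
  exact single_mem_closedCycles _ (fun i => by rw [lift_t]; exact hv.ne_zero i) _

theorem subringLength_top (K : Type*) [Field K] : subringLength (⊤ : Subring K) = 1 := by
  let : Algebra K (⊤ : Subring K) := ((Subring.topEquiv (R := K)).symm : K →+* _).toAlgebra
  have : IsScalarTower K (⊤ : Subring K) K := IsScalarTower.of_algebraMap_eq fun _ => rfl
  have h : Module.length (⊤ : Subring K) K = Module.length K K :=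
    (Module.length_eq_of_surjective (R := (⊤ : Subring K)) (S := K)
      (Subring.topEquiv (R := K)).symm.surjective).symm
  rw [subringLength, h, Module.length_eq_one]
  rfl

theorem homCycle_of_surjective {n : ℕ} {K : Type*} [Field K] [Algebra k K] (g : Q k n →ₐ[k] K)
    (hg : Function.Surjective g) :
    homCycle g = Finsupp.single ⟨RingHom.ker g, RingHom.ker_isPrime g⟩ 1 := by
  rw [homCycle, dif_pos (RingHom.ker_isPrime g)]
  have : (g : Q k n →+* K).range = ⊤ := RingHom.range_eq_top.2 hg
  rw [this, subringLength_top]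
  rfl

theorem pointCycle_self {n : ℕ} {v : Fin (n + 1) → k} (hv : ∑ i, v i = 0) :
    pointCycle k v = Finsupp.single (ratPoint v hv) 1 := by
  rw [pointCycle_of_sum hv]
  exact homCycle_of_surjective _ fun c => ⟨algebraMap k _ c, (lift v hv).commutes c⟩

end PointCycleLemmas

/-! ### Curves whose zeros have a common residue field -/

section Evaluation

variable {k : Type u} [Field k] {n : ℕ} {R : Type u} [CommRing R] [IsDomain R]
  [IsPrincipalIdealRing R] [Algebra k R] {f : Q k (n + 1) →ₐ[k] R}

/-- A variant of `IsGoodCurve.sum_mem_boundaries`, for coordinates which factor into primes with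
residue field `K`. -/
theorem IsGoodCurve.sum_pointCycle_mem (hf : IsGoodCurve f) {ι K : Type*} [Field K] [Algebra k K]
    (x : ι → R) (ρ : ι → R →ₐ[k] K) (hρ : ∀ i, Function.Surjective (ρ i))
    (hx : ∀ i, RingHom.ker (ρ i) = Ideal.span {x i}) (hx0 : ∀ i, x i ≠ 0)
    (l : Fin (n + 2) → Multiset ι)
    (hl : ∀ j, Associated ((l j).map x).prod (f (t j))) :
    ∑ j : Fin (n + 2), (-1 : ℤ) ^ (j : ℕ) • ((l j).map fun i => pointCycle k
      (fun s => ρ i (f (t (j.succAbove s))))).sum ∈ boundaries k n n := by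
  have hp : ∀ i, Prime (x i) := fun i => by
    rw [← Ideal.span_singleton_prime (hx0 i), ← hx]
    exact RingHom.ker_isPrime _
  have h := hf.sum_mem_boundaries (fun j => (l j).map x) (fun j y hy => by
    obtain ⟨i, -, rfl⟩ := Multiset.mem_map.1 hy
    exact hp i) hl
  convert h using 4 with j
  rw [Multiset.map_map]
  exact Multiset.map_congr rfl fun i _ => (pointCycle_quotient (ρ i) (hρ i) (hx i) _).symm

end Evaluation

/-! ### Curves parametrized by the line and the punctured line -/

section RationalCurves

variable {k : Type u} [Field k]

/-- After division by the leading coefficient, P minus its value at `x` is a monic equation for `x`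
over the integral closure of `B`, because that closure contains the image of `K`. -/
theorem isIntegral_of_isIntegral_aeval {B K R : Type*} [CommRing B] [Field K] [CommRing R]
    [Nontrivial R] [Algebra B R] [Algebra K R] (hK : ∀ c : K, IsIntegral B (algebraMap K R c)) {x : R}
    {P : Polynomial K} (hP : 0 < P.natDegree) (h : IsIntegral B (Polynomial.aeval x P)) :
    IsIntegral B x := by
  let C := integralClosure B R
  let φ : K →+* C := (algebraMap K R).codRestrict C hK
  have hP0 : P ≠ 0 := fun h0 => by simp [h0] at hP
  have hmon : (Polynomial.C P.leadingCoeff⁻¹ * P).Monic := by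
    rw [mul_comm]
    exact Polynomial.monic_mul_leadingCoeff_inv hP0
  have hc : IsIntegral B (algebraMap K R P.leadingCoeff⁻¹ * Polynomial.aeval x P) :=
    (hK _).mul h
  have : IsIntegral C x := by
    refine ⟨(Polynomial.C P.leadingCoeff⁻¹ * P).map φ - Polynomial.C ⟨_, hc⟩, ?_, ?_⟩
    · have : Nontrivial C := inferInstance
      refine (hmon.map φ).sub_of_left (lt_of_le_of_lt Polynomial.degree_C_le ?_)
      rw [hmon.degree_map]
      rw [← Polynomial.natDegree_pos_iff_degree_pos,
        Polynomial.natDegree_C_mul (inv_ne_zero (Polynomial.leadingCoeff_ne_zero.2 hP0))]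
      exact hP
    · rw [Polynomial.eval₂_sub, Polynomial.eval₂_C, Polynomial.eval₂_map,
        Polynomial.eval₂_mul, Polynomial.eval₂_C]
      exact sub_self _
  exact isIntegral_trans (A := C) x this

/-- A criterion for curves with coordinates in a ring over a finite extension `K` of `k`. -/
theorem isGoodCurve_lift {n : ℕ} {K R : Type u} [Field K] [Algebra k K] [FiniteDimensional k K]
    [CommRing R] [IsDomain R] [Algebra k R] [Algebra K R] [IsScalarTower k K R] {s : Set R}
    (hs : s.Finite) (hadj : Algebra.adjoin K s = ⊤) (htr : Algebra.trdeg K R ≤ 1)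
    (F : Fin (n + 2) → R) (hF : ∑ i, F i = 0) (h0 : ∀ i, F i ≠ 0)
    (hcop : ∀ i j, i ≠ j → IsCoprime (F i) (F j)) (hunit : ∃ j, ¬ IsUnit (F j))
    (hint : ∀ (B : Type u) [CommRing B] [Algebra B R],
      (∀ c : K, IsIntegral B (algebraMap K R c)) → (∀ i, IsIntegral B (F i)) →
      ∀ x ∈ s, IsIntegral B x) :
    IsGoodCurve (lift (k := k) F hF) where
  finiteType := by
    have : Algebra.FiniteType K R := ⟨⟨hs.toFinset, by rw [Set.Finite.coe_toFinset, hadj]⟩⟩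
    exact Algebra.FiniteType.trans (S := K) inferInstance this
  isIntegral := by
    let f : Q k (n + 1) →ₐ[k] R := lift (k := k) F hF
    let := (f : Q k (n + 1) →+* R).toAlgebra
    have hst : IsScalarTower k (Q k (n + 1)) R :=
      IsScalarTower.of_algebraMap_eq fun x => (f.commutes x).symm
    have hK : ∀ c : K, IsIntegral (Q k (n + 1)) (algebraMap K R c) := fun c =>
      have h : IsIntegral k (algebraMap K R c) :=
        (Algebra.IsIntegral.isIntegral c).map (IsScalarTower.toAlgHom k K R)
      h.tower_top
    have hFi : ∀ i, IsIntegral (Q k (n + 1)) (F i) := fun i => by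
      have : algebraMap (Q k (n + 1)) R (t i) = F i := lift_t F hF i
      rw [← this]
      exact isIntegral_algebraMap
    intro x
    change IsIntegral (Q k (n + 1)) x
    have hx : x ∈ Algebra.adjoin K s := hadj ▸ Algebra.mem_top
    induction hx using Algebra.adjoin_induction with
    | mem x hx => exact hint _ hK hFi x hx
    | algebraMap c => exact hK c
    | add x y _ _ hx hy => exact hx.add hy
    | mul x y _ _ hx hy => exact hx.mul hy
  trdeg_le := by
    have : FaithfulSMul K R := inferInstance
    rw [← trdeg_add_eq k K, trdeg_eq_zero, zero_add]
    exact htr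
  ne_zero := fun j => by
    rw [lift_t]
    exact h0 j
  isCoprime := fun i j hij => by
    rw [lift_t, lift_t]
    exact hcop i j hij
  exists_not_isUnit := by
    simpa only [lift_t] using hunit

-- One nonconstant coordinate suffices to make X integral over the coordinate ring.
open Polynomial in
theorem isGoodCurve_polynomial {n : ℕ} {K : Type u} [Field K] [Algebra k K]
    [FiniteDimensional k K] (F : Fin (n + 2) → K[X]) (hF : ∑ i, F i = 0)
    (h0 : ∀ i, F i ≠ 0) (hcop : ∀ i j, i ≠ j → IsCoprime (F i) (F j))
    (hdeg : ∃ j, 0 < (F j).natDegree) : IsGoodCurve (lift (k := k) F hF) := by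
  refine isGoodCurve_lift (K := K) (s := {X}) (Set.finite_singleton _) Polynomial.adjoin_X
    Polynomial.trdeg_of_isDomain.le F hF h0 hcop ?_ ?_
  · obtain ⟨j, hj⟩ := hdeg
    exact ⟨j, fun h => hj.ne' (Polynomial.natDegree_eq_zero_of_isUnit h)⟩
  · rintro B _ _ hK hFi x rfl
    obtain ⟨j, hj⟩ := hdeg
    refine isIntegral_of_isIntegral_aeval hK hj ?_
    rw [Polynomial.aeval_X_left_apply]
    exact hFi j

open Polynomial in
theorem ker_aeval_eq_span {K : Type*} [Field K] [Algebra k K] (w : K) :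
    RingHom.ker ((aeval w : K[X] →ₐ[K] K).restrictScalars k) = Ideal.span {X - C w} := by
  ext p
  rw [RingHom.mem_ker, Ideal.mem_span_singleton, dvd_iff_isRoot]
  exact Iff.rfl

section Laurent

open LaurentPolynomial

/-- Every ideal of the localization is extended from K[X]. -/
instance {K : Type*} [Field K] : IsPrincipalIdealRing K[T;T⁻¹] where
  principal I := by
    obtain ⟨g, hg⟩ := IsPrincipalIdealRing.principal (I.comap (algebraMap (Polynomial K) K[T;T⁻¹]))
    refine ⟨⟨algebraMap _ _ g, ?_⟩⟩
    have h := IsLocalization.map_under (Submonoid.powers (Polynomial.X : Polynomial K)) K[T;T⁻¹] I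
    rw [← h, Ideal.under, hg, ← Set.image_singleton]
    exact Ideal.map_span _ _

theorem trdeg_laurentPolynomial (K : Type*) [Field K] : Algebra.trdeg K K[T;T⁻¹] ≤ 1 := by
  have : IsScalarTower K (Polynomial K) K[T;T⁻¹] := IsScalarTower.of_algebraMap_eq fun c =>
    (Polynomial.toLaurent_C c).symm
  have : FaithfulSMul (Polynomial K) K[T;T⁻¹] :=
    (faithfulSMul_iff_algebraMap_injective _ _).2 Polynomial.toLaurent_injective
  have : Algebra.IsAlgebraic (Polynomial K) K[T;T⁻¹] :=
    IsLocalization.isAlgebraic _ (Submonoid.powers (Polynomial.X : Polynomial K))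
  rw [← trdeg_add_eq K (Polynomial K), trdeg_eq_zero (R := Polynomial K), add_zero, Polynomial.trdeg_of_isDomain]

/-- The punctured line has two ends, and integrality needs a pole at each: the coordinate ξT makes T
integral, and then the coordinate with leading term α/T makes T⁻¹ integral. -/
theorem isGoodCurve_laurentPolynomial {n : ℕ} {K : Type u} [Field K] [Algebra k K]
    [FiniteDimensional k K] (F : Fin (n + 2) → K[T;T⁻¹]) (hF : ∑ i, F i = 0)
    (h0 : ∀ i, F i ≠ 0) (hcop : ∀ i j, i ≠ j → IsCoprime (F i) (F j))
    (hunit : ∃ j, ¬ IsUnit (F j)) {i j : Fin (n + 2)} {ξ α β γ : K} (hξ : ξ ≠ 0) (hα : α ≠ 0)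
    (hi : F i = C ξ * T 1) (hj : F j = C α * T (-1) + C β + C γ * T 1) :
    IsGoodCurve (lift (k := k) F hF) := by
  refine isGoodCurve_lift (K := K) (s := {T 1, T (-1)}) (by simp) ?_
    (trdeg_laurentPolynomial K) F hF h0 hcop hunit ?_
  · rw [eq_top_iff]
    rintro x -
    induction x using LaurentPolynomial.induction_on_mul_T with
    | _ f n =>
    have h1 : Polynomial.toLaurent f ∈ Algebra.adjoin K ({T 1, T (-1)} : Set K[T;T⁻¹]) := by
      induction f using Polynomial.induction_on' with
      | add p q hp hq =>
        rw [map_add]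
        exact add_mem hp hq
      | monomial m a =>
        rw [← Polynomial.C_mul_X_pow_eq_monomial, map_mul, map_pow, Polynomial.toLaurent_X,
          Polynomial.toLaurent_C]
        exact mul_mem (Subalgebra.algebraMap_mem _ a)
          (pow_mem (Algebra.subset_adjoin (Set.mem_insert _ _)) m)
    have h2 : (T (-(n : ℤ)) : K[T;T⁻¹]) = T (-1) ^ n := by rw [T_pow, mul_neg_one]
    rw [h2]
    exact mul_mem h1 (pow_mem (Algebra.subset_adjoin (by simp)) n)
  · intro B _ _ hK hFi x hx
    have hC : ∀ c : K, IsIntegral B (C c : K[T;T⁻¹]) := hK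
    have hT : IsIntegral B (T 1 : K[T;T⁻¹]) := by
      have h1 : (T 1 : K[T;T⁻¹]) = C ξ⁻¹ * F i := by
        rw [hi, ← mul_assoc, ← map_mul, inv_mul_cancel₀ hξ, map_one, one_mul]
      rw [h1]
      exact (hC _).mul (hFi i)
    rcases hx with rfl | rfl
    · exact hT
    · have h1 : (T (-1) : K[T;T⁻¹]) = C α⁻¹ * (F j - C β - C γ * T 1) := by
        rw [hj, add_assoc, sub_sub, add_sub_cancel_right, ← mul_assoc, ← map_mul,
          inv_mul_cancel₀ hα, map_one, one_mul]
      rw [h1]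
      exact (hC _).mul (((hFi j).sub (hC _)).sub ((hC _).mul hT))

/-- Evaluation of Laurent polynomials at a unit. -/
def laurentEval (k : Type u) [Field k] {K : Type*} [Field K] [Algebra k K] (w : Kˣ) :
    K[T;T⁻¹] →ₐ[k] K :=
  { LaurentPolynomial.eval₂ (RingHom.id K) w with
    commutes' := fun c => LaurentPolynomial.eval₂_C (RingHom.id K) w (algebraMap k K c) }

theorem laurentEval_C {K : Type*} [Field K] [Algebra k K] (w : Kˣ) (c : K) :
    laurentEval k w (C c) = c := LaurentPolynomial.eval₂_C (RingHom.id K) w c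

theorem laurentEval_T {K : Type*} [Field K] [Algebra k K] (w : Kˣ) :
    laurentEval k w (T 1) = w := by
  have := LaurentPolynomial.eval₂_T (RingHom.id K) w 1
  rwa [zpow_one] at this

theorem laurentEval_T_neg {K : Type*} [Field K] [Algebra k K] (w : Kˣ) :
    laurentEval k w (T (-1)) = (w : K)⁻¹ := by
  have := LaurentPolynomial.eval₂_T (RingHom.id K) w (-1)
  rwa [zpow_neg_one, Units.val_inv_eq_inv_val] at this

/-- A power of T clears the denominators, and the factor theorem applies to the resulting
polynomial. -/
theorem ker_laurentEval {K : Type*} [Field K] [Algebra k K] (w : Kˣ) :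
    RingHom.ker (laurentEval k w) = Ideal.span {(T 1 - C (w : K) : K[T;T⁻¹])} := by
  apply le_antisymm
  · intro x hx
    obtain ⟨n, p, hp⟩ := exists_T_pow x
    have h1 : p.eval (w : K) = 0 := by
      have h2 : laurentEval k w (Polynomial.toLaurent p) = p.eval (w : K) :=
        LaurentPolynomial.eval₂_toLaurent (RingHom.id K) w p
      rw [← h2, hp, map_mul, hx, zero_mul]
    obtain ⟨q, rfl⟩ := Polynomial.dvd_iff_isRoot.2 h1
    have h3 : x = Polynomial.toLaurent ((Polynomial.X - Polynomial.C (w : K)) * q) * T (-n) := by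
      rw [hp, mul_assoc, ← T_add, add_neg_cancel, T_zero, mul_one]
    rw [h3, map_mul, map_sub, Polynomial.toLaurent_X, Polynomial.toLaurent_C, mul_assoc]
    exact Ideal.mul_mem_right _ _ (Ideal.subset_span rfl)
  · rw [Ideal.span_le, Set.singleton_subset_iff, SetLike.mem_coe, RingHom.mem_ker, map_sub,
      laurentEval_C, laurentEval_T, sub_self]

end Laurent

end RationalCurves

/-! ### Classes of torus points and the boundary relation -/

section TorusClass

variable {k : Type u} [Field k] {n : ℕ}

open Classical in
/-- The class in `SH^(n+1)(k, n+1)` of a `K`-valued point of the torus in `Q^(n+1)`, and zero for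
a family which is not such a point. -/
def torusClass (k : Type u) [Field k] {n : ℕ} {K : Type*} [Field K] [Algebra k K]
    [Algebra.IsAlgebraic k K] (v : Fin (n + 2) → K) : SH k (n + 1) (n + 1) :=
  if hv : IsTorusPoint v then QuotientAddGroup.mk ⟨pointCycle k v, pointCycle_mem hv⟩ else 0

variable {K : Type*} [Field K] [Algebra k K] [Algebra.IsAlgebraic k K]

theorem torusClass_of_isTorusPoint {v : Fin (n + 2) → K} (hv : IsTorusPoint v) :
    torusClass k v = QuotientAddGroup.mk ⟨pointCycle k v, pointCycle_mem hv⟩ := dif_pos hv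

theorem torusClass_of_not {v : Fin (n + 2) → K} (hv : ¬ IsTorusPoint v) :
    torusClass k v = 0 := dif_neg hv

theorem torusClass_of_eq_zero {v : Fin (n + 2) → K} (i : Fin (n + 2)) (hi : v i = 0) :
    torusClass k v = 0 := torusClass_of_not fun h => h.ne_zero i hi

theorem torusClass_self {v : Fin (n + 2) → k} (hv : ∑ i, v i = 0) (h0 : ∀ i, v i ≠ 0) :
    torusClass k v = pointClass v hv h0 := by
  rw [torusClass_of_isTorusPoint ⟨hv, h0⟩]
  congr 2
  exact pointCycle_self hv

theorem map_ne_zero_of_isCoprime {R : Type*} [CommRing R] {x y : R} (h : IsCoprime x y) {S : Type*}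
    [CommRing S] [Nontrivial S] (f : R →+* S) (hx : f x = 0) : f y ≠ 0 := by
  intro hy
  obtain ⟨a, b, hab⟩ := h
  have := congrArg f hab
  rw [map_add, map_mul, map_mul, hx, hy, mul_zero, mul_zero, add_zero, map_one] at this
  exact zero_ne_one this

variable {R : Type u} [CommRing R] [IsDomain R] [IsPrincipalIdealRing R] [Algebra k R]

/-- The boundary of a parametrized curve, in `SH^(n+1)(k, n+1)`. -/
theorem IsGoodCurve.sum_torusClass (F : Fin (n + 3) → R) (hF : ∑ i, F i = 0)
    (hf : IsGoodCurve (lift (k := k) F hF)) {ι : Type*}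
    (x : ι → R) (ρ : ι → R →ₐ[k] K) (hρ : ∀ i, Function.Surjective (ρ i))
    (hx : ∀ i, RingHom.ker (ρ i) = Ideal.span {x i}) (hx0 : ∀ i, x i ≠ 0)
    (l : Fin (n + 3) → Multiset ι) (hl : ∀ j, Associated ((l j).map x).prod (F j)) :
    ∑ j : Fin (n + 3), (-1 : ℤ) ^ (j : ℕ) • ((l j).map fun i => torusClass k
      (fun s => ρ i (F (j.succAbove s)))).sum = 0 := by
  -- At a zero of the coordinate `j` the other coordinates do not vanish, by coprimality, so they
  -- form a point of the torus.
  have hpt : ∀ j, ∀ i ∈ l j, IsTorusPoint (fun s => ρ i (F (j.succAbove s))) := fun j i hi => by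
    have h0 : ρ i (F j) = 0 := by
      obtain ⟨y, hy⟩ := (Multiset.dvd_prod (Multiset.mem_map_of_mem x hi)).trans (hl j).dvd
      have hxi : ρ i (x i) = 0 := by
        rw [← RingHom.mem_ker, hx]
        exact Ideal.subset_span rfl
      rw [hy, map_mul, hxi, zero_mul]
    refine ⟨?_, fun s => ?_⟩
    · have := congrArg (ρ i) hF
      rwa [map_sum, map_zero, Fin.sum_univ_succAbove _ j, h0, zero_add] at this
    · have := hf.isCoprime j (j.succAbove s) (Fin.succAbove_ne j s).symm
      rw [lift_t, lift_t] at this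
      exact map_ne_zero_of_isCoprime this (ρ i : R →+* K) h0
  -- The summands are lifted to closed cycles; the default 0 never occurs for indices from `l j`.
  let c : Fin (n + 3) → ι → closedCycles k (n + 1) (n + 1) := fun j i =>
    open Classical in if h : IsTorusPoint (fun s => ρ i (F (j.succAbove s))) then
      ⟨pointCycle k (fun s => ρ i (F (j.succAbove s))), pointCycle_mem h⟩ else 0
  have hc : ∀ j, ∀ i ∈ l j, (c j i : Cycle k (n + 1)) =
      pointCycle k (fun s => ρ i (F (j.succAbove s))) := fun j i hi => by
    simp only [c, dif_pos (hpt j i hi)]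
  have hT : ∀ j, ∀ i ∈ l j, torusClass k (fun s => ρ i (F (j.succAbove s))) =
      QuotientAddGroup.mk' _ (c j i) := fun j i hi => by
    rw [torusClass_of_isTorusPoint (hpt j i hi)]
    simp only [c, dif_pos (hpt j i hi)]
    rfl
  have h := hf.sum_pointCycle_mem x ρ hρ hx hx0 l (fun j => by rw [lift_t]; exact hl j)
  simp only [lift_t] at h
  have h1 : ∑ j : Fin (n + 3), (-1 : ℤ) ^ (j : ℕ) • ((l j).map fun i => torusClass k
      (fun s => ρ i (F (j.succAbove s)))).sum =
      QuotientAddGroup.mk' _ (∑ j : Fin (n + 3), (-1 : ℤ) ^ (j : ℕ) • ((l j).map (c j)).sum) := by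
    rw [map_sum]
    refine Finset.sum_congr rfl fun j _ => ?_
    rw [map_zsmul, map_multiset_sum, Multiset.map_map]
    congr 2
    exact Multiset.map_congr rfl (hT j)
  rw [h1]
  refine (QuotientAddGroup.eq_zero_iff _).2 ?_
  rw [AddSubgroup.mem_addSubgroupOf]
  convert h using 1
  rw [← AddSubgroup.coe_subtype, map_sum]
  refine Finset.sum_congr rfl fun j _ => ?_
  rw [map_zsmul, map_multiset_sum, Multiset.map_map]
  congr 2
  exact Multiset.map_congr rfl (hc j)

end TorusClass

/-! ### The action of the multiplicative group on torus points -/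

section Star

variable {k : Type u} [Field k] {n : ℕ}

/-- Scaling is a `k`-automorphism of the coordinate ring, so the image ring in `K`, and with it the
degree of the point, is unchanged. -/
theorem star_torusClass_mk {K : Type*} [Field K] [Algebra k K] [Algebra.IsAlgebraic k K]
    (a : kˣ) (v : Fin (n + 2) → K) :
    star a (torusClass k v) = torusClass k (fun i => ((a : k)⁻¹) • v i) := by
  by_cases hv : IsTorusPoint v
  · have hv' : IsTorusPoint (fun i => ((a : k)⁻¹) • v i) :=
      ⟨by rw [← Finset.smul_sum, hv.sum_eq, smul_zero],
        fun i => smul_ne_zero (inv_ne_zero a.ne_zero) (hv.ne_zero i)⟩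
    rw [torusClass_of_isTorusPoint hv, torusClass_of_isTorusPoint hv']
    change QuotientAddGroup.mk _ = _
    congr 1
    apply Subtype.ext
    change starCycle a (pointCycle k v) = pointCycle k _
    rw [pointCycle_of_sum hv.sum_eq, pointCycle_of_sum hv'.sum_eq]
    have hcomp : lift (k := k) _ hv'.sum_eq = (lift (k := k) v hv.sum_eq).comp
        (scale a : Q k (n + 1) ≃ₐ[k] Q k (n + 1)).toAlgHom := algHom_ext fun i => by
      simp only [AlgHom.comp_apply, AlgEquiv.toAlgHom_apply, scale_t, map_smul, lift_t]
    have hrange : (lift (k := k) _ hv'.sum_eq : Q k (n + 1) →+* K).range =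
        (lift (k := k) v hv.sum_eq : Q k (n + 1) →+* K).range := by
      rw [hcomp]
      refine SetLike.coe_injective ?_
      exact (scale a : Q k (n + 1) ≃ₐ[k] Q k (n + 1)).surjective.range_comp
        (lift (k := k) v hv.sum_eq)
    rw [homCycle, homCycle, dif_pos (RingHom.ker_isPrime _), dif_pos (RingHom.ker_isPrime _),
      starCycle_single, hrange]
    congr 1
    refine PrimeSpectrum.ext ?_
    rw [starPoint_asIdeal, hcomp]
    rfl
  · have hv' : ¬ IsTorusPoint (fun i => ((a : k)⁻¹) • v i) := fun h => hv
      ⟨by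
        have := h.sum_eq
        rw [← Finset.smul_sum] at this
        exact (smul_eq_zero.1 this).resolve_left (inv_ne_zero a.ne_zero), fun i hi =>
        h.ne_zero i (by rw [hi, smul_zero])⟩
    rw [torusClass_of_not hv, torusClass_of_not hv', map_zero]

end Star

/-! ### Inserting a coordinate into a family -/

section Insertion

variable {n : ℕ}

theorem isCoprime_of_isUnit {ι R : Type*} [CommRing R] {F : ι → R} {p q : ι}
    (hu : ∀ i, i ≠ p → i ≠ q → IsUnit (F i)) (hpq : IsCoprime (F p) (F q)) {i j : ι}
    (hij : i ≠ j) : IsCoprime (F i) (F j) := by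
  by_cases hi : i ≠ p ∧ i ≠ q
  · exact (isCoprime_one_left.of_isCoprime_of_dvd_left (hu i hi.1 hi.2).dvd : IsCoprime (F i) (F j))
  by_cases hj : j ≠ p ∧ j ≠ q
  · exact (isCoprime_one_right.of_isCoprime_of_dvd_right (hu j hj.1 hj.2).dvd)
  have h : (i = p ∧ j = q) ∨ (i = q ∧ j = p) := by grind
  rcases h with ⟨rfl, rfl⟩ | ⟨rfl, rfl⟩
  · exact hpq
  · exact hpq.symm

/-- It compares the points on two adjacent faces: once the coordinate after the inserted one is
omitted, the inserted one stands in its place. -/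
theorem insertNth_castSucc_succAbove_succ {α : Type*} (j : Fin (n + 1)) (P : α)
    (v : Fin (n + 1) → α) (s : Fin (n + 1)) :
    Fin.insertNth (α := fun _ => α) j.castSucc P v (j.succ.succAbove s) =
      Function.update v j P s := by
  rcases lt_trichotomy s j with h | rfl | h
  · have h1 : j.succ.succAbove s = j.castSucc.succAbove s := by
      rw [Fin.succAbove_succ_of_le _ _ h.le, Fin.succAbove_castSucc_of_lt _ _ h]
    rw [h1, Fin.insertNth_apply_succAbove, Function.update_of_ne h.ne]
  · rw [Fin.succAbove_succ_self, Fin.insertNth_apply_same, Function.update_self]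
  · have h1 : j.succ.succAbove s = j.castSucc.succAbove s := by
      rw [Fin.succAbove_succ_of_lt _ _ h, Fin.succAbove_castSucc_of_le _ _ h.le]
    rw [h1, Fin.insertNth_apply_succAbove, Function.update_of_ne h.ne']

theorem sum_insertNth {M : Type*} [AddCommMonoid M] (j : Fin (n + 1)) (P : M) (v : Fin n → M) :
    ∑ i, Fin.insertNth (α := fun _ => M) j P v i = P + ∑ i, v i := by
  rw [Fin.sum_univ_succAbove _ j]
  simp

end Insertion

theorem eq_zero_of_neg_one_pow_zsmul {M : Type*} [AddGroup M] {x : M} {m : ℕ}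
    (h : (-1 : ℤ) ^ m • x = 0) : x = 0 := by
  rcases neg_one_pow_eq_or ℤ m with h1 | h1
  · rwa [h1, one_zsmul] at h
  · rwa [h1, neg_zsmul, one_zsmul, neg_eq_zero] at h

/-! ### Curves which meet only two faces -/

section TwoFaces

variable {k : Type u} [Field k] {n : ℕ} {K : Type*} [Field K] [Algebra k K]
  [Algebra.IsAlgebraic k K] {R : Type u} [CommRing R] [IsDomain R] [IsPrincipalIdealRing R]
  [Algebra k R]

/-- The boundary of a parametrized curve which meets only two faces. -/
theorem IsGoodCurve.add_torusClass (F : Fin (n + 3) → R) (hF : ∑ i, F i = 0)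
    (hf : IsGoodCurve (lift (k := k) F hF)) {ι : Type*}
    (x : ι → R) (ρ : ι → R →ₐ[k] K) (hρ : ∀ i, Function.Surjective (ρ i))
    (hx : ∀ i, RingHom.ker (ρ i) = Ideal.span {x i}) (hx0 : ∀ i, x i ≠ 0)
    {p q : Fin (n + 3)} (hpq : p ≠ q) {lp lq : Multiset ι}
    (hp : Associated (lp.map x).prod (F p)) (hq : Associated (lq.map x).prod (F q))
    (hu : ∀ i, i ≠ p → i ≠ q → IsUnit (F i)) :
    (-1 : ℤ) ^ (p : ℕ) • (lp.map fun i => torusClass k (fun s => ρ i (F (p.succAbove s)))).sum +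
    (-1 : ℤ) ^ (q : ℕ) • (lq.map fun i => torusClass k (fun s => ρ i (F (q.succAbove s)))).sum =
      0 := by
  classical
  have h := hf.sum_torusClass F hF x ρ hρ hx hx0
    (fun i => if i = p then lp else if i = q then lq else 0) (fun j => by
      by_cases h1 : j = p
      · rw [if_pos h1, h1]
        exact hp
      by_cases h2 : j = q
      · rw [if_neg h1, if_pos h2, h2]
        exact hq
      rw [if_neg h1, if_neg h2]
      exact (associated_one_iff_isUnit.2 (hu j h1 h2)).symm)
  rw [Fintype.sum_eq_add p q hpq (fun j hj => by
    rw [if_neg hj.1, if_neg hj.2]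
    simp)] at h
  rwa [if_pos rfl, if_neg hpq.symm, if_pos rfl] at h

/-- The boundary of a parametrized curve which meets only two adjacent faces. -/
theorem IsGoodCurve.sum_torusClass_insertNth (j : Fin (n + 2)) (P : R) (v : Fin (n + 2) → R)
    (hF : ∑ i, Fin.insertNth (α := fun _ => R) j.castSucc P v i = 0)
    (hf : IsGoodCurve (lift (k := k) (Fin.insertNth (α := fun _ => R) j.castSucc P v) hF))
    {ι : Type*}
    (x : ι → R) (ρ : ι → R →ₐ[k] K) (hρ : ∀ i, Function.Surjective (ρ i))
    (hx : ∀ i, RingHom.ker (ρ i) = Ideal.span {x i}) (hx0 : ∀ i, x i ≠ 0) {lp lq : Multiset ι}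
    (hp : Associated (lp.map x).prod P) (hq : Associated (lq.map x).prod (v j))
    (hu : ∀ i, i ≠ j → IsUnit (v i)) :
    (lp.map fun i => torusClass k (fun s => ρ i (v s))).sum =
      (lq.map fun i => torusClass k (fun s => ρ i (Function.update v j P s))).sum := by
  have h := hf.add_torusClass _ _ x ρ hρ hx hx0 (p := j.castSucc) (q := j.succ)
    (Fin.castSucc_lt_succ).ne (lp := lp) (lq := lq) (by simpa using hp)
    (by
      have := Fin.insertNth_apply_succAbove (α := fun _ => R) j.castSucc P v j
      rw [Fin.succAbove_castSucc_self] at this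
      rwa [this])
    (fun i hi hi' => by
      obtain ⟨s, rfl⟩ := Fin.exists_succAbove_eq hi
      rw [Fin.insertNth_apply_succAbove]
      refine hu s fun hs => hi' ?_
      rw [hs, Fin.succAbove_castSucc_self])
  simp only [Fin.insertNth_apply_succAbove, insertNth_castSucc_succAbove_succ, Fin.val_castSucc,
    Fin.val_succ, pow_succ, mul_neg_one, neg_smul] at h
  -- Adjacent faces enter the boundary with opposite signs, so the relation becomes an equality of
  -- two sums.
  rw [← sub_eq_add_neg, ← zsmul_sub] at h
  exact sub_eq_zero.1 (eq_zero_of_neg_one_pow_zsmul h)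

end TwoFaces

/-! ### Exchanging two neighbouring coordinates -/

section Swap

open Polynomial

theorem surjective_aeval_restrictScalars {k : Type u} [Field k] {K : Type*} [Field K]
    [Algebra k K] (w : K) :
    Function.Surjective ((aeval w : K[X] →ₐ[K] K).restrictScalars k) := fun c =>
  ⟨C c, aeval_C _ _⟩

variable {k : Type u} [Field k] {n : ℕ} {K : Type u} [Field K] [Algebra k K]
  [FiniteDimensional k K]

theorem isCoprime_X_C_sub_X {y : K} (hy : y ≠ 0) : IsCoprime (X : K[X]) (C y - X) := by
  refine ⟨C y⁻¹, C y⁻¹, ?_⟩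
  rw [← mul_add, add_sub_cancel, ← C_mul, inv_mul_cancel₀ hy, C_1]

/-- The curve (…, X, v_j, v_(j+1) - X, …) meets only the faces with indices j and j + 2. At X = 0
the remaining coordinates are `v`; at X = v_(j+1) they are `v` with the two entries exchanged. The
two faces carry the same sign, so the classes add up to zero. -/
theorem torusClass_add_swap (j : Fin (n + 1)) (v : Fin (n + 2) → K) :
    torusClass k v + torusClass k (v ∘ Equiv.swap j.castSucc j.succ) = 0 := by
  by_cases hv : IsTorusPoint v
  · let p : Fin (n + 3) := j.castSucc.castSucc
    let q : Fin (n + 3) := j.succ.succ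
    let G : Fin (n + 2) → K[X] := fun i => C (v i) - if i = j.succ then X else 0
    let F : Fin (n + 3) → K[X] := Fin.insertNth (α := fun _ => K[X]) p X G
    have hpq_lt : p < q := by
      simp only [p, q, Fin.lt_def, Fin.val_castSucc, Fin.val_succ]
      omega
    have hpq : p ≠ q := hpq_lt.ne
    have hG : ∑ i, G i = -X := by
      simp only [G]
      rw [Finset.sum_sub_distrib, ← map_sum, hv.sum_eq, map_zero, Finset.sum_ite_eq',
        if_pos (Finset.mem_univ _), zero_sub]
    have hF : ∑ i, F i = 0 := by
      rw [sum_insertNth, hG, add_neg_cancel]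
    have hq1 : p.succAbove j.succ = q :=
      Fin.succAbove_castSucc_of_le _ _ (Fin.castSucc_lt_succ).le
    have hFp : F p = X := Fin.insertNth_apply_same _ _ _
    have hFq : F q = C (v j.succ) - X := by
      rw [← hq1]
      simp only [F, Fin.insertNth_apply_succAbove, G, if_pos]
    have hu : ∀ i, i ≠ p → i ≠ q → IsUnit (F i) := fun i hi hi' => by
      obtain ⟨s, rfl⟩ := Fin.exists_succAbove_eq hi
      have hs : s ≠ j.succ := fun h => hi' (by rw [h, hq1])
      simp only [F, Fin.insertNth_apply_succAbove, G, if_neg hs, sub_zero]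
      exact (IsUnit.mk0 _ (hv.ne_zero s)).map C
    have hcop : IsCoprime (F p) (F q) := by
      rw [hFp, hFq]
      exact isCoprime_X_C_sub_X (hv.ne_zero _)
    have hf : IsGoodCurve (lift (k := k) F hF) := by
      refine isGoodCurve_polynomial F hF (fun i => ?_)
        (fun i j hij => isCoprime_of_isUnit hu hcop hij) ⟨p, by rw [hFp, natDegree_X]; exact one_pos⟩
      by_cases h1 : i = p
      · rw [h1, hFp]
        exact X_ne_zero
      by_cases h2 : i = q
      · rw [h2, hFq]
        exact sub_ne_zero.2 (fun h => by simpa using congrArg natDegree h)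
      exact (hu i h1 h2).ne_zero
    have h := hf.add_torusClass F hF (fun w : K => X - C w)
      (fun w => (aeval w : K[X] →ₐ[K] K).restrictScalars k) surjective_aeval_restrictScalars
      ker_aeval_eq_span X_sub_C_ne_zero hpq (lp := {0}) (lq := {v j.succ})
      (by simp [hFp]) (by
        rw [hFq, Multiset.map_singleton, Multiset.prod_singleton, ← neg_sub]
        exact (Associated.refl _).neg_left) hu
    simp only [Multiset.map_singleton, Multiset.sum_singleton] at h
    -- The indices of the two faces differ by 2, so the signs agree.
    have h1 : (-1 : ℤ) ^ (q : ℕ) = (-1) ^ (p : ℕ) := by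
      simp [p, q, pow_succ]
    have h2 : (fun s => (aeval (0 : K) : K[X] →ₐ[K] K).restrictScalars k (F (p.succAbove s))) = v := by
      funext s
      simp only [F, Fin.insertNth_apply_succAbove, AlgHom.restrictScalars_apply, G]
      by_cases hs : s = j.succ
      · subst hs
        simp
      · simp [hs]
    have h3 : (fun s => (aeval (v j.succ) : K[X] →ₐ[K] K).restrictScalars k (F (q.succAbove s))) =
        v ∘ Equiv.swap j.castSucc j.succ := by
      funext s
      simp only [AlgHom.restrictScalars_apply, Function.comp_apply]
      have hFs : ∀ s, F (p.succAbove s) = G s := fun s =>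
        Fin.insertNth_apply_succAbove _ _ _ _
      by_cases h4 : s = j.castSucc
      · have h5 : q.succAbove s = p := by
          rw [h4, Fin.succAbove_of_castSucc_lt _ _ hpq_lt]
        rw [h5, hFp, aeval_X, h4, Equiv.swap_apply_left]
      by_cases h5 : s = j.succ
      · have h6 : q.succAbove s = p.succAbove j.castSucc := by
          rw [h5, Fin.succAbove_succ_self, Fin.succAbove_castSucc_self, Fin.succ_castSucc]
        rw [h6, hFs, h5, Equiv.swap_apply_right]
        simp only [G, if_neg Fin.castSucc_lt_succ.ne, sub_zero, aeval_C]
        rfl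
      · have h6 : q.succAbove s = p.succAbove s := by
          simp only [p, q, Fin.ext_iff, Fin.val_castSucc, Fin.val_succ, Fin.succAbove,
            Fin.lt_def] at *
          split_ifs <;> grind
        rw [h6, hFs, Equiv.swap_apply_of_ne_of_ne h4 h5]
        simp only [G, if_neg h5, sub_zero, aeval_C]
        rfl
    rw [h1, ← zsmul_add, h2, h3] at h
    exact eq_zero_of_neg_one_pow_zsmul h
  · have hv' : ¬ IsTorusPoint (v ∘ Equiv.swap j.castSucc j.succ) := fun h => hv
      ⟨by rw [← h.sum_eq]; exact (Equiv.sum_comp (Equiv.swap _ _) v).symm, fun i => by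
        have := h.ne_zero (Equiv.swap j.castSucc j.succ i)
        simpa using this⟩
    rw [torusClass_of_not hv, torusClass_of_not hv', add_zero]

end Swap

theorem sum_eq_sum_Iio_add_sum_Ioi {m : ℕ} {M : Type*} [AddCommMonoid M] (j : Fin m)
    (f : Fin m → M) : ∑ i, f i = ∑ i ∈ Finset.Iio j, f i + f j + ∑ i ∈ Finset.Ioi j, f i := by
  classical
  have h : (Finset.univ : Finset (Fin m)) = ((Finset.Iio j).disjUnion {j}
      (by simp)).disjUnion (Finset.Ioi j) (by
        rw [Finset.disjoint_left]
        intro a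
        simp only [Finset.mem_disjUnion, Finset.mem_Iio, Finset.mem_singleton, Finset.mem_Ioi]
        rintro (h | rfl) h'
        · exact h.asymm h'
        · exact lt_irrefl _ h') := by
    ext a
    simp only [Finset.mem_univ, Finset.mem_disjUnion, Finset.mem_Iio, Finset.mem_singleton,
      Finset.mem_Ioi, true_iff]
    rcases lt_trichotomy a j with h | h | h <;> simp [h]
  rw [h, Finset.sum_disjUnion, Finset.sum_disjUnion, Finset.sum_singleton]

/-- The family with entries `c` before the position `j`, with entries `w ξ` after it, and with
`x` at the position `j`. -/
def scaleTail {m : ℕ} {R : Type*} [Mul R] (c ξ : Fin m → R) (j : Fin m) (x w : R) : Fin m → R :=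
  fun i => if i < j then c i else if i = j then x else w * ξ i

section ScaleTail

variable {m : ℕ} {R : Type*} [CommRing R] (c ξ : Fin m → R) (j : Fin m) (x w : R)

theorem scaleTail_self : scaleTail c ξ j x w j = x := by simp [scaleTail]

theorem scaleTail_of_lt {i : Fin m} (h : i < j) : scaleTail c ξ j x w i = c i := by
  simp [scaleTail, h]

theorem scaleTail_of_gt {i : Fin m} (h : j < i) : scaleTail c ξ j x w i = w * ξ i := by
  simp [scaleTail, h.not_gt, h.ne']

theorem sum_scaleTail : ∑ i, scaleTail c ξ j x w i =
    ∑ i ∈ Finset.Iio j, c i + x + w * ∑ i ∈ Finset.Ioi j, ξ i := by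
  rw [sum_eq_sum_Iio_add_sum_Ioi j, scaleTail_self, Finset.mul_sum]
  congr 1
  · congr 1
    exact Finset.sum_congr rfl fun i hi => scaleTail_of_lt _ _ _ _ _ (Finset.mem_Iio.1 hi)
  · exact Finset.sum_congr rfl fun i hi => scaleTail_of_gt _ _ _ _ _ (Finset.mem_Ioi.1 hi)

theorem update_scaleTail (y : R) :
    Function.update (scaleTail c ξ j x w) j y = scaleTail c ξ j y w := by
  funext i
  by_cases h : i = j
  · rw [h, Function.update_self, scaleTail_self]
  · rw [Function.update_of_ne h]
    simp [scaleTail, h]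

theorem map_scaleTail {S : Type*} [CommRing S] (f : R →+* S) (i : Fin m) :
    f (scaleTail c ξ j x w i) = scaleTail (fun i => f (c i)) (fun i => f (ξ i)) j (f x) (f w) i := by
  unfold scaleTail
  split_ifs <;> simp

end ScaleTail

/-! ### Scaling a tail of coordinates along the punctured line -/

section Laurent

open LaurentPolynomial

variable {k : Type u} [Field k] {n : ℕ} {K : Type u} [Field K] [Algebra k K]
  [FiniteDimensional k K]

theorem surjective_laurentEval {K : Type*} [Field K] [Algebra k K] (w : Kˣ) :
    Function.Surjective (laurentEval k w) := fun c => ⟨C c, laurentEval_C w c⟩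

theorem T_sub_C_ne_zero {K : Type*} [Field K] (w : Kˣ) : (T 1 - C (w : K) : K[T;T⁻¹]) ≠ 0 := by
  intro h
  have h1 : Polynomial.toLaurent (Polynomial.X - Polynomial.C (w : K)) = 0 := by
    rw [map_sub, Polynomial.toLaurent_X, Polynomial.toLaurent_C, h]
  exact Polynomial.X_sub_C_ne_zero _ (Polynomial.toLaurent_eq_zero.1 h1)

theorem not_isUnit_of_laurentEval {K : Type*} [Field K] {f : K[T;T⁻¹]} (w : Kˣ)
    (h : laurentEval K w f = 0) : ¬ IsUnit f := fun hf =>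
  (hf.map (laurentEval K w)).ne_zero h

/-- The boundary of a curve `(c | P, Q | w ξ)` with parameter `w` on the punctured line. -/
theorem sum_torusClass_scaleTail {c ξ : Fin (n + 2) → K} {j : Fin (n + 2)}
    (hc : ∀ i, i < j → c i ≠ 0) (hξ : ∀ i, j < i → ξ i ≠ 0) (hj : j < Fin.last (n + 1))
    {P Q : K[T;T⁻¹]} {α β γ : K} (hα : α ≠ 0) (hP : P = C α * T (-1) + C β + C γ * T 1)
    (hPQ : P + Q + C (∑ i ∈ Finset.Iio j, c i) + C (∑ i ∈ Finset.Ioi j, ξ i) * T 1 = 0)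
    (hcop : IsCoprime P Q) (hQ0 : Q ≠ 0) (hunit : ¬ IsUnit P ∨ ¬ IsUnit Q) {lp lq : Multiset Kˣ}
    (hp : Associated (lp.map fun w : Kˣ => (T 1 - C (w : K) : K[T;T⁻¹])).prod P)
    (hq : Associated (lq.map fun w : Kˣ => (T 1 - C (w : K) : K[T;T⁻¹])).prod Q) :
    (lp.map fun w => torusClass k (scaleTail c ξ j (laurentEval k w Q) w)).sum =
      (lq.map fun w => torusClass k (scaleTail c ξ j (laurentEval k w P) w)).sum := by
  let v : Fin (n + 2) → K[T;T⁻¹] := scaleTail (fun i => C (c i)) (fun i => C (ξ i)) j Q (T 1)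
  let F : Fin (n + 3) → K[T;T⁻¹] := Fin.insertNth (α := fun _ => K[T;T⁻¹]) j.castSucc P v
  have hvj : v j = Q := scaleTail_self _ _ _ _ _
  have hF : ∑ i, F i = 0 := by
    rw [sum_insertNth, sum_scaleTail, ← map_sum, ← map_sum, ← hPQ]
    ring
  have hv : ∀ i, i ≠ j → IsUnit (v i) := fun i hi => by
    rcases lt_or_gt_of_ne hi with h | h
    · simp only [v, scaleTail_of_lt _ _ _ _ _ h]
      exact (IsUnit.mk0 _ (hc i h)).map C
    · simp only [v, scaleTail_of_gt _ _ _ _ _ h]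
      exact (isUnit_T 1).mul ((IsUnit.mk0 _ (hξ i h)).map C)
  have hFp : F j.castSucc = P := Fin.insertNth_apply_same _ _ _
  have hFq : F j.succ = Q := by
    have := Fin.insertNth_apply_succAbove (α := fun _ => K[T;T⁻¹]) j.castSucc P v j
    rwa [Fin.succAbove_castSucc_self, hvj] at this
  have hu : ∀ i, i ≠ j.castSucc → i ≠ j.succ → IsUnit (F i) := fun i hi hi' => by
    obtain ⟨s, rfl⟩ := Fin.exists_succAbove_eq hi
    simp only [F, Fin.insertNth_apply_succAbove]
    refine hv s fun hs => hi' ?_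
    rw [hs, Fin.succAbove_castSucc_self]
  -- The coefficient α of T⁻¹ is not zero.
  have hP0 : P ≠ 0 := by
    intro h
    have h1 := congrArg (fun f : K[T;T⁻¹] => f.coeff (-1)) (hP.symm.trans h)
    simp [-single_eq_C_mul_T, ← single_eq_C] at h1
    exact hα h1
  have hlast : F (Fin.last (n + 2)) = C (ξ (Fin.last (n + 1))) * T 1 := by
    have h1 := Fin.insertNth_apply_succAbove (α := fun _ => K[T;T⁻¹]) j.castSucc P v
      (Fin.last (n + 1))
    rw [Fin.succAbove_castSucc_of_le _ _ hj.le, Fin.succ_last] at h1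
    refine h1.trans ?_
    simp only [v, scaleTail_of_gt _ _ _ _ _ hj]
    ring
  have hf : IsGoodCurve (lift (k := k) F hF) := by
    refine isGoodCurve_laurentPolynomial F hF (fun i => ?_) (fun i j hij =>
      isCoprime_of_isUnit hu (by rwa [hFp, hFq]) hij) ?_ (hξ _ hj) hα hlast (hFp.trans hP)
    · by_cases h1 : i = j.castSucc
      · rwa [h1, hFp]
      by_cases h2 : i = j.succ
      · rwa [h2, hFq]
      exact (hu i h1 h2).ne_zero
    · rcases hunit with h | h
      · exact ⟨_, hFp ▸ h⟩
      · exact ⟨_, hFq ▸ h⟩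
  have h := hf.sum_torusClass_insertNth j P v hF (fun w : Kˣ => (T 1 - C (w : K) : K[T;T⁻¹]))
    (laurentEval k) surjective_laurentEval ker_laurentEval T_sub_C_ne_zero hp
    (by rwa [hvj]) hv
  have key : ∀ (S : K[T;T⁻¹]) (w : Kˣ), (fun s => laurentEval k w (scaleTail (fun i => C (c i))
      (fun i => C (ξ i)) j S (T 1) s)) = scaleTail c ξ j (laurentEval k w S) w := fun S w => by
    funext s
    have := map_scaleTail (fun i => (C (c i) : K[T;T⁻¹])) (fun i => C (ξ i)) j S (T 1)
      (laurentEval k w : K[T;T⁻¹] →+* K) s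
    simp only [AlgHom.coe_toRingHom, laurentEval_C, laurentEval_T] at this
    exact this
  simp only [v, update_scaleTail, key] at h
  exact h

/-- A point of the torus vanishes in the additive Chow group if one of its tail sums vanishes. -/
theorem torusClass_eq_zero_of_sum_Ioi {v : Fin (n + 2) → K} {j : Fin (n + 2)}
    (hj : j < Fin.last (n + 1)) (h : ∑ i ∈ Finset.Ioi j, v i = 0) : torusClass k v = 0 := by
  by_cases hv : IsTorusPoint v
  · have hvj := hv.ne_zero j
    have hsum : ∑ i ∈ Finset.Iio j, v i = - v j := by
      have := hv.sum_eq
      rw [sum_eq_sum_Iio_add_sum_Ioi j, h, add_zero] at this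
      exact eq_neg_of_add_eq_zero_left this
    -- On the curve (… | v_j/T, v_j - v_j/T | T v_(j+1), …) the coordinates have sum zero because
    -- the tail sum vanishes. The only coordinate with a zero is v_j - v_j/T, with the simple zero T
    -- = 1, where the remaining coordinates are `v`.
    have hQ : (C (v j) - C (v j) * T (-1) : K[T;T⁻¹]) = C (v j) * T (-1) * (T 1 - C ((1 : Kˣ) : K)) := by
      rw [mul_sub, mul_assoc, ← T_add, neg_add_cancel, T_zero, Units.val_one, map_one]
      ring
    have hPu : IsUnit (C (v j) * T (-1) : K[T;T⁻¹]) :=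
      ((IsUnit.mk0 _ hvj).map C).mul (isUnit_T _)
    have h1 := sum_torusClass_scaleTail (k := k) (c := v) (ξ := v) (j := j)
      (fun i _ => hv.ne_zero i)
      (fun i _ => hv.ne_zero i) hj (P := C (v j) * T (-1)) (Q := C (v j) - C (v j) * T (-1))
      (α := v j) (β := 0) (γ := 0) hvj (by simp) (by rw [h, hsum, map_neg, map_zero]; ring)
      (isCoprime_one_left.of_isCoprime_of_dvd_left hPu.dvd)
      (by rw [hQ]; exact mul_ne_zero hPu.ne_zero (T_sub_C_ne_zero 1))
      (Or.inr (by rw [hQ]; exact not_isUnit_of_laurentEval 1 (by simp [laurentEval_C, laurentEval_T])))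
      (lp := 0) (lq := {1}) (by simpa using (associated_one_iff_isUnit.2 hPu).symm)
      (by
        rw [hQ, Multiset.map_singleton, Multiset.prod_singleton, mul_comm]
        exact (associated_mul_unit_right _ _ hPu))
    simp only [Multiset.map_zero, Multiset.sum_zero, Multiset.map_singleton,
      Multiset.sum_singleton, map_mul, laurentEval_C, laurentEval_T_neg] at h1
    rw [h1]
    congr 1
    funext i
    rcases lt_trichotomy i j with h2 | rfl | h2
    · rw [scaleTail_of_lt _ _ _ _ _ h2]
    · rw [scaleTail_self]; simp
    · rw [scaleTail_of_gt _ _ _ _ _ h2]; simp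
  · exact torusClass_of_not hv

/-- The curve is (c | P, Q | Tξ) with P = -(T - w₁)(T - w₂)/T and Q = w₁w₂/T - (s + w₁ + w₂), so
that P + Q + s + T = 0. The zeros of P are w₁ and w₂; the zero of Q is w₁w₂/(s + w₁ + w₂). If s + w₁
+ w₂ = 0, then Q is a unit; the right side, where division by zero makes the tail vanish, is then
not a torus point and has class 0. -/
theorem torusClass_scaleTail_add {c ξ : Fin (n + 2) → K} {j : Fin (n + 2)}
    (hc : ∀ i, i < j → c i ≠ 0) (hξ : ∀ i, j < i → ξ i ≠ 0) (hj : j < Fin.last (n + 1))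
    (hsum : ∑ i ∈ Finset.Ioi j, ξ i = 1) {s : K} (hs : ∑ i ∈ Finset.Iio j, c i = s) {w₁ w₂ : K}
    (hw₁ : w₁ ≠ 0) (hw₂ : w₂ ≠ 0) (hs₁ : s + w₁ ≠ 0) (hs₂ : s + w₂ ≠ 0) :
    torusClass k (scaleTail c ξ j (-s - w₁) w₁) + torusClass k (scaleTail c ξ j (-s - w₂) w₂) =
      torusClass k (scaleTail c ξ j (-s - w₁ * w₂ / (s + w₁ + w₂)) (w₁ * w₂ / (s + w₁ + w₂))) := by
  let P : K[T;T⁻¹] := C (-(w₁ * w₂)) * T (-1) + C (w₁ + w₂) + C (-1) * T 1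
  let Q : K[T;T⁻¹] := C (w₁ * w₂) * T (-1) - C (s + w₁ + w₂)
  have hTT : (T 1 * T (-1) : K[T;T⁻¹]) = 1 := by rw [← T_add, add_neg_cancel, T_zero]
  have hP : P = -T (-1) * ((T 1 - C ((Units.mk0 w₁ hw₁ : Kˣ) : K)) *
      (T 1 - C ((Units.mk0 w₂ hw₂ : Kˣ) : K))) := by
    simp only [P, Units.val_mk0, map_neg, map_mul, map_add, map_one]
    linear_combination (T 1 - C w₁ - C w₂) * hTT
  have hTu : IsUnit (-T (-1) : K[T;T⁻¹]) := (isUnit_T _).neg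
  have hC : ∀ {x : K}, x ≠ 0 → IsUnit (C x : K[T;T⁻¹]) := fun hx => (IsUnit.mk0 _ hx).map C
  -- Modulo T - a, with a one of w₁, w₂, the function Q is the constant -(s + a), which is a unit by
  -- assumption.
  have hQ1 : ∀ {a b : K} (ha : a ≠ 0), s + a ≠ 0 → w₁ * w₂ = a * b → w₁ + w₂ = a + b →
      IsCoprime (T 1 - C a : K[T;T⁻¹]) Q := fun {a b} ha hsa h1 h2 => by
    have h3 : Q = C (-(s + a)) + (T 1 - C a) * (C (-b) * T (-1)) := by
      simp only [Q]
      rw [h1, add_assoc, h2]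
      simp only [map_neg, map_mul, map_add]
      linear_combination (C b) * hTT
    rw [h3]
    exact (isCoprime_one_right.of_isCoprime_of_dvd_right
      (hC (neg_ne_zero.2 hsa)).dvd).add_mul_left_right _
  have hcop : IsCoprime P Q := by
    rw [hP]
    refine (isCoprime_mul_unit_left_left hTu _ _).2 ?_
    exact (hQ1 hw₁ hs₁ rfl rfl).mul_left (hQ1 hw₂ hs₂ (mul_comm _ _) (add_comm _ _))
  have hPunit : ¬ IsUnit P := by
    rw [hP]
    exact not_isUnit_of_laurentEval (Units.mk0 w₁ hw₁) (by simp [laurentEval_C, laurentEval_T])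
  have hPQ : P + Q + C (∑ i ∈ Finset.Iio j, c i) + C (∑ i ∈ Finset.Ioi j, ξ i) * T 1 = 0 := by
    rw [hs, hsum]
    simp only [P, Q, map_neg, map_mul, map_add, map_one]
    ring
  have hQ0 : Q ≠ 0 := fun h => by
    rw [h, isCoprime_zero_right] at hcop
    exact hPunit hcop
  have hP' : Associated ((({Units.mk0 w₁ hw₁, Units.mk0 w₂ hw₂} : Multiset Kˣ)).map
      fun w : Kˣ => (T 1 - C (w : K) : K[T;T⁻¹])).prod P := by
    rw [hP, Multiset.insert_eq_cons, Multiset.map_cons, Multiset.map_singleton,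
      Multiset.prod_cons, Multiset.prod_singleton, mul_comm (-T (-1))]
    exact associated_mul_unit_right _ _ hTu
  have hPdef : P = C (-(w₁ * w₂)) * T (-1) + C (w₁ + w₂) + C (-1) * T 1 := rfl
  have hα : -(w₁ * w₂) ≠ 0 := neg_ne_zero.2 (mul_ne_zero hw₁ hw₂)
  have hQev : ∀ {a b : K} (ha : a ≠ 0), w₁ * w₂ = a * b → w₁ + w₂ = a + b →
      laurentEval k (Units.mk0 a ha) Q = -s - a := fun {a b} ha h1 h2 => by
    simp only [Q, map_sub, map_mul, laurentEval_C, laurentEval_T_neg, Units.val_mk0]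
    rw [h1, add_assoc, h2]
    field_simp
    ring
  by_cases hd : s + w₁ + w₂ = 0
  · have h := sum_torusClass_scaleTail (k := k) hc hξ hj hα hPdef hPQ hcop hQ0 (Or.inl hPunit) hP'
      (lq := 0) (by
        simp only [Q, hd, map_zero, sub_zero, Multiset.map_zero, Multiset.prod_zero]
        exact (associated_one_iff_isUnit.2
          ((hC (mul_ne_zero hw₁ hw₂)).mul (isUnit_T _))).symm)
    simp only [Multiset.insert_eq_cons, Multiset.map_cons, Multiset.map_singleton, Multiset.sum_cons,
      Multiset.sum_singleton, Multiset.map_zero, Multiset.sum_zero, Units.val_mk0,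
      hQev hw₁ rfl rfl, hQev hw₂ (mul_comm _ _) (add_comm _ _)] at h
    rw [h, hd, div_zero]
    refine (torusClass_of_eq_zero (Fin.last (n + 1)) ?_).symm
    rw [scaleTail_of_gt _ _ _ _ _ hj, zero_mul]
  · have hw₃ : w₁ * w₂ / (s + w₁ + w₂) ≠ 0 := div_ne_zero (mul_ne_zero hw₁ hw₂) hd
    have h := sum_torusClass_scaleTail (k := k) hc hξ hj hα hPdef hPQ hcop hQ0 (Or.inl hPunit) hP'
      (lq := {Units.mk0 _ hw₃}) (by
        have h1 : Q = (T 1 - C ((Units.mk0 _ hw₃ : Kˣ) : K)) *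
            (C (-(s + w₁ + w₂)) * T (-1)) := by
          have h2 : C (w₁ * w₂) = (C (w₁ * w₂ / (s + w₁ + w₂)) * C (s + w₁ + w₂) : K[T;T⁻¹]) := by
            rw [← map_mul, div_mul_cancel₀ _ hd]
          simp only [Q, Units.val_mk0]
          rw [h2, map_neg]
          linear_combination (C (s + w₁ + w₂)) * hTT
        rw [h1, Multiset.map_singleton, Multiset.prod_singleton]
        exact associated_mul_unit_right _ _ ((hC (neg_ne_zero.2 hd)).mul (isUnit_T _)))
    simp only [Multiset.insert_eq_cons, Multiset.map_cons, Multiset.map_singleton, Multiset.sum_cons,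
      Multiset.sum_singleton, Units.val_mk0,
      hQev hw₁ rfl rfl, hQev hw₂ (mul_comm _ _) (add_comm _ _)] at h
    rw [h]
    congr 2
    simp only [P, map_add, map_mul, laurentEval_C, laurentEval_T_neg, laurentEval_T, Units.val_mk0]
    field_simp
    ring

end Laurent

/-! ### Curves through a given closed point -/

section GeneratingCurve

open Polynomial

variable {k : Type u} [Field k] {n : ℕ}

/-- A point lies in a group of cycles which contains the boundaries, if it is the only point on
the last face of a curve on the line whose other zeros lie in the group. -/
theorem pointCycle_mem_of_curve {L K : Type u} [Field L] [Algebra k L] [FiniteDimensional k L]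
    [Field K] [Algebra k K] [Algebra L K] [IsScalarTower k L K] {α : K}
    (hα : Function.Surjective (aeval α : L[X] →ₐ[L] K)) {p : L[X]} (hpα : RingHom.ker (aeval α : L[X] →ₐ[L] K) = Ideal.span {p})
    (hp0 : 0 < p.natDegree)
    {F : Fin (n + 2) → L[X]} {c : L} (hc : c ≠ 0) (hF : ∑ i, F i = C c * p)
    (hcop : ∀ i j, i ≠ j → IsCoprime (F i) (F j)) (hcop' : ∀ i, IsCoprime (F i) p)
    {H : AddSubgroup (Cycle k (n + 1))} (hH : boundaries k (n + 1) (n + 1) ≤ H)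
    (h : ∀ (i : Fin (n + 2)) (π : L[X]), Irreducible π → π ∣ F i →
      ∑ s, Ideal.Quotient.mk (Ideal.span {π})
        (Fin.snoc (α := fun _ => L[X]) F (-(C c * p)) (i.castSucc.succAbove s)) = 0 →
      (∀ s, Ideal.Quotient.mk (Ideal.span {π})
        (Fin.snoc (α := fun _ => L[X]) F (-(C c * p)) (i.castSucc.succAbove s)) ≠ 0) →
      pointCycle k (fun s => Ideal.Quotient.mk (Ideal.span {π})
        (Fin.snoc (α := fun _ => L[X]) F (-(C c * p)) (i.castSucc.succAbove s))) ∈ H) :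
    pointCycle k (fun i => aeval α (F i)) ∈ H := by
  have hpne : p ≠ 0 := fun h => by simp [h] at hp0
  have hCc : IsUnit (-C c : L[X]) := ((IsUnit.mk0 c hc).map C).neg
  have hpp : Prime p := by
    rw [← Ideal.span_singleton_prime hpne, ← hpα]
    exact RingHom.ker_isPrime _
  have hne : ∀ i, F i ≠ 0 := fun i hi => by
    have := hcop' i
    rw [hi, isCoprime_zero_left] at this
    exact hpp.not_isUnit this
  let G : Fin (n + 3) → L[X] := Fin.snoc (α := fun _ => L[X]) F (-(C c * p))
  have hG : ∑ i, G i = 0 := by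
    rw [Fin.sum_univ_castSucc]
    simp only [G, Fin.snoc_castSucc, Fin.snoc_last, hF, add_neg_cancel]
  have hGl : G (Fin.last _) = -C c * p := by
    simp only [G, Fin.snoc_last, neg_mul]
  have hcast : ∀ i, IsCoprime (F i) (-C c * p) := fun i =>
    (isCoprime_mul_unit_left_right hCc _ _).2 (hcop' i)
  have hf : IsGoodCurve (lift (k := k) G hG) := by
    refine isGoodCurve_polynomial G hG (fun i => ?_) (fun i j hij => ?_) ⟨Fin.last _, ?_⟩
    · refine Fin.lastCases ?_ (fun i => ?_) i
      · rw [hGl]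
        exact mul_ne_zero hCc.ne_zero hpne
      · simp only [G, Fin.snoc_castSucc]
        exact hne i
    · induction i using Fin.lastCases with
      | last =>
        induction j using Fin.lastCases with
        | last => exact absurd rfl hij
        | cast j =>
          rw [hGl]
          simp only [G, Fin.snoc_castSucc]
          exact (hcast j).symm
      | cast i =>
        induction j using Fin.lastCases with
        | last =>
          rw [hGl]
          simp only [G, Fin.snoc_castSucc]
          exact hcast i
        | cast j =>
          simp only [G, Fin.snoc_castSucc]
          exact hcop i j fun h => hij (h ▸ rfl)
    · rw [hGl, ← C_neg, natDegree_C_mul (neg_ne_zero.2 hc)]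
      exact hp0
  classical
  have hmem := hH (hf.sum_mem_boundaries
    (Fin.snoc (α := fun _ => Multiset L[X])
      (fun i => UniqueFactorizationMonoid.normalizedFactors (F i)) {p})
    (fun j => by
      induction j using Fin.lastCases with
      | last => simpa using hpp
      | cast j =>
        simp only [Fin.snoc_castSucc]
        exact fun x hx => UniqueFactorizationMonoid.prime_of_normalized_factor x hx)
    (fun j => by
      rw [lift_t]
      induction j using Fin.lastCases with
      | last =>
        rw [hGl, Fin.snoc_last, Multiset.prod_singleton]
        exact associated_unit_mul_right _ _ hCc
      | cast j =>
        simp only [Fin.snoc_castSucc, G]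
        exact UniqueFactorizationMonoid.prod_normalizedFactors (hne j)))
  rw [Fin.sum_univ_castSucc] at hmem
  simp only [lift_t, Fin.snoc_castSucc, Fin.snoc_last, Multiset.map_singleton,
    Multiset.sum_singleton] at hmem
  -- The last face contributes a single point; all other terms of the boundary lie in `H` by
  -- assumption.
  have h1 : (-1 : ℤ) ^ (Fin.last (n + 2) : ℕ) • pointCycle k (fun i =>
      Ideal.Quotient.mk (Ideal.span {p}) (G ((Fin.last (n + 2)).succAbove i))) ∈ H := by
    refine (AddSubgroup.add_mem_cancel_left H (AddSubgroup.sum_mem _ fun j _ =>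
      AddSubgroup.zsmul_mem _ (AddSubgroup.multiset_sum_mem _ _ fun y hy => ?_) _)).1 hmem
    obtain ⟨π, hπ, rfl⟩ := Multiset.mem_map.1 hy
    have hπi := UniqueFactorizationMonoid.irreducible_of_normalized_factor π hπ
    have hπd := UniqueFactorizationMonoid.dvd_of_mem_normalizedFactors hπ
    have hGj : Ideal.Quotient.mk (Ideal.span {π}) (G j.castSucc) = 0 := by
      simp only [G, Fin.snoc_castSucc]
      exact Ideal.Quotient.eq_zero_iff_dvd _ _ |>.2 hπd
    have : Nontrivial (L[X] ⧸ Ideal.span {π}) :=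
      Ideal.Quotient.nontrivial_iff.2 fun h => hπi.not_isUnit (Ideal.span_singleton_eq_top.1 h)
    refine h j π hπi hπd ?_ fun s => ?_
    · have := congrArg (Ideal.Quotient.mk (Ideal.span {π})) hG
      rwa [map_sum, map_zero, Fin.sum_univ_succAbove _ j.castSucc, hGj, zero_add] at this
    · have := hf.isCoprime j.castSucc (j.castSucc.succAbove s) (Fin.succAbove_ne _ s).symm
      rw [lift_t, lift_t] at this
      exact map_ne_zero_of_isCoprime this _ hGj
  rw [pointCycle_quotient ((aeval α : L[X] →ₐ[L] K).restrictScalars k) hα hpα] at h1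
  simp only [Fin.succAbove_last, G, Fin.snoc_castSucc, AlgHom.restrictScalars_apply] at h1
  rcases neg_one_pow_eq_or ℤ (Fin.last (n + 2) : ℕ) with h2 | h2
  · rwa [h2, one_smul] at h1
  · rwa [h2, neg_smul, one_smul, neg_mem_iff] at h1

variable {L : Type u} [Field L]

/-- Each prime factor π of F excludes at most one c: if it divides f + a p and f + b p, it divides
(a - b) p, while F and p are coprime. -/
theorem finite_not_isCoprime_add_C_mul {F p : L[X]} (hF : F ≠ 0) (hp : IsCoprime F p) (f : L[X]) :
    {c : L | ¬ IsCoprime F (f + C c * p)}.Finite := by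
  classical
  have hsub : {c : L | ¬ IsCoprime F (f + C c * p)} ⊆
      ⋃ π ∈ (UniqueFactorizationMonoid.normalizedFactors F).toFinset,
        {c : L | π ∣ f + C c * p} := by
    intro c hc
    by_contra hcon
    refine hc (isCoprime_of_irreducible_dvd (fun h => hF h.1) fun z hz hzF hzf => hcon ?_)
    obtain ⟨π, hπ, hzπ⟩ := UniqueFactorizationMonoid.exists_mem_normalizedFactors_of_dvd hF hz hzF
    exact Set.mem_biUnion (Multiset.mem_toFinset.2 hπ) (hzπ.dvd_iff_dvd_left.1 hzf)
  refine Set.Finite.subset (Set.Finite.biUnion (Finset.finite_toSet _) fun π hπ => ?_) hsub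
  refine Set.Subsingleton.finite fun a ha b hb => ?_
  by_contra hab
  have hπ' := Multiset.mem_toFinset.1 hπ
  have h1 : π ∣ C (a - b) * p := by
    have := dvd_sub ha hb
    rwa [add_sub_add_left_eq_sub, ← sub_mul, ← C_sub] at this
  rw [((IsUnit.mk0 _ (sub_ne_zero.2 hab)).map C).dvd_mul_left] at h1
  exact (UniqueFactorizationMonoid.irreducible_of_normalized_factor π hπ').not_isUnit
    (hp.isUnit_of_dvd' (UniqueFactorizationMonoid.dvd_of_mem_normalizedFactors hπ') h1)

/-- As `p` has no root in `L`, every `s` is a root of f + c p for c = -f(s)/p(s). The finitely many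
c in `B` account for only finitely many s, since f + c p is never zero. -/
theorem exists_isRoot_of_finite [Infinite L] {p f : L[X]} (hp : Irreducible p)
    (hp1 : 1 < p.natDegree) (hf : f ≠ 0) (hfp : f.natDegree < p.natDegree) {B : Set L}
    (hB : B.Finite) : ∃ c ∉ B, ∃ s, (f + C c * p).IsRoot s := by
  have hroot : ∀ s, p.eval s ≠ 0 := fun s hs =>
    hp1.ne' (natDegree_eq_of_degree_eq_some (degree_eq_one_of_irreducible_of_root hp hs))
  by_contra! hcon
  have hcov : (Set.univ : Set L) ⊆ ⋃ c ∈ B, {s | (f + C c * p).IsRoot s} := by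
    intro s _
    have hs : (f + C (-(f.eval s) / p.eval s) * p).IsRoot s := by
      rw [IsRoot, eval_add, eval_mul, eval_C, div_mul_cancel₀ _ (hroot s), add_neg_cancel]
    by_cases hc : -(f.eval s) / p.eval s ∈ B
    · exact Set.mem_biUnion hc hs
    · exact absurd hs (hcon _ hc s)
  refine Set.infinite_univ (Set.Finite.subset (hB.biUnion fun c _ => ?_) hcov)
  refine finite_setOfPred_isRoot fun h0 => ?_
  by_cases hc : c = 0
  · rw [hc, C_0, zero_mul, add_zero] at h0
    exact hf h0
  · have h1 : f = C (-c) * p := by rw [C_neg, neg_mul]; exact eq_neg_of_add_eq_zero_left h0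
    rw [h1, natDegree_C_mul (neg_ne_zero.2 hc)] at hfp
    exact lt_irrefl _ hfp

theorem isCoprime_add_C_mul {p f : L[X]} (hp : Irreducible p) (hf : f ≠ 0)
    (hfp : f.natDegree < p.natDegree) (c : L) : IsCoprime (f + C c * p) p := by
  have : ¬ p ∣ f := fun h => absurd (natDegree_le_of_dvd h hf) hfp.not_ge
  exact IsCoprime.add_mul_right_left (((hp.coprime_iff_not_dvd).2 this).symm) _

/-- The constants are chosen one at a time; each condition of coprimality excludes only finitely
many values, and a root can still be arranged. -/
theorem exists_pairwise_isCoprime [Infinite L] {p : L[X]} (hp : Irreducible p)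
    (hp1 : 1 < p.natDegree) : ∀ {m : ℕ} (f : Fin m → L[X]), (∀ i, f i ≠ 0) →
      (∀ i, (f i).natDegree < p.natDegree) → ∃ c : Fin m → L,
      (∀ i, ∃ s, (f i + C (c i) * p).IsRoot s) ∧
      (∀ i j, i ≠ j → IsCoprime (f i + C (c i) * p) (f j + C (c j) * p)) ∧
      (m ≠ 0 → ∑ i, c i ≠ 0)
  | 0, _, _, _ => ⟨fun i => i.elim0, fun i => i.elim0, fun i => i.elim0, fun h => absurd rfl h⟩
  | m + 1, f, hf, hfp => by
    obtain ⟨c, hc, hcop, -⟩ := exists_pairwise_isCoprime hp hp1 (fun i => f i.succ)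
      (fun i => hf i.succ) (fun i => hfp i.succ)
    have hne : ∀ i : Fin m, f i.succ + C (c i) * p ≠ 0 := fun i h => by
      have := isCoprime_add_C_mul hp (hf i.succ) (hfp i.succ) (c i)
      rw [h, isCoprime_zero_left] at this
      exact hp.not_isUnit this
    -- Excluding minus the sum of the earlier constants keeps the total sum nonzero.
    have hB : (insert (-∑ i, c i) (⋃ i, {a : L | ¬ IsCoprime (f i.succ + C (c i) * p)
        (f 0 + C a * p)})).Finite :=
      (Set.finite_iUnion fun i => finite_not_isCoprime_add_C_mul (hne i)
        (isCoprime_add_C_mul hp (hf i.succ) (hfp i.succ) (c i)) _).insert _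
    obtain ⟨a, ha, hs⟩ := exists_isRoot_of_finite hp hp1 (hf 0) (hfp 0) hB
    simp only [Set.mem_insert_iff, Set.mem_iUnion, Set.mem_ofPred_eq, not_or, not_exists,
      not_not] at ha
    refine ⟨Fin.cons a c, ?_, ?_, ?_⟩
    · intro i
      induction i using Fin.cases with
      | zero => exact hs
      | succ i => exact hc i
    · intro i j hij
      induction i using Fin.cases with
      | zero =>
        induction j using Fin.cases with
        | zero => exact absurd rfl hij
        | succ j => exact (ha.2 j).symm
      | succ i =>
        induction j using Fin.cases with
        | zero => exact ha.2 i
        | succ j => exact hcop i j fun h => hij (h ▸ rfl)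
    · intro _
      rw [Fin.sum_univ_succ]
      simp only [Fin.cons_zero, Fin.cons_succ]
      exact fun h => ha.1 (eq_neg_of_add_eq_zero_left h)

/-- With the root split off, an irreducible factor divides either X - s or a cofactor of degree less
than d; the bound 1 < d deals with the first case. -/
theorem natDegree_lt_of_dvd_of_isRoot {F π : L[X]} {s : L} {d : ℕ} (hd : 1 < d)
    (hFd : F.natDegree ≤ d) (hF : F ≠ 0) (hs : F.IsRoot s) (hπ : Irreducible π) (h : π ∣ F) :
    π.natDegree < d := by
  obtain ⟨G, rfl⟩ := dvd_iff_isRoot.2 hs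
  have hG : G ≠ 0 := right_ne_zero_of_mul hF
  rw [natDegree_mul (X_sub_C_ne_zero s) hG, natDegree_X_sub_C] at hFd
  rcases hπ.prime.dvd_or_dvd h with h | h
  · have := natDegree_le_of_dvd h (X_sub_C_ne_zero s)
    rw [natDegree_X_sub_C] at this
    omega
  · have := natDegree_le_of_dvd h hG
    omega

end GeneratingCurve

/-! ### Generation by rational points -/

section Generation

open Polynomial

variable (k : Type u) [Field k] (n : ℕ)

/-- The cycles which are sums of rational points outside of all faces, up to boundaries. -/
def rationalCycles : AddSubgroup (Cycle k (n + 1)) :=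
  AddSubgroup.closure {z | ∃ v : Fin (n + 2) → k, IsTorusPoint v ∧ z = pointCycle k v} ⊔
    boundaries k (n + 1) (n + 1)

variable {k} {n}

theorem pointCycle_mem_rationalCycles_of_surjective {K : Type u} [Field K] [Algebra k K]
    (h : Function.Surjective (algebraMap k K)) {v : Fin (n + 2) → K} (hv : IsTorusPoint v) :
    pointCycle k v ∈ rationalCycles k n := by
  let e : k ≃ₐ[k] K := AlgEquiv.ofBijective (Algebra.ofId k K) ⟨(algebraMap k K).injective, h⟩
  have h1 : (fun i => e (e.symm (v i))) = v := funext fun i => e.apply_symm_apply _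
  rw [← h1, pointCycle_comp_algEquiv]
  refine AddSubgroup.mem_sup_left (AddSubgroup.subset_closure ⟨_, ⟨?_, fun i => ?_⟩, rfl⟩)
  · rw [← map_sum, hv.sum_eq, map_zero]
  · exact (map_ne_zero_iff e.symm e.symm.injective).2 (hv.ne_zero i)

theorem finrank_eq_of_surjective_aeval {L K : Type*} [Field L] [Field K] [Algebra L K] {α : K}
    (hα : Function.Surjective (aeval α : L[X] →ₐ[L] K)) :
    Module.finrank L K = (minpoly L α).natDegree := by
  have h : RingHom.ker (aeval α : L[X] →ₐ[L] K) = Ideal.span {minpoly L α} :=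
    minpoly.ker_aeval_eq_span_minpoly L α
  rw [← finrank_quotient_span_eq_natDegree, ← h]
  exact ((Ideal.quotientKerAlgEquivOfSurjective hα).toLinearEquiv.finrank_eq).symm

theorem finiteDimensional_quotient_span {L : Type*} [Field L] {π : L[X]} (hπ : 0 < π.natDegree) :
    FiniteDimensional L (L[X] ⧸ Ideal.span {π}) :=
  Module.finite_of_finrank_pos (by rwa [finrank_quotient_span_eq_natDegree])

theorem finrank_quotient_span_eq_mul {L : Type*} [Field L] [Algebra k L] {π : L[X]} :
    Module.finrank k (L[X] ⧸ Ideal.span {π}) = Module.finrank k L * π.natDegree := by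
  rw [← finrank_quotient_span_eq_natDegree (f := π)]
  exact (Module.finrank_mul_finrank k L _).symm

theorem finiteDimensional_quotient_span_of_finiteDimensional {L : Type*} [Field L] [Algebra k L]
    [FiniteDimensional k L] {π : L[X]} (hπ : 0 < π.natDegree) :
    FiniteDimensional k (L[X] ⧸ Ideal.span {π}) := by
  have := finiteDimensional_quotient_span hπ
  exact Module.Finite.trans L _

/-- A finite extension which is not trivial is generated by one element over an intermediate
field. -/
theorem exists_intermediateField_surjective_aeval {K : Type*} [Field K] [Algebra k K]
    [FiniteDimensional k K] (h : ¬ Function.Surjective (algebraMap k K)) :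
    ∃ (L : IntermediateField k K) (α : K), α ∉ L ∧
      Function.Surjective (aeval α : L[X] →ₐ[L] K) := by
  have hbot : (⊥ : IntermediateField k K) ≠ ⊤ := fun hb => h fun x => by
    have : x ∈ (⊥ : IntermediateField k K) := hb ▸ IntermediateField.mem_top
    exact IntermediateField.mem_bot.1 this
  -- L is a proper intermediate field with [K : L] minimal, so any element outside L generates K
  -- over L.
  obtain ⟨L, hL, hmin⟩ := (measure fun L : IntermediateField k K =>
    Module.finrank L K).wf.has_min {L | L ≠ ⊤} ⟨⊥, hbot⟩
  obtain ⟨α, hα⟩ : ∃ α, α ∉ L := by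
    by_contra! hcon
    exact hL (eq_top_iff.2 fun x _ => hcon x)
  refine ⟨L, α, hα, ?_⟩
  let M : IntermediateField k K := (IntermediateField.adjoin L {α}).restrictScalars k
  have hαM : α ∈ M := IntermediateField.mem_adjoin_simple_self L α
  have hLM : L ≤ M := fun x hx => (IntermediateField.adjoin L {α}).algebraMap_mem ⟨x, hx⟩
  have hM : M = ⊤ := by
    by_contra hM
    have h1 := hmin M hM
    have h2 : L = M := IntermediateField.eq_of_le_of_finrank_le' hLM (not_lt.1 h1)
    exact hα (h2 ▸ hαM)
  intro x
  have hx : x ∈ (IntermediateField.adjoin L {α}).toSubalgebra := by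
    have : x ∈ M := hM ▸ IntermediateField.mem_top
    exact this
  rw [IntermediateField.adjoin_simple_toSubalgebra_of_isAlgebraic
    (Algebra.IsAlgebraic.isAlgebraic α), Algebra.adjoin_singleton_eq_range_aeval] at hx
  exact hx

/-- With K = L[α] and p the minimal polynomial of α, the coordinates are values at α of polynomials
f_i of smaller degree. The curve f_i + c_i p, with last coordinate -(∑ c_i) p, meets the last face
only in the given point. If every f_i + c_i p has a root in L, its irreducible factors have degree
less than p, and induction on the degree over `k` applies. -/
theorem pointCycle_mem_rationalCycles [Infinite k] (d : ℕ) : ∀ {K : Type u} [Field K]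
    [Algebra k K] [FiniteDimensional k K], Module.finrank k K = d → ∀ {v : Fin (n + 2) → K},
    IsTorusPoint v → pointCycle k v ∈ rationalCycles k n := by
  induction d using Nat.strong_induction_on with
  | _ d ih =>
    intro K _ _ _ hd v hv
    by_cases hsurj : Function.Surjective (algebraMap k K)
    · exact pointCycle_mem_rationalCycles_of_surjective hsurj hv
    obtain ⟨L, α, hαL, hα⟩ := exists_intermediateField_surjective_aeval hsurj
    have hint : IsIntegral L α := Algebra.IsIntegral.isIntegral α
    let p := minpoly L α
    have hp : Irreducible p := minpoly.irreducible hint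
    have hpm : p.Monic := minpoly.monic hint
    have hp1 : 1 < p.natDegree := (minpoly.two_le_natDegree_iff hint).2 fun ⟨x, hx⟩ =>
      hαL (hx ▸ x.2)
    have hdp : Module.finrank k L * p.natDegree = d := by
      rw [← hd, ← Module.finrank_mul_finrank k L K, finrank_eq_of_surjective_aeval hα]
    choose g hg using hα
    let f : Fin (n + 2) → L[X] := fun i => g (v i) %ₘ p
    have hfv : ∀ i, aeval α (f i) = v i := fun i => by
      rw [aeval_modByMonic_eq_self_of_root (minpoly.aeval L α), hg]
    have hfdeg : ∀ i, (f i).natDegree < p.natDegree := fun i =>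
      natDegree_modByMonic_lt _ hpm hp.ne_one
    have hf0 : ∀ i, f i ≠ 0 := fun i h => hv.ne_zero i (by rw [← hfv, h, map_zero])
    -- The sum vanishes at α, so p divides it, and its degree is too small for it to be nonzero.
    have hfsum : ∑ i, f i = 0 := by
      refine eq_zero_of_dvd_of_natDegree_lt (minpoly.dvd L α ?_) ?_
      · rw [map_sum]
        simp only [hfv]
        exact hv.sum_eq
      · refine lt_of_le_of_lt (natDegree_sum_le_of_forall_le _ (n := p.natDegree - 1) _ fun i _ => ?_)
          (Nat.sub_lt (by omega) one_pos)
        have := hfdeg i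
        omega
    have : Infinite L := Infinite.of_injective _ (algebraMap k L).injective
    obtain ⟨c, hroot, hcop, hc⟩ := exists_pairwise_isCoprime hp hp1 f hf0 hfdeg
    have hmem := pointCycle_mem_of_curve (k := k) (α := α) (p := p)
      (fun x => ⟨_, hg x⟩) (minpoly.ker_aeval_eq_span_minpoly L α) (by omega)
      (F := fun i => f i + C (c i) * p) (c := ∑ i, c i) (hc (by omega))
      (by rw [Finset.sum_add_distrib, hfsum, zero_add, map_sum, Finset.sum_mul]) hcop
      (fun i => isCoprime_add_C_mul hp (hf0 i) (hfdeg i) (c i)) (H := rationalCycles k n)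
      le_sup_right (fun i π hπ hπi hsum hne => by
        obtain ⟨s, hs⟩ := hroot i
        have hF0 : f i + C (c i) * p ≠ 0 := fun h => by
          have := isCoprime_add_C_mul hp (hf0 i) (hfdeg i) (c i)
          rw [h, isCoprime_zero_left] at this
          exact hp.not_isUnit this
        have hFd : (f i + C (c i) * p).natDegree ≤ p.natDegree :=
          (natDegree_add_le _ _).trans (max_le (hfdeg i).le (natDegree_C_mul_le _ _))
        have hlt := natDegree_lt_of_dvd_of_isRoot hp1 hFd hF0 hs hπ hπi
        have := PrincipalIdealRing.isMaximal_of_irreducible hπ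
        let := Ideal.Quotient.field (Ideal.span {π})
        have := finiteDimensional_quotient_span_of_finiteDimensional (k := k) hπ.natDegree_pos
        refine ih _ ?_ (K := L[X] ⧸ Ideal.span {π}) rfl ⟨hsum, hne⟩
        rw [finrank_quotient_span_eq_mul, ← hdp]
        exact Nat.mul_lt_mul_of_pos_left hlt Module.finrank_pos)
    simpa only [map_add, map_mul, hfv, p, minpoly.aeval, mul_zero, add_zero] using hmem

/-- On `Q^1`, closed points are equivalent to sums of rational points over every field. -/
theorem pointCycle_mem_rationalCycles_zero (d : ℕ) : ∀ {K : Type u} [Field K]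
    [Algebra k K] [FiniteDimensional k K], Module.finrank k K = d → ∀ {v : Fin 2 → K},
    IsTorusPoint v → Function.Surjective (aeval (v 0) : k[X] →ₐ[k] K) →
    pointCycle k v ∈ rationalCycles k 0 := by
  induction d using Nat.strong_induction_on with
  | _ d ih =>
    intro K _ _ _ hd v hv hα
    have hint : IsIntegral k (v 0) := Algebra.IsIntegral.isIntegral _
    let p := minpoly k (v 0)
    have hp : Irreducible p := minpoly.irreducible hint
    have hdp : p.natDegree = d := by rw [← hd, finrank_eq_of_surjective_aeval hα]
    by_cases hp1 : 1 < p.natDegree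
    swap
    · refine pointCycle_mem_rationalCycles_of_surjective ?_ hv
      have h0 : 0 < Module.finrank k K := Module.finrank_pos
      exact (Algebra.finrank_eq_one_iff_bijective_algebraMap.1 (by omega)).2
    have hroot : ∀ s, p.eval s ≠ 0 := fun s hs =>
      hp1.ne' (natDegree_eq_of_degree_eq_some (degree_eq_one_of_irreducible_of_root hp hs))
    -- The constant is chosen so that 1 is a root of -X + c p. This replaces the choice in an
    -- infinite field.
    let c : k := (p.eval 1)⁻¹
    have hc : c ≠ 0 := inv_ne_zero (hroot 1)
    have hXdeg : (X : k[X]).natDegree < p.natDegree := by rwa [natDegree_X]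
    have hcopX : IsCoprime (X : k[X]) p := by
      simpa using isCoprime_add_C_mul hp X_ne_zero hXdeg 0
    have hcopX' : IsCoprime (-X + C c * p) p :=
      isCoprime_add_C_mul hp (neg_ne_zero.2 X_ne_zero) (by rwa [natDegree_neg]) c
    have hcop01 : IsCoprime (X : k[X]) (-X + C c * p) := by
      have h1 : IsCoprime (X : k[X]) (C c * p) :=
        (isCoprime_mul_unit_left_right ((IsUnit.mk0 c hc).map C) _ _).2 hcopX
      have := h1.add_mul_left_right (-1)
      rwa [mul_neg_one, add_comm] at this
    have hmem := pointCycle_mem_of_curve (k := k) (α := v 0) (p := p) (n := 0) hα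
      (minpoly.ker_aeval_eq_span_minpoly k (v 0)) (by omega)
      (F := ![X, -X + C c * p]) (c := c) hc (by simp)
      (fun i j hij => by
        fin_cases i <;> fin_cases j
        · exact absurd rfl hij
        · exact hcop01
        · exact hcop01.symm
        · exact absurd rfl hij)
      (fun i => by
        fin_cases i
        · exact hcopX
        · exact hcopX') (H := rationalCycles k 0)
      le_sup_right (fun i π hπ hπi hsum hne => by
        have := PrincipalIdealRing.isMaximal_of_irreducible hπ
        let := Ideal.Quotient.field (Ideal.span {π})
        have := finiteDimensional_quotient_span hπ.natDegree_pos
        have hrank : Module.finrank k (k[X] ⧸ Ideal.span {π}) = π.natDegree :=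
          finrank_quotient_span_eq_natDegree
        fin_cases i
        · have h1 : π.natDegree ≤ 1 := by
            rw [← natDegree_X (R := k)]
            exact natDegree_le_of_dvd hπi X_ne_zero
          refine pointCycle_mem_rationalCycles_of_surjective (K := k[X] ⧸ Ideal.span {π}) ?_
            ⟨hsum, hne⟩
          have h0 := hπ.natDegree_pos
          exact (Algebra.finrank_eq_one_iff_bijective_algebraMap.1 (by omega)).2
        · have hs : (-X + C c * p).IsRoot 1 := by
            simp [c, hroot 1]
          have hlt := natDegree_lt_of_dvd_of_isRoot hp1
            ((natDegree_add_le _ _).trans (max_le (by rw [natDegree_neg, natDegree_X]; exact hp1.le)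
              (natDegree_C_mul_le _ _)))
            (fun h => by
              have := hcopX'
              rw [h, isCoprime_zero_left] at this
              exact hp.not_isUnit this) hs hπ hπi
          refine ih _ ?_ (K := k[X] ⧸ Ideal.span {π}) rfl ⟨hsum, hne⟩ ?_
          · rw [hrank]
            omega
          -- The hypothesis that the first coordinate generates the residue field persists: on this
          -- face the first coordinate is the class of X.
          · have hX : Ideal.Quotient.mk (Ideal.span {π}) (Fin.snoc (α := fun _ => k[X])
                ![X, -X + C c * p] (-(C c * p)) ((1 : Fin 2).castSucc.succAbove 0)) =
                Ideal.Quotient.mk (Ideal.span {π}) X := rfl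
            intro y
            obtain ⟨q, rfl⟩ := Ideal.Quotient.mk_surjective y
            refine ⟨q, ?_⟩
            refine (congrArg (fun z => aeval z q) hX).trans ?_
            have := aeval_algHom_apply (Ideal.Quotient.mkₐ k (Ideal.span {π})) X q
            rwa [aeval_X_left_apply] at this)
    convert hmem using 2 with i
    funext i
    fin_cases i
    · simp
    · have := hv.sum_eq
      rw [Fin.sum_univ_two] at this
      simp [p, eq_neg_of_add_eq_zero_right this]

/-- The height `n + 1` is already the largest possible one. -/
theorem isMaximal_of_isGood {P : PrimeSpectrum (Q k (n + 1))} (hP : IsGood (n + 1) P) :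
    P.asIdeal.IsMaximal := by
  obtain ⟨M, hM, hPM⟩ := Ideal.exists_le_maximal _ P.isPrime.ne_top
  have h1 := Q.height_eq_of_isMaximal M
  by_contra hcon
  have hlt : P.asIdeal < M := lt_of_le_of_ne hPM fun h => hcon (h ▸ hM)
  have h2 := Ideal.height_add_one_le_of_lt_of_isPrime hlt
  rw [h1, hP.height_eq] at h2
  have : n + 1 + 1 ≤ n + 1 := by exact_mod_cast h2
  omega

/-- A closed point on a facet has codimension only `n` there, which good position forbids. -/
theorem notMem_of_isGood {P : PrimeSpectrum (Q k (n + 1))} (hP : IsGood (n + 1) P)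
    (i : Fin (n + 2)) : t i ∉ P.asIdeal := by
  intro hi
  have := isMaximal_of_isGood hP
  let J : Ideal (Q k (n + 1)) :=
    Ideal.span ((t : Fin (n + 2) → Q k (n + 1)) '' ({i} : Finset (Fin (n + 2))))
  have hJ : J ≤ P.asIdeal := by
    rw [Ideal.span_le]
    rintro _ ⟨s, hs, rfl⟩
    rw [Finset.coe_singleton, Set.mem_singleton_iff] at hs
    exact hs ▸ hi
  let q : Ideal (FaceRing k ({i} : Finset (Fin (n + 2)))) := P.asIdeal.map (Ideal.Quotient.mk J)
  have hcomap : q.comap (Ideal.Quotient.mk J) = P.asIdeal := by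
    rw [Ideal.comap_map_of_surjective _ Ideal.Quotient.mk_surjective, ← RingHom.ker_eq_comap_bot,
      Ideal.mk_ker, sup_eq_left]
    exact hJ
  have hqm : q.IsMaximal := by
    refine (Ideal.map_eq_top_or_isMaximal_of_surjective _ Ideal.Quotient.mk_surjective
      this).resolve_left fun h => P.isPrime.ne_top ?_
    rw [← hcomap]
    exact (congrArg (Ideal.comap (Ideal.Quotient.mk J)) h).trans Ideal.comap_top
  have h1 := hP.face {i} (Finset.singleton_nonempty i) ⟨q, hqm.isPrime⟩ hcomap.ge
  have h2 := height_faceRing_singleton i q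
  change ((n + 1 : ℕ) : ℕ∞) ≤ Ideal.height q at h1
  rw [h2] at h1
  have : n + 1 ≤ n := by exact_mod_cast h1
  omega

/-- Cycles in good position of the dimension zero are generated by closed points, which are
points of the torus with values in finite extensions. -/
theorem goodCycles_le (H : AddSubgroup (Cycle k (n + 1)))
    (h : ∀ (K : Type u) [Field K] [Algebra k K] [FiniteDimensional k K] (v : Fin (n + 2) → K),
      IsTorusPoint v → Function.Surjective (MvPolynomial.aeval v : _ →ₐ[k] K) →
        pointCycle k v ∈ H) :
    goodCycles k (n + 1) (n + 1) ≤ H := by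
  intro z hz
  change z ∈ Finsupp.supported ℤ ℤ _ at hz
  rw [Finsupp.supported_eq_span_single] at hz
  induction hz using Submodule.span_induction with
  | zero => exact zero_mem _
  | add x y _ _ hx hy => exact add_mem hx hy
  | smul a x _ hx => exact AddSubgroup.zsmul_mem _ hx a
  | mem x hx =>
    obtain ⟨P, hP, rfl⟩ := hx
    have := isMaximal_of_isGood hP
    let := Ideal.Quotient.field P.asIdeal
    have : Algebra.FiniteType k (Q k (n + 1) ⧸ P.asIdeal) :=
      Algebra.FiniteType.of_surjective (Ideal.Quotient.mkₐ k P.asIdeal)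
        (Ideal.Quotient.mkₐ_surjective k _)
    have : FiniteDimensional k (Q k (n + 1) ⧸ P.asIdeal) :=
      finite_of_finite_type_of_isJacobsonRing k _
    let v : Fin (n + 2) → Q k (n + 1) ⧸ P.asIdeal := fun i => Ideal.Quotient.mk _ (t i)
    have hv : IsTorusPoint v := ⟨by
      simp only [v]
      rw [← map_sum, sum_t, map_zero], fun i hi => notMem_of_isGood hP i
        (Ideal.Quotient.eq_zero_iff_mem.1 hi)⟩
    have hlift : lift (k := k) v hv.sum_eq = Ideal.Quotient.mkₐ k P.asIdeal :=
      algHom_ext fun i => lift_t _ _ i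
    have hsurj : Function.Surjective (lift (k := k) v hv.sum_eq) := by
      rw [hlift]
      exact Ideal.Quotient.mkₐ_surjective k _
    have h1 := h _ v hv (fun y => by
      obtain ⟨x, rfl⟩ := hsurj y
      obtain ⟨q, rfl⟩ := Q.mk_surjective k _ x
      exact ⟨q, rfl⟩)
    rw [pointCycle_of_sum hv.sum_eq, homCycle_of_surjective _ hsurj] at h1
    convert h1 using 2
    refine PrimeSpectrum.ext ?_
    rw [hlift]
    exact (Ideal.Quotient.mkₐ_ker k _).symm

theorem goodCycles_le_rationalCycles (h : Infinite k ∨ n = 0) :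
    goodCycles k (n + 1) (n + 1) ≤ rationalCycles k n := by
  refine goodCycles_le _ fun K _ _ _ v hv hsurj => ?_
  rcases h with h | rfl
  · exact pointCycle_mem_rationalCycles _ rfl hv
  -- On Q^1 the second coordinate is minus the first, so the first alone generates the residue
  -- field.
  · refine pointCycle_mem_rationalCycles_zero _ rfl hv ?_
    rw [← AlgHom.range_eq_top, ← Algebra.adjoin_singleton_eq_range_aeval]
    rw [← AlgHom.range_eq_top, ← Algebra.adjoin_range_eq_range_aeval] at hsurj
    refine top_le_iff.1 (hsurj ▸ Algebra.adjoin_le ?_)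
    rintro _ ⟨i, rfl⟩
    have h0 : v 0 ∈ Algebra.adjoin k {v 0} := Algebra.subset_adjoin rfl
    fin_cases i
    · exact h0
    · have := hv.sum_eq
      rw [Fin.sum_univ_two] at this
      exact (eq_neg_of_add_eq_zero_right this) ▸ neg_mem h0

/-- The additive Chow group is generated by the rational points. -/
theorem closure_pointClass (h : Infinite k ∨ n = 0) :
    AddSubgroup.closure
      {x : SH k (n + 1) (n + 1) | ∃ (v : Fin (n + 2) → k) (hv : ∑ i, v i = 0)
        (h0 : ∀ i, v i ≠ 0), x = pointClass v hv h0} = ⊤ := by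
  rw [eq_top_iff]
  rintro x -
  obtain ⟨⟨z, hz⟩, rfl⟩ := QuotientAddGroup.mk_surjective x
  obtain ⟨y, hy, b, hb, hyb⟩ := AddSubgroup.mem_sup.1 (goodCycles_le_rationalCycles h hz.1)
  have hy' : ∃ hyc : y ∈ closedCycles k (n + 1) (n + 1),
      (QuotientAddGroup.mk ⟨y, hyc⟩ : SH k (n + 1) (n + 1)) ∈ AddSubgroup.closure
      {x : SH k (n + 1) (n + 1) | ∃ (v : Fin (n + 2) → k) (hv : ∑ i, v i = 0)
        (h0 : ∀ i, v i ≠ 0), x = pointClass v hv h0} := by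
    clear hyb
    induction hy using AddSubgroup.closure_induction with
    | mem y hy =>
      obtain ⟨v, hv, rfl⟩ := hy
      refine ⟨pointCycle_mem hv, AddSubgroup.subset_closure ⟨v, hv.sum_eq, hv.ne_zero, ?_⟩⟩
      rw [← torusClass_self, torusClass_of_isTorusPoint hv]
    | zero => exact ⟨zero_mem _, zero_mem _⟩
    | add a b _ _ ha hb => exact ⟨add_mem ha.1 hb.1, add_mem ha.2 hb.2⟩
    | neg a _ ha => exact ⟨neg_mem ha.1, neg_mem ha.2⟩
  obtain ⟨hyc, hy'⟩ := hy'
  convert hy' using 1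
  rw [QuotientAddGroup.eq, AddSubgroup.mem_addSubgroupOf]
  have : -z + y = -b := by rw [← hyb]; abel
  change -z + y ∈ _
  rw [this]
  exact neg_mem hb

end Generation

/-! ### Coordinates by tail sums -/

section TailSums

variable {K : Type*} [Field K]

/-- The family with tail sums `R`, if `R 0 = R n = 0`. -/
def diffPoint (n : ℕ) (R : ℕ → K) : Fin n → K := fun j => R j - R (j + 1)

theorem sum_diffPoint (n : ℕ) (R : ℕ → K) : ∑ j, diffPoint n R j = R 0 - R n := by
  unfold diffPoint
  rw [Fin.sum_univ_eq_sum_range (fun j => R j - R (j + 1)), Finset.sum_range_sub']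

theorem sum_Iio_diffPoint {n : ℕ} (R : ℕ → K) (j : Fin n) :
    ∑ i ∈ Finset.Iio j, diffPoint n R i = R 0 - R j := by
  rw [← Finset.sum_range_sub', ← Nat.Iio_eq_range, ← Fin.map_valEmbedding_Iio, Finset.sum_map]
  rfl

theorem sum_Ioi_diffPoint {n : ℕ} (R : ℕ → K) (j : Fin n) :
    ∑ i ∈ Finset.Ioi j, diffPoint n R i = R (j + 1) - R n := by
  have h := sum_eq_sum_Iio_add_sum_Ioi j (diffPoint n R)
  rw [sum_diffPoint, sum_Iio_diffPoint] at h
  unfold diffPoint at h ⊢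
  linear_combination -h

theorem exists_diffPoint {n : ℕ} {v : Fin n → K} (hv : ∑ i, v i = 0) :
    ∃ R : ℕ → K, R 0 = 0 ∧ R n = 0 ∧ v = diffPoint n R := by
  let v' : ℕ → K := fun i => if h : i < n then v ⟨i, h⟩ else 0
  refine ⟨fun m => -∑ i ∈ Finset.range m, v' i, by simp, ?_, ?_⟩
  · change -∑ i ∈ Finset.range n, v' i = 0
    rw [← Fin.sum_univ_eq_sum_range, neg_eq_zero, ← hv]
    exact Finset.sum_congr rfl fun i _ => by simp [v']
  · funext i
    simp [diffPoint, Finset.sum_range_succ, v']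

/-- The tail sums of the point with first coordinate `-x⁻¹` such that the quotient of the tail sums
at the positions `i` and `i + 1` is `1 - β i`. -/
def tailSum {n : ℕ} (x : K) (β : Fin n → K) (m : ℕ) : K :=
  if m = 0 ∨ n + 2 ≤ m then 0 else x⁻¹ * ∏ i ∈ Finset.univ.filter (fun i : Fin n => (i : ℕ) + 1 < m), (1 - β i)⁻¹

variable {n : ℕ}

theorem tailSum_zero (x : K) (β : Fin n → K) : tailSum x β 0 = 0 := by simp [tailSum]

theorem tailSum_end (x : K) (β : Fin n → K) : tailSum x β (n + 2) = 0 := by simp [tailSum]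

theorem tailSum_one (x : K) (β : Fin n → K) : tailSum x β 1 = x⁻¹ := by simp [tailSum]

theorem tailSum_succ (x : K) (β : Fin n → K) (i : Fin n) :
    tailSum x β (i + 2) = tailSum x β (i + 1) * (1 - β i)⁻¹ := by
  have hi := i.2
  rw [tailSum, tailSum, if_neg (by omega), if_neg (by omega), mul_assoc]
  congr 1
  have h : (Finset.univ.filter fun l : Fin n => (l : ℕ) + 1 < i + 2) =
      insert i (Finset.univ.filter fun l : Fin n => (l : ℕ) + 1 < i + 1) := by
    ext l
    simp only [Finset.mem_filter, Finset.mem_univ, true_and, Finset.mem_insert, Fin.ext_iff]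
    omega
  rw [h, Finset.prod_insert (by simp), mul_comm]

theorem tailSum_mul (x y : K) (β : Fin n → K) (m : ℕ) :
    tailSum (x * y) β m = x⁻¹ * tailSum y β m := by
  unfold tailSum
  split_ifs
  · rw [mul_zero]
  · rw [mul_inv, mul_assoc]

/-- Changing one β scales exactly the tail sums beyond its position. This is the form in which the
relation for scaled tails can be applied, with the entry 0 as reference. -/
theorem tailSum_update (x : K) (β : Fin n → K) (i : Fin n) (a : K) (m : ℕ) :
    tailSum x (Function.update β i a) m = if m ≤ i + 1 then
      tailSum x (Function.update β i 0) m else (1 - a)⁻¹ * tailSum x (Function.update β i 0) m := by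
  by_cases hm : m = 0 ∨ n + 2 ≤ m
  · simp [tailSum, hm]
  simp only [tailSum, if_neg hm]
  split_ifs with h
  · congr 1
    refine Finset.prod_congr rfl fun l hl => ?_
    have : l ≠ i := fun hl' => by
      have := (Finset.mem_filter.1 hl).2
      rw [hl'] at this
      omega
    rw [Function.update_of_ne this, Function.update_of_ne this]
  · have hi : i ∈ Finset.univ.filter fun l : Fin n => (l : ℕ) + 1 < m :=
      Finset.mem_filter.2 ⟨Finset.mem_univ _, by omega⟩
    rw [← Finset.mul_prod_erase _ _ hi, ← Finset.mul_prod_erase _ _ hi, Function.update_self,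
      Function.update_self, sub_zero, inv_one, one_mul]
    rw [mul_left_comm]
    congr 2
    refine Finset.prod_congr rfl fun l hl => ?_
    have : l ≠ i := Finset.ne_of_mem_erase hl
    rw [Function.update_of_ne this, Function.update_of_ne this]

theorem eq_tailSum {R : ℕ → K} (h0 : R 0 = 0) (hn : R (n + 2) = 0)
    (hR : ∀ m, 1 ≤ m → m ≤ n + 1 → R m ≠ 0) {m : ℕ} (hm : m ≤ n + 2) :
    R m = tailSum (R 1)⁻¹ (fun i : Fin n => 1 - R (i + 1) / R (i + 2)) m := by
  by_cases h : m = n + 2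
  · rw [h, hn, tailSum_end]
  rcases m with - | m
  · rw [h0, tailSum_zero]
  induction m with
  | zero => rw [tailSum_one, inv_inv]
  | succ m ih =>
    have hmn : m < n := by omega
    have := tailSum_succ (R 1)⁻¹ (fun i : Fin n => 1 - R (i + 1) / R (i + 2)) ⟨m, hmn⟩
    simp only at this
    rw [this, ← ih (by omega) (by omega)]
    have h1 := hR (m + 1) (by omega) (by omega)
    have h2 := hR (m + 2) (by omega) (by omega)
    rw [sub_sub_cancel, inv_div, mul_div_cancel₀ _ h1]

end TailSums

/-! ### Relations between classes of forms -/

section FormClass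

variable {k : Type u} [Field k] {n : ℕ} {K : Type u} [Field K] [Algebra k K]
  [FiniteDimensional k K]

theorem torusClass_diffPoint_eq_zero {R : ℕ → K} (hn : R (n + 2) = 0) {m : ℕ}
    (hm : 1 ≤ m) (hmn : m ≤ n + 1) (h : R m = 0) : torusClass k (diffPoint (n + 2) R) = 0 := by
  obtain ⟨m, rfl⟩ : ∃ j, m = j + 1 := ⟨m - 1, by omega⟩
  refine torusClass_eq_zero_of_sum_Ioi (j := ⟨m, by omega⟩) (by
    rw [Fin.lt_def]
    simp only [Fin.val_last]
    omega) ?_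
  rw [sum_Ioi_diffPoint, hn, sub_zero]
  exact h

/-- An exchange of two neighbouring coordinates affects only the tail sum between them. -/
theorem torusClass_diffPoint_swap {R : ℕ → K} {j : ℕ} (hj : j ≤ n) :
    torusClass k (diffPoint (n + 2) R) + torusClass k (diffPoint (n + 2)
      (Function.update R (j + 1) (R j + R (j + 2) - R (j + 1)))) = 0 := by
  convert torusClass_add_swap (k := k) (⟨j, by omega⟩ : Fin (n + 1)) (diffPoint (n + 2) R) using 3
  funext i
  have hcs : ((⟨j, by omega⟩ : Fin (n + 1)).castSucc : ℕ) = j := rfl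
  have hs : ((⟨j, by omega⟩ : Fin (n + 1)).succ : ℕ) = j + 1 := rfl
  simp only [Function.comp_apply, Equiv.swap_apply_def, diffPoint, Fin.ext_iff]
  by_cases h1 : (i : ℕ) = j
  · rw [if_pos (h1.trans hcs.symm), hs, h1, Function.update_of_ne (by omega), Function.update_self]
    ring
  by_cases h2 : (i : ℕ) = j + 1
  · rw [if_neg (by rw [hcs]; exact h1), if_pos (h2.trans hs.symm), hcs, h2, Function.update_self,
      Function.update_of_ne (by omega)]
    ring
  · rw [if_neg (by rw [hcs]; exact h1), if_neg (by rw [hs]; exact h2), Function.update_of_ne h2,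
      Function.update_of_ne (by omega)]

/-- The relation between the points obtained by scaling the tail sums after a given position. -/
theorem torusClass_diffPoint_add {R : ℕ → K} (h0 : R 0 = 0) (hn : R (n + 2) = 0) {j : ℕ}
    (hj : j ≤ n) (hR : R (j + 1) ≠ 0) {s₁ s₂ : K} (hs₁ : s₁ ≠ 0) (hs₂ : s₂ ≠ 0)
    (hRs₁ : s₁ * R (j + 1) ≠ R j) (hRs₂ : s₂ * R (j + 1) ≠ R j) :
    torusClass k (diffPoint (n + 2) fun m => if m ≤ j then R m else s₁ * R m) +
    torusClass k (diffPoint (n + 2) fun m => if m ≤ j then R m else s₂ * R m) =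
    torusClass k (diffPoint (n + 2) fun m => if m ≤ j then R m else
      s₁ * s₂ * R (j + 1) / (s₁ * R (j + 1) + s₂ * R (j + 1) - R j) * R m) := by
  let J : Fin (n + 2) := ⟨j, by omega⟩
  let v := diffPoint (n + 2) R
  -- The tail is divided by R (j + 1) to have sum 1, as `torusClass_scaleTail_add` requires; the
  -- scale `s` then becomes the parameter s R (j + 1).
  have hpt : ∀ s : K, (diffPoint (n + 2) fun m => if m ≤ j then R m else s * R m) =
      scaleTail v (fun i => v i / R (j + 1)) J (R j - s * R (j + 1)) (s * R (j + 1)) := fun s => by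
    funext i
    rcases lt_trichotomy i J with h | rfl | h
    · rw [scaleTail_of_lt _ _ _ _ _ h]
      have h' : (i : ℕ) < j := h
      simp only [diffPoint, v]
      rw [if_pos h'.le, if_pos (by omega)]
    · rw [scaleTail_self]
      simp [diffPoint, J]
    · rw [scaleTail_of_gt _ _ _ _ _ h]
      have h' : j < (i : ℕ) := h
      simp only [diffPoint, v]
      rw [if_neg (by omega), if_neg (by omega)]
      field_simp
  -- If a coordinate away from J vanishes, none of the three points is on the torus and all classes
  -- are zero.
  by_cases hc : ∀ i, i < J → v i ≠ 0
  swap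
  · push Not at hc
    obtain ⟨i, hi, hvi⟩ := hc
    have hz : ∀ s : K, torusClass k (diffPoint (n + 2) fun m => if m ≤ j then R m else s * R m) =
        0 := fun s => by
      rw [hpt]
      exact torusClass_of_eq_zero i (by rw [scaleTail_of_lt _ _ _ _ _ hi, hvi])
    rw [hz, hz, hz, add_zero]
  by_cases hξ : ∀ i, J < i → v i ≠ 0
  swap
  · push Not at hξ
    obtain ⟨i, hi, hvi⟩ := hξ
    have hz : ∀ s : K, torusClass k (diffPoint (n + 2) fun m => if m ≤ j then R m else s * R m) =
        0 := fun s => by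
      rw [hpt]
      exact torusClass_of_eq_zero i (by
        rw [scaleTail_of_gt _ _ _ _ _ hi, hvi, zero_div, mul_zero])
    rw [hz, hz, hz, add_zero]
  have hsum : ∑ i ∈ Finset.Ioi J, v i / R (j + 1) = 1 := by
    rw [← Finset.sum_div, sum_Ioi_diffPoint, hn, sub_zero]
    exact div_self hR
  have hs : ∑ i ∈ Finset.Iio J, v i = -R j := by
    rw [sum_Iio_diffPoint, h0, zero_sub]
  have h := torusClass_scaleTail_add (k := k) hc (fun i hi => div_ne_zero (hξ i hi) hR)
    (by rw [Fin.lt_def, Fin.val_last]; change j < n + 1; omega) hsum hs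
    (mul_ne_zero hs₁ hR) (mul_ne_zero hs₂ hR)
    (fun h => hRs₁ (by linear_combination h)) (fun h => hRs₂ (by linear_combination h))
  rw [hpt, hpt, hpt]
  have e : s₁ * s₂ * R (j + 1) / (s₁ * R (j + 1) + s₂ * R (j + 1) - R j) * R (j + 1) =
      s₁ * R (j + 1) * (s₂ * R (j + 1)) / (-R j + s₁ * R (j + 1) + s₂ * R (j + 1)) := by
    rw [div_mul_eq_mul_div]
    congr 1 <;> ring
  simp only [neg_neg] at h
  rw [e]
  exact h

variable (k) in
/-- The class corresponding to the form `x d log β_1 ∧ … ∧ d log β_n`. -/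
def formClass (x : K) (β : Fin n → K) : SH k (n + 1) (n + 1) :=
  torusClass k (diffPoint (n + 2) (tailSum x β))

theorem torusClass_diffPoint {R : ℕ → K} (h0 : R 0 = 0) (hn : R (n + 2) = 0)
    (hR : ∀ m, 1 ≤ m → m ≤ n + 1 → R m ≠ 0) : torusClass k (diffPoint (n + 2) R) =
      formClass k (R 1)⁻¹ (fun i : Fin n => 1 - R (i + 1) / R (i + 2)) := by
  unfold formClass
  congr 1
  funext i
  unfold diffPoint
  rw [← eq_tailSum h0 hn hR (by omega), ← eq_tailSum h0 hn hR (by omega)]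

theorem formClass_zero (β : Fin n → K) : formClass k 0 β = 0 :=
  torusClass_diffPoint_eq_zero (tailSum_end _ _) (le_refl 1) (by omega)
    (by rw [tailSum_one, inv_zero])

/-- The convention 0⁻¹ = 0 makes the next tail sum vanish, in accordance with d log 1 = 0. -/
theorem formClass_of_eq_one (x : K) (β : Fin n → K) {i : Fin n} (hi : β i = 1) :
    formClass k x β = 0 :=
  torusClass_diffPoint_eq_zero (m := i + 2) (tailSum_end _ _) (by omega)
    (by omega) (by rw [tailSum_succ, hi, sub_self, inv_zero, mul_zero])

theorem tailSum_ne_zero {x : K} {β : Fin n → K} (hx : x ≠ 0) (hβ : ∀ i, β i ≠ 1) {m : ℕ}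
    (hm : 1 ≤ m) (hmn : m ≤ n + 1) : tailSum x β m ≠ 0 := by
  rw [tailSum, if_neg (by omega)]
  exact mul_ne_zero (inv_ne_zero hx) (Finset.prod_ne_zero_iff.2 fun i _ =>
    inv_ne_zero (sub_ne_zero.2 (hβ i).symm))

/-- This is the relation for scaled tails at the first position, with scales x⁻¹ and y⁻¹; these
combine to x⁻¹y⁻¹/(x⁻¹ + y⁻¹) = (x + y)⁻¹, also for x + y = 0 by the conventions on division. -/
theorem formClass_add (x y : K) (β : Fin n → K) :
    formClass k (x + y) β = formClass k x β + formClass k y β := by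
  by_cases hx : x = 0
  · rw [hx, zero_add, formClass_zero, zero_add]
  by_cases hy : y = 0
  · rw [hy, add_zero, formClass_zero, add_zero]
  have hR : ∀ z : K, (diffPoint (n + 2) fun m => if m ≤ 0 then tailSum 1 β m else
      z⁻¹ * tailSum 1 β m) = diffPoint (n + 2) (tailSum z β) := fun z => by
    congr 1
    funext m
    rw [← tailSum_mul, mul_one]
    split_ifs with h
    · rw [Nat.le_zero.1 h, tailSum_zero, tailSum_zero]
    · rfl
  have h1 : tailSum 1 β (0 + 1) = 1 := by rw [zero_add, tailSum_one, inv_one]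
  have h := torusClass_diffPoint_add (k := k) (tailSum_zero 1 β) (tailSum_end 1 β) (Nat.zero_le n)
    (by rw [h1]; exact one_ne_zero) (inv_ne_zero hx) (inv_ne_zero hy)
    (by rw [h1, tailSum_zero, mul_one]; exact inv_ne_zero hx)
    (by rw [h1, tailSum_zero, mul_one]; exact inv_ne_zero hy)
  rw [h1, tailSum_zero] at h
  have e : x⁻¹ * y⁻¹ * 1 / (x⁻¹ * 1 + y⁻¹ * 1 - 0) = (x + y)⁻¹ := by
    rw [mul_one, mul_one, mul_one, sub_zero, inv_add_inv hx hy]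
    by_cases hxy : x + y = 0
    · rw [hxy, zero_div, div_zero, inv_zero]
    · field_simp
  rw [e, hR, hR, hR] at h
  exact h.symm

/-- Here the scales are s₁ = (1 - a)⁻¹ and s₂ = (1 - b)⁻¹, relative to a family with two equal
consecutive tail sums, and s₁s₂/(s₁ + s₂ - 1) = (1 - ab)⁻¹. -/
theorem formClass_update_mul (x : K) (β : Fin n → K) (i : Fin n) {a b : K} (ha : a ≠ 0)
    (hb : b ≠ 0) : formClass k x (Function.update β i (a * b)) =
      formClass k x (Function.update β i a) + formClass k x (Function.update β i b) := by
  by_cases ha1 : a = 1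
  · rw [ha1, one_mul, formClass_of_eq_one x (Function.update β i 1) (Function.update_self i 1 β),
      zero_add]
  by_cases hb1 : b = 1
  · rw [hb1, mul_one, formClass_of_eq_one x (Function.update β i 1) (Function.update_self i 1 β),
      add_zero]
  let R := tailSum x (Function.update β i 0)
  have hR : ∀ c : K, formClass k x (Function.update β i c) =
      torusClass k (diffPoint (n + 2) fun m => if m ≤ i + 1 then R m else (1 - c)⁻¹ * R m) :=
    fun c => by
    unfold formClass
    congr 2
    funext m
    exact tailSum_update x β i c m
  have hRi : R (i + 1 + 1) = R (i + 1) := by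
    have := tailSum_succ x (Function.update β i 0) i
    rwa [Function.update_self, sub_zero, inv_one, mul_one] at this
  by_cases hRi0 : R (i + 1) = 0
  · have hz : ∀ c : K, formClass k x (Function.update β i c) = 0 := fun c => by
      rw [hR]
      refine torusClass_diffPoint_eq_zero (m := i + 1) ?_ (by omega) (by omega) ?_
      · rw [if_neg (by omega)]
        simp [R, tailSum_end]
      · rw [if_pos le_rfl, hRi0]
    rw [hz, hz, hz, add_zero]
  have ha' : 1 - a ≠ 0 := sub_ne_zero.2 (Ne.symm ha1)
  have hb' : 1 - b ≠ 0 := sub_ne_zero.2 (Ne.symm hb1)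
  -- The scale (1 - c)⁻¹ is 1 only for c = 0; this is where `a` and `b` have to be nonzero.
  have hne : ∀ {c : K}, c ≠ 0 → 1 - c ≠ 0 → (1 - c)⁻¹ * R (i + 1 + 1) ≠ R (i + 1) :=
    fun {c} hc hc' h => by
    rw [hRi] at h
    have h1 := mul_right_cancel₀ hRi0 (h.trans (one_mul _).symm)
    rw [inv_eq_one, sub_eq_self] at h1
    exact hc h1
  have h := torusClass_diffPoint_add (k := k) (R := R) (tailSum_zero _ _) (tailSum_end _ _)
    (j := i + 1) (by omega) (by rwa [hRi]) (inv_ne_zero ha') (inv_ne_zero hb') (hne ha ha')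
    (hne hb hb')
  have e : (1 - a)⁻¹ * (1 - b)⁻¹ * R (i + 1 + 1) / ((1 - a)⁻¹ * R (i + 1 + 1) +
      (1 - b)⁻¹ * R (i + 1 + 1) - R (i + 1)) = (1 - a * b)⁻¹ := by
    rw [hRi]
    have h1 : (1 - a)⁻¹ * R (i + 1) + (1 - b)⁻¹ * R (i + 1) - R (i + 1) =
        (1 - a)⁻¹ * (1 - b)⁻¹ * R (i + 1) * (1 - a * b) := by
      field_simp
      ring
    rw [h1, div_mul_cancel_left₀]
    exact mul_ne_zero (mul_ne_zero (inv_ne_zero ha') (inv_ne_zero hb')) hRi0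
  rw [e] at h
  rw [hR, hR, hR, h]

/-- With a = β 0, exchanging the first two coordinates replaces the tail sum R 1 = 1/(a x) by R 2 -
R 1 = 1/((1 - a) x) and leaves the others alone. The outcome is the relation a d log a + (1 - a) d
log (1 - a) = 0. -/
theorem formClass_mul_self_add (x : K) (β : Fin (n + 1) → K) (h0 : β 0 ≠ 0) :
    formClass k (β 0 * x) β + formClass k ((1 - β 0) * x) (Function.update β 0 (1 - β 0)) = 0 := by
  by_cases hx : x = 0
  · rw [hx, mul_zero, mul_zero, formClass_zero, formClass_zero, add_zero]
  by_cases hβ : ∀ i, β i ≠ 1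
  swap
  · push Not at hβ
    obtain ⟨i, hi⟩ := hβ
    rw [formClass_of_eq_one _ _ hi, zero_add]
    by_cases hi0 : i = 0
    · rw [← hi0, hi, sub_self, zero_mul, formClass_zero]
    · exact formClass_of_eq_one _ _ (i := i) (by rw [Function.update_of_ne hi0, hi])
  have h1 : 1 - β 0 ≠ 0 := sub_ne_zero.2 (hβ 0).symm
  let R := tailSum (β 0 * x) β
  have hR : ∀ m, 1 ≤ m → m ≤ n + 2 → R m ≠ 0 := fun m hm hmn =>
    tailSum_ne_zero (mul_ne_zero h0 hx) hβ hm hmn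
  have hR1 : R 1 = (β 0 * x)⁻¹ := tailSum_one _ _
  have hRs : ∀ i : Fin (n + 1), R (i + 2) = R (i + 1) * (1 - β i)⁻¹ := tailSum_succ _ _
  have hR2 : R 2 = R 1 * (1 - β 0)⁻¹ := hRs 0
  have h := torusClass_diffPoint_swap (k := k) (n := n + 1) (R := R) (j := 0) (Nat.zero_le _)
  have hR0 : R 0 = 0 := tailSum_zero _ _
  rw [hR0, zero_add, zero_add] at h
  have hnew : R 2 - R 1 = ((1 - β 0) * x)⁻¹ := by
    rw [hR2, hR1]
    field_simp
    ring
  have hnew0 : R 2 - R 1 ≠ 0 := by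
    rw [hnew]
    exact inv_ne_zero (mul_ne_zero h1 hx)
  rw [torusClass_diffPoint (R := Function.update R 1 _) (by rw [Function.update_of_ne (by omega), hR0])
    (by rw [Function.update_of_ne (by omega)]; exact tailSum_end _ _)
    (fun m hm hmn => by
      by_cases h2 : m = 1
      · rwa [h2, Function.update_self]
      · rw [Function.update_of_ne h2]
        exact hR m hm hmn)] at h
  rw [Function.update_self, hnew, inv_inv] at h
  refine Eq.trans (congrArg₂ (· + ·) rfl (congrArg (formClass k _) ?_)) h
  funext i
  by_cases hi : i = 0
  · rw [hi, Function.update_self, Fin.val_zero, zero_add, Function.update_self,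
      Function.update_of_ne (by omega), hR2, hR1]
    field_simp
  · have hi' : (i : ℕ) ≠ 0 := fun h => hi (Fin.ext h)
    rw [Function.update_of_ne hi, Function.update_of_ne (by omega), Function.update_of_ne (by omega),
      hRs]
    have := hR (i + 1) (by omega) (by omega)
    have := hβ i
    have : 1 - β i ≠ 0 := sub_ne_zero.2 this.symm
    field_simp
    ring

/-- In units of R (i + 3) the two preceding tail sums R (i + 1) and R (i + 2) are 1 - b - x and 1 -
b. The exchange of the coordinates between them turns 1 - b into 1 - x and so interchanges x and b.
-/
theorem formClass_adjacent (y : K) (β : Fin (n + 1) → K) (i : Fin n) {x b : K} (hx : x ≠ 1)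
    (hb1 : b ≠ 1) :
    formClass k y (Function.update (Function.update β i.castSucc (x / (1 - b))) i.succ b) +
    formClass k y (Function.update (Function.update β i.castSucc (b / (1 - x))) i.succ x) = 0 := by
  have hx1 : 1 - x ≠ 0 := sub_ne_zero.2 hx.symm
  have hb1' : 1 - b ≠ 0 := sub_ne_zero.2 hb1.symm
  let β' := Function.update (Function.update β i.castSucc (x / (1 - b))) i.succ b
  have hne : i.castSucc ≠ i.succ := Fin.castSucc_lt_succ.ne
  by_cases hy : y = 0
  · rw [hy, formClass_zero, formClass_zero, add_zero]
  -- For x + b = 1 both terms contain d log 1 and vanish.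
  by_cases hxb : x / (1 - b) = 1
  · rw [div_eq_one_iff_eq hb1'] at hxb
    have hxb' : b / (1 - x) = 1 := by
      rw [div_eq_one_iff_eq hx1]
      linear_combination hxb
    rw [formClass_of_eq_one _ _ (i := i.castSucc) (by
      rw [Function.update_of_ne hne, Function.update_self, hxb, div_self hb1']),
      formClass_of_eq_one _ _ (i := i.castSucc) (by
      rw [Function.update_of_ne hne, Function.update_self, hxb']), add_zero]
  by_cases hβ : ∀ l, l ≠ i.castSucc → l ≠ i.succ → β l ≠ 1
  swap
  · push Not at hβ
    obtain ⟨l, hl, hl', h⟩ := hβ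
    rw [formClass_of_eq_one _ _ (i := l) (by
      rw [Function.update_of_ne hl', Function.update_of_ne hl, h]),
      formClass_of_eq_one _ _ (i := l) (by
      rw [Function.update_of_ne hl', Function.update_of_ne hl, h]), add_zero]
  have hβ' : ∀ l, β' l ≠ 1 := fun l => by
    simp only [β']
    by_cases h1 : l = i.succ
    · rwa [h1, Function.update_self]
    by_cases h2 : l = i.castSucc
    · rwa [h2, Function.update_of_ne hne, Function.update_self]
    · rw [Function.update_of_ne h1, Function.update_of_ne h2]
      exact hβ l h2 h1
  let R := tailSum y β'
  have hR : ∀ m, 1 ≤ m → m ≤ n + 2 → R m ≠ 0 := fun m hm hmn => tailSum_ne_zero hy hβ' hm hmn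
  have hRs : ∀ l : Fin (n + 1), R (l + 2) = R (l + 1) * (1 - β' l)⁻¹ := tailSum_succ _ _
  have hRi : R (i + 2) = R (i + 1) * (1 - x / (1 - b))⁻¹ := by
    have := hRs i.castSucc
    simp only [β', Function.update_of_ne hne, Function.update_self] at this
    exact this
  have hRi' : R (i + 3) = R (i + 2) * (1 - b)⁻¹ := by
    have := hRs i.succ
    simp only [β', Function.update_self] at this
    exact this
  have hxb' : 1 - x / (1 - b) ≠ 0 := sub_ne_zero.2 (Ne.symm hxb)
  have hbx : 1 - b - x ≠ 0 := fun h => hxb (by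
    rw [div_eq_one_iff_eq hb1']
    linear_combination -h)
  have hRi1 := hR (i + 1) (by omega) (by omega)
  have hRi2 := hR (i + 2) (by omega) (by omega)
  have hRi3 := hR (i + 3) (by omega) (by omega)
  have hi2 : R (i + 2) = (1 - b) * R (i + 3) := by
    rw [hRi']
    field_simp
  have hi1 : R (i + 1) = (1 - b - x) * R (i + 3) := by
    have : R (i + 1) = R (i + 2) * (1 - x / (1 - b)) := by
      rw [hRi]
      field_simp
    rw [this, hi2]
    field_simp
  have hnew : R (i + 1) + R (i + 3) - R (i + 2) = (1 - x) * R (i + 3) := by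
    rw [hi1, hi2]
    ring
  have h := torusClass_diffPoint_swap (k := k) (n := n + 1) (R := R) (j := i + 1) (by omega)
  have hR1 : R 1 = y⁻¹ := tailSum_one _ _
  change torusClass k (diffPoint (n + 3) R) + torusClass k (diffPoint (n + 3)
    (Function.update R (i + 2) (R (i + 1) + R (i + 3) - R (i + 2)))) = 0 at h
  rw [hnew, torusClass_diffPoint (R := Function.update R _ _)
    (by rw [Function.update_of_ne (by omega)]; exact tailSum_zero _ _)
    (by rw [Function.update_of_ne (by omega)]; exact tailSum_end _ _)
    (fun m hm hmn => by
      by_cases h2 : m = i + 2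
      · rw [h2, Function.update_self]
        exact mul_ne_zero hx1 hRi3
      · rw [Function.update_of_ne h2]
        exact hR m hm hmn), Function.update_of_ne (by omega : 1 ≠ (i : ℕ) + 2), hR1, inv_inv] at h
  refine Eq.trans (congrArg₂ (· + ·) rfl (congrArg (formClass k _) ?_)) h
  funext l
  by_cases h1 : l = i.succ
  · subst h1
    rw [Function.update_self, Fin.val_succ, Function.update_self, Function.update_of_ne (by omega)]
    rw [show (i : ℕ) + 1 + 2 = i + 3 from rfl]
    field_simp
    ring
  by_cases h2 : l = i.castSucc
  · subst h2
    rw [Function.update_of_ne h1, Function.update_self, Fin.val_castSucc, Function.update_self,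
      Function.update_of_ne (by omega), hi1]
    field_simp
    ring
  · rw [Function.update_of_ne h1, Function.update_of_ne h2]
    have h1' : (l : ℕ) ≠ i + 1 := fun h => h1 (Fin.ext h)
    have h2' : (l : ℕ) ≠ i := fun h => h2 (Fin.ext h)
    rw [Function.update_of_ne (by omega), Function.update_of_ne (by omega), hRs]
    simp only [β', Function.update_of_ne h1, Function.update_of_ne h2]
    have := hR (l + 1) (by omega) (by omega)
    have h3 : 1 - β l ≠ 0 := sub_ne_zero.2 (hβ l h2 h1).symm
    field_simp
    ring

end FormClass

section StarFormClass

variable {k : Type u} [Field k] {n : ℕ}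

theorem star_formClass (a : kˣ) (x : k) (β : Fin n → k) :
    star a (formClass k x β) = formClass k ((a : k) * x) β := by
  unfold formClass
  rw [star_torusClass_mk]
  congr 1
  funext i
  simp only [diffPoint, tailSum_mul, smul_eq_mul, mul_sub]

end StarFormClass

/-! ### Biadditive maps with the relation for adjacent entries -/

section TwoSlots

variable {k : Type*} [Field k] {M : Type*} [AddCommGroup M] {f : kˣ → kˣ → M}

/-- By biadditivity the relation reads f(x,y) + f(y,x) = s(x) + s(y) with s(x) = f(1 - x, x). The
left side is biadditive; comparing its values at (x,b), (x,b') and (x,bb') shows that s is a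
constant κ, and putting x = b then gives 2κ = 0. Finally -x = (1 - x)/(1 - x⁻¹) gives f(-x,x) = 2κ =
0. -/
theorem add_swap_eq_zero_of_adjacent [Infinite k]
    (hl : ∀ x y z, f (x * y) z = f x z + f y z) (hr : ∀ x y z, f x (y * z) = f x y + f x z)
    (hadj : ∀ x y u v : kˣ, x ≠ 1 → y ≠ 1 → (u : k) * (1 - y) = x → (v : k) * (1 - x) = y →
      f u y + f v x = 0) :
    (∀ x y, f x y + f y x = 0) ∧ ∀ x, f (-x) x = 0 := by
  have hone : ∀ x, f 1 x = 0 := fun x => by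
    have := hl 1 1 x
    rwa [mul_one, left_eq_add] at this
  have hone' : ∀ x, f x 1 = 0 := fun x => by
    have := hr x 1 1
    rwa [mul_one, left_eq_add] at this
  have hcompl : ∀ x : kˣ, x ≠ 1 → ∃ y : kˣ, (y : k) = 1 - x := fun x hx =>
    ⟨Units.mk0 (1 - x) (sub_ne_zero.2 fun h => hx (Units.ext h.symm)), rfl⟩
  choose c hc using hcompl
  have hdiv : ∀ {x y z : kˣ}, (x : k) * y = z → ∀ w, f x w = f z w - f y w := fun {x y z} h w => by
    have : x * y = z := Units.ext h
    rw [← this, hl, add_sub_cancel_right]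
  have key : ∀ x y : kˣ, ∀ (hx : x ≠ 1) (hy : y ≠ 1),
      f x y + f y x = f (c y hy) y + f (c x hx) x := fun x y hx hy => by
    have h1 : ((x * (c y hy)⁻¹ : kˣ) : k) * c y hy = x := by simp
    have h2 : ((y * (c x hx)⁻¹ : kˣ) : k) * c x hx = y := by simp
    have h := hadj x y (x * (c y hy)⁻¹) (y * (c x hx)⁻¹) hx hy (by rw [← hc y hy, h1])
      (by rw [← hc x hx, h2])
    rw [hdiv h1, hdiv h2] at h
    rw [← sub_eq_zero, ← h]
    abel
  -- None of b, b', bb' may be 1, as s is defined only away from 1.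
  obtain ⟨b, b', hb, hb', hbb'⟩ : ∃ b b' : kˣ, b ≠ 1 ∧ b' ≠ 1 ∧ b * b' ≠ 1 := by
    classical
    obtain ⟨b, hb⟩ := Infinite.exists_notMem_finset ({0, 1} : Finset k)
    obtain ⟨b', hb'⟩ := Infinite.exists_notMem_finset ({0, 1, b⁻¹} : Finset k)
    simp only [Finset.mem_insert, Finset.mem_singleton, not_or] at hb hb'
    refine ⟨Units.mk0 b hb.1, Units.mk0 b' hb'.1, fun h => hb.2 (congrArg Units.val h),
      fun h => hb'.2.1 (congrArg Units.val h), fun h => hb'.2.2 ?_⟩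
    have : b * b' = 1 := congrArg Units.val h
    exact eq_inv_of_mul_eq_one_right this
  obtain ⟨κ, hκ⟩ : ∃ κ, ∀ x (hx : x ≠ 1), f (c x hx) x = κ := by
    refine ⟨f (c _ hbb') (b * b') - f (c b hb) b - f (c b' hb') b', fun x hx => ?_⟩
    have h1 := key x (b * b') hx hbb'
    rw [hl, hr] at h1
    have h2 := key x b hx hb
    have h3 := key x b' hx hb'
    have h4 : f (c _ hbb') (b * b') + f (c x hx) x =
        f (c b hb) b + f (c x hx) x + (f (c b' hb') b' + f (c x hx) x) := by
      rw [← h1, ← h2, ← h3]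
      abel
    have h5 := sub_eq_zero.2 h4
    rw [← sub_eq_zero, ← neg_eq_zero, ← h5]
    abel
  have hκ2 : κ + κ = 0 := by
    have h1 := key b (b * b') hb hbb'
    have h2 := key b b hb hb
    have h3 := key b b' hb hb'
    rw [hl, hr, hκ, hκ] at h1
    rw [hκ] at h2
    rw [hκ, hκ] at h3
    have h4 : κ + κ = f b b + f b b + (f b b' + f b' b) := by
      rw [← h1]
      abel
    rw [h2, h3] at h4
    simpa using h4
  refine ⟨fun x y => ?_, fun x => ?_⟩
  · by_cases hx : x = 1
    · rw [hx, hone, hone', add_zero]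
    by_cases hy : y = 1
    · rw [hy, hone, hone', add_zero]
    rw [key x y hx hy, hκ, hκ, hκ2]
  · by_cases hx : x = 1
    · rw [hx, hone']
    have hx' : x⁻¹ ≠ 1 := fun h => hx (inv_eq_one.1 h)
    have h1 : ((-x : kˣ) : k) * c _ hx' = c x hx := by
      rw [hc, hc, Units.val_neg, Units.val_inv_eq_inv_val]
      field_simp
      ring
    have h2 : f (c _ hx') x⁻¹ + f (c _ hx') x = 0 := by
      rw [← hr, inv_mul_cancel, hone']
    rw [hdiv h1, hκ, ← hκ2]
    have h3 := hκ _ hx'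
    rw [sub_eq_add_neg, ← eq_neg_of_add_eq_zero_left h2, h3]

/-- If 2 is invertible, skew-symmetry suffices; in characteristic 2 it is f(-x,x) = 0 that applies,
as -x = x. -/
theorem self_eq_zero_of_adjacent [Infinite k] [Module k M]
    (hl : ∀ x y z, f (x * y) z = f x z + f y z) (hr : ∀ x y z, f x (y * z) = f x y + f x z)
    (hadj : ∀ x y u v : kˣ, x ≠ 1 → y ≠ 1 → (u : k) * (1 - y) = x → (v : k) * (1 - x) = y →
      f u y + f v x = 0) (x : kˣ) : f x x = 0 := by
  obtain ⟨h1, h2⟩ := add_swap_eq_zero_of_adjacent hl hr hadj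
  by_cases h : (2 : k) = 0
  · have : -x = x := Units.ext (by
      rw [Units.val_neg]
      linear_combination (-(x : k)) * h)
    rw [← h2 x, this]
  · have h3 := h1 x x
    rw [← two_smul k] at h3
    exact (smul_eq_zero.1 h3).resolve_left h

end TwoSlots

/-! ### Symbols and multilinear maps on differentials -/

section Symbols

variable {k : Type u} [Field k] {M : Type u} [AddCommGroup M] [Module k M]

/-- A map is a symbol if in each variable it behaves like the logarithmic differential. -/
structure IsSymbol {n : ℕ} (L : (Fin n → kˣ) → M) : Prop where
  map_update_mul : ∀ i b x y, L (Function.update b i (x * y)) =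
    L (Function.update b i x) + L (Function.update b i y)
  smul_map_update : ∀ i b (x y z : kˣ), (x : k) + y = z →
    (z : k) • L (Function.update b i z) =
      (x : k) • L (Function.update b i x) + (y : k) • L (Function.update b i y)

theorem span_range_dlog : Submodule.span k (Set.range (dlog : kˣ → Ω[k⁄ℤ])) = ⊤ := by
  rw [← top_le_iff, ← KaehlerDifferential.span_range_derivation ℤ k, Submodule.span_le]
  rintro _ ⟨a, rfl⟩
  by_cases ha : a = 0
  · rw [ha, map_zero]
    exact zero_mem _
  · have h : KaehlerDifferential.D ℤ k a = a • dlog (Units.mk0 a ha) := by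
      rw [dlog, smul_smul, Units.val_inv_eq_inv_val, Units.val_mk0, mul_inv_cancel₀ ha, one_smul]
    rw [h]
    exact Submodule.smul_mem _ _ (Submodule.subset_span ⟨_, rfl⟩)

theorem multilinearMap_ext_dlog {ι : Type*} [Finite ι] {Φ Ψ : MultilinearMap k (fun _ : ι => Ω[k⁄ℤ]) M}
    (h : ∀ b : ι → kˣ, Φ (fun i => dlog (b i)) = Ψ (fun i => dlog (b i))) : Φ = Ψ :=
  MultilinearMap.ext_of_span_eq_top (g := fun _ => dlog) (fun _ => span_range_dlog) h

theorem dlog_mul (x y : kˣ) : dlog (x * y) = dlog x + dlog y := by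
  have hx : ((x * y)⁻¹ : kˣ) * (x : k) = (y⁻¹ : kˣ) := by
    rw [← Units.val_mul, mul_inv_rev, inv_mul_cancel_right]
  have hy : ((x * y)⁻¹ : kˣ) * (y : k) = (x⁻¹ : kˣ) := by
    rw [← Units.val_mul, mul_inv, inv_mul_cancel_right]
  rw [dlog, dlog, dlog, Units.val_mul, Derivation.leibniz, smul_add, smul_smul, smul_smul, hx, hy,
    add_comm]

/-- The linear map on differential forms attached to a logarithmic derivation. -/
theorem exists_linearMap {g : kˣ → M} (hmul : ∀ x y, g (x * y) = g x + g y)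
    (hadd : ∀ x y z : kˣ, (x : k) + y = z → (z : k) • g z = (x : k) • g x + (y : k) • g y) :
    ∃ G : Ω[k⁄ℤ] →ₗ[k] M, ∀ b, G (dlog b) = g b := by
  classical
  have hone : g 1 = 0 := by
    have := hmul 1 1
    rwa [mul_one, left_eq_add] at this
  -- Either -1 = 1, or 2 g(-1) = g(1) = 0 in a vector space with 2 invertible.
  have hneg1 : g (-1) = 0 := by
    by_cases h2 : (2 : k) = 0
    · have : (-1 : kˣ) = 1 := Units.ext (by
        rw [Units.val_neg, Units.val_one]
        linear_combination -h2)
      rw [this, hone]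
    · have h := hmul (-1) (-1)
      rw [neg_mul_neg, one_mul, hone, ← two_smul k] at h
      exact (smul_eq_zero.1 h.symm).resolve_left h2
  have hneg : ∀ x, g (-x) = g x := fun x => by
    rw [← neg_one_mul, hmul, hneg1, zero_add]
  -- The derivation belonging to `g` is a ↦ a g(a), since da = a d log a.
  let d : k → M := fun a => if h : a = 0 then 0 else a • g (Units.mk0 a h)
  have hd : ∀ x : kˣ, d x = (x : k) • g x := fun x => by
    simp only [d, dif_neg x.ne_zero, Units.mk0_val]
  have hd0 : d 0 = 0 := dif_pos rfl
  have hdu : ∀ a : k, a = 0 ∨ ∃ x : kˣ, a = x := fun a => by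
    by_cases h : a = 0
    · exact Or.inl h
    · exact Or.inr ⟨Units.mk0 a h, rfl⟩
  have hdadd : ∀ a b, d (a + b) = d a + d b := fun a b => by
    rcases hdu a with rfl | ⟨x, rfl⟩
    · rw [zero_add, hd0, zero_add]
    rcases hdu b with rfl | ⟨y, rfl⟩
    · rw [add_zero, hd0, add_zero]
    rcases hdu ((x : k) + y) with h | ⟨z, h⟩
    · have h1 : y = -x := Units.ext (by rw [Units.val_neg]; linear_combination h)
      rw [h, hd0, hd, hd, h1, hneg, Units.val_neg, neg_smul, add_neg_cancel]
    · rw [h, hd, hd, hd, hadd x y z h]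
  have hdmul : ∀ a b, d (a * b) = a • d b + b • d a := fun a b => by
    rcases hdu a with rfl | ⟨x, rfl⟩
    · rw [zero_mul, hd0, zero_smul, smul_zero, add_zero]
    rcases hdu b with rfl | ⟨y, rfl⟩
    · rw [mul_zero, hd0, zero_smul, smul_zero, add_zero]
    rw [← Units.val_mul, hd, hd, hd, hmul, smul_add, smul_smul, smul_smul, Units.val_mul,
      add_comm, mul_comm (y : k)]
  let D : Derivation ℤ k M := Derivation.mk' (AddMonoidHom.toIntLinearMap
    { toFun := d, map_zero' := hd0, map_add' := hdadd }) hdmul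
  refine ⟨D.liftKaehlerDifferential, fun b => ?_⟩
  rw [dlog, map_smul, Derivation.liftKaehlerDifferential_comp_D]
  change _ • d b = _
  rw [hd, smul_smul, Units.inv_mul, one_smul]

/-- With the first entry x fixed, induction gives a multilinear map in the others. It depends on x
like a logarithmic derivative, so `exists_linearMap` applies with values in the space of multilinear
maps. -/
theorem IsSymbol.exists_multilinearMap : ∀ {n : ℕ} {M : Type u} [AddCommGroup M] [Module k M]
    {L : (Fin n → kˣ) → M}, IsSymbol L →
    ∃ Φ : MultilinearMap k (fun _ : Fin n => Ω[k⁄ℤ]) M, ∀ b, Φ (fun i => dlog (b i)) = L b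
  | 0, M, _, _, L, _ => ⟨MultilinearMap.constOfIsEmpty k _ (L Fin.elim0), fun b =>
      congrArg L (Subsingleton.elim _ _)⟩
  | n + 1, M, _, _, L, hL => by
    have hcons : ∀ x, IsSymbol (fun b : Fin n → kˣ => L (Fin.cons x b)) := fun x =>
      ⟨fun i b y z => by
        simp only [Fin.cons_update]
        exact hL.map_update_mul _ _ _ _, fun i b y z w h => by
        simp only [Fin.cons_update]
        exact hL.smul_map_update _ _ _ _ _ h⟩
    choose Φ hΦ using fun x => (hcons x).exists_multilinearMap
    have hupd : ∀ x y (b : Fin n → kˣ), L (Fin.cons x b) =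
        L (Function.update (Fin.cons y b : Fin (n + 1) → kˣ) 0 x) := fun x y b => by
      rw [Fin.update_cons_zero]
    obtain ⟨G, hG⟩ := exists_linearMap (g := Φ) (fun x y => multilinearMap_ext_dlog fun b => by
        rw [add_apply, hΦ, hΦ, hΦ, hupd _ 1, hL.map_update_mul, ← hupd, ← hupd])
      (fun x y z h => multilinearMap_ext_dlog fun b => by
        rw [add_apply, smul_apply, smul_apply,
          smul_apply, hΦ, hΦ, hΦ, hupd _ 1, hL.smul_map_update _ _ _ _ _ h,
          ← hupd, ← hupd])
    refine ⟨G.uncurryLeft, fun b => ?_⟩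
    rw [LinearMap.uncurryLeft_apply, hG]
    refine (hΦ _ _).trans ?_
    exact congrArg L (Fin.cons_self_tail b)

/-- Exchanging the second of the two equal entries with its predecessor brings them one step closer
and changes only the sign. -/
theorem eq_zero_of_adjacent {n : ℕ} {X M : Type*} [AddGroup M] {f : (Fin n → X) → M}
    (hswap : ∀ (i j : Fin n) (_ : (j : ℕ) = i + 1) v, f (v ∘ Equiv.swap i j) = -f v)
    (hself : ∀ (i j : Fin n) (_ : (j : ℕ) = i + 1) v, v i = v j → f v = 0) (d : ℕ) :
    ∀ (i j : Fin n), (j : ℕ) = i + 1 + d → ∀ v, v i = v j → f v = 0 := by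
  induction d with
  | zero => exact hself
  | succ d ih =>
    intro i j hij v hv
    let l : Fin n := ⟨j - 1, by omega⟩
    have hl : (j : ℕ) = l + 1 := by simp only [l]; omega
    rw [← neg_eq_zero, ← hswap l j hl]
    refine ih i l (by simp only [l]; omega) _ ?_
    have h1 : i ≠ l := fun h => by rw [h] at hij; omega
    have h2 : i ≠ j := fun h => by rw [h] at hij; omega
    simp only [Function.comp_apply, Equiv.swap_apply_left, Equiv.swap_apply_of_ne_of_ne h1 h2]
    exact hv

end Symbols

/-! ### Alternating maps from relations on adjacent entries -/

section Alternating

variable {k : Type u} [Field k] {M : Type u} [AddCommGroup M] [Module k M]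

theorem comp_swap_eq_update {ι X : Type*} [DecidableEq ι] {i j : ι} (hij : i ≠ j) (b : ι → X) :
    b ∘ Equiv.swap i j = Function.update (Function.update b i (b j)) j (b i) := by
  funext l
  by_cases h1 : l = j
  · rw [h1, Function.update_self, Function.comp_apply, Equiv.swap_apply_right]
  by_cases h2 : l = i
  · rw [h2, Function.update_of_ne hij, Function.update_self, Function.comp_apply,
      Equiv.swap_apply_left]
  · rw [Function.update_of_ne h1, Function.update_of_ne h2, Function.comp_apply,
      Equiv.swap_apply_of_ne_of_ne h2 h1]

theorem update_comp_swap {ι X : Type*} [DecidableEq ι] {i j : ι} (b : ι → X) (x : X) :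
    Function.update b j x ∘ Equiv.swap i j = Function.update (b ∘ Equiv.swap i j) i x := by
  rw [Function.update_comp_equiv, Equiv.symm_swap, Equiv.swap_apply_right]

/-- A multilinear map on differential forms is alternating in two variables if this holds on
logarithmic forms. -/
theorem map_eq_zero_of_dlog {ι : Type*} [Finite ι] [DecidableEq ι]
    {Φ : MultilinearMap k (fun _ : ι => Ω[k⁄ℤ]) M} {i j : ι} (hij : i ≠ j)
    (hswap : ∀ v, Φ (v ∘ Equiv.swap i j) = -Φ v)
    (hself : ∀ b : ι → kˣ, b i = b j → Φ (fun l => dlog (b l)) = 0) (v : ι → Ω[k⁄ℤ])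
    (hv : v i = v j) : Φ v = 0 := by
  -- The value with x in both slots is additive in x, since the cross terms cancel by skew-symmetry.
  -- It thus suffices to take x = d log b, and then the remaining entries may be taken logarithmic
  -- by multilinearity.
  have key : ∀ x v, Φ (Function.update (Function.update v i x) j x) = 0 := fun x => by
    have hx : x ∈ Submodule.span k (Set.range (dlog : kˣ → Ω[k⁄ℤ])) :=
      by rw [span_range_dlog]; exact Submodule.mem_top
    induction hx using Submodule.span_induction with
    | mem x hx =>
      obtain ⟨b, rfl⟩ : ∃ b : kˣ, dlog b = x := hx
      intro v
      have h0 : Φ.domDomRestrict (fun l => l ≠ i ∧ l ≠ j) (fun _ => (dlog b : Ω[k⁄ℤ])) = 0 :=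
        multilinearMap_ext_dlog (k := k) (M := M) fun c => by
          rw [MultilinearMap.domDomRestrict_apply, zero_apply]
          have := hself (fun l => if h : l ≠ i ∧ l ≠ j then c ⟨l, h⟩ else b) (by simp)
          rw [← this]
          congr 1
          funext l
          split_ifs <;> rfl
      have h1 := congrArg (fun Ψ => Ψ fun l => v l.1) h0
      simp only [MultilinearMap.domDomRestrict_apply, zero_apply] at h1
      rw [← h1]
      congr 1
      funext l
      by_cases h1 : l = j
      · rw [h1, Function.update_self, dif_neg (by simp)]
      by_cases h2 : l = i
      · rw [h2, Function.update_of_ne hij, Function.update_self, dif_neg (by simp)]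
      · rw [Function.update_of_ne h1, Function.update_of_ne h2, dif_pos ⟨h2, h1⟩]
    | zero =>
      intro v
      rw [Φ.map_update_zero]
    | add x y _ _ hx hy =>
      intro v
      have hs : Φ (Function.update (Function.update v i y) j x) =
          -Φ (Function.update (Function.update v i x) j y) := by
        rw [← hswap, comp_swap_eq_update hij]
        congr 1
        funext l
        by_cases h1 : l = j
        · simp [h1, hij]
        by_cases h2 : l = i
        · simp [h2, hij]
        · simp [h1, h2]
      have hexp : ∀ z, Φ (Function.update (Function.update v i (x + y)) j z) =
          Φ (Function.update (Function.update v i x) j z) +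
            Φ (Function.update (Function.update v i y) j z) := fun z => by
        simp only [Function.update_comm hij]
        exact Φ.map_update_add _ _ _ _
      rw [Φ.map_update_add, hexp, hexp, hx, hy, hs, zero_add, add_zero, neg_add_cancel]
    | smul c x _ hx =>
      intro v
      rw [Φ.map_update_smul, Function.update_comm hij, Φ.map_update_smul,
        Function.update_comm hij.symm, hx, smul_zero, smul_zero]
  have := key (v i) v
  rwa [Function.update_eq_self, hv, Function.update_eq_self] at this

/-- The relation on adjacent entries makes L alternating in neighbouring slots on logarithmic
entries. This extends to all differentials and then to arbitrary pairs of slots. -/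
theorem exists_alternatingMap_of_adjacent [Infinite k] {n : ℕ} {L : (Fin (n + 1) → kˣ) → M}
    (hmul : ∀ i b x y, L (Function.update b i (x * y)) =
      L (Function.update b i x) + L (Function.update b i y))
    (hadd : ∀ b (x y z : kˣ), (x : k) + y = z → (z : k) • L (Function.update b 0 z) =
      (x : k) • L (Function.update b 0 x) + (y : k) • L (Function.update b 0 y))
    (hadj : ∀ (i : Fin n) (b : Fin (n + 1) → kˣ) (x y u v : kˣ), x ≠ 1 → y ≠ 1 →
      (u : k) * (1 - y) = x → (v : k) * (1 - x) = y →
      L (Function.update (Function.update b i.castSucc u) i.succ y) +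
        L (Function.update (Function.update b i.castSucc v) i.succ x) = 0) :
    ∃ Φ : Ω[k⁄ℤ] [⋀^Fin (n + 1)]→ₗ[k] M, ∀ b, Φ (fun i => dlog (b i)) = L b := by
  have hne : ∀ i : Fin n, i.castSucc ≠ i.succ := fun i => Fin.castSucc_lt_succ.ne
  have hl : ∀ (i : Fin n) (b : Fin (n + 1) → kˣ) (x y z : kˣ),
      L (Function.update (Function.update b i.castSucc (x * y)) i.succ z) =
      L (Function.update (Function.update b i.castSucc x) i.succ z) +
      L (Function.update (Function.update b i.castSucc y) i.succ z) := fun i b x y z => by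
    simp only [Function.update_comm (hne i)]
    exact hmul _ _ _ _
  have hr : ∀ (i : Fin n) (b : Fin (n + 1) → kˣ) (x y z : kˣ),
      L (Function.update (Function.update b i.castSucc x) i.succ (y * z)) =
      L (Function.update (Function.update b i.castSucc x) i.succ y) +
      L (Function.update (Function.update b i.castSucc x) i.succ z) := fun i b x y z =>
    hmul _ _ _ _
  have hswap : ∀ (i : Fin n) b, L (b ∘ Equiv.swap i.castSucc i.succ) = -L b := fun i b => by
    have h := (add_swap_eq_zero_of_adjacent (hl i b) (hr i b) (hadj i b)).1 (b i.castSucc) (b i.succ)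
    rw [← comp_swap_eq_update (hne i), Function.update_eq_self, Function.update_eq_self] at h
    exact eq_neg_of_add_eq_zero_right h
  have hself : ∀ (i : Fin n) b, b i.castSucc = b i.succ → L b = 0 := fun i b hb => by
    have h := self_eq_zero_of_adjacent (hl i b) (hr i b) (hadj i b) (b i.castSucc)
    rwa [Function.update_eq_self, hb, Function.update_eq_self] at h
  -- The additive relation is assumed for the slot 0 only; skew-symmetry carries it from each slot
  -- to the next.
  have hL : IsSymbol L := ⟨hmul, fun i => by
    induction i using Fin.induction with
    | zero => exact hadd
    | succ i ih =>
      intro b x y z h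
      have h1 : ∀ c : kˣ, L (Function.update b i.succ c) =
          -L (Function.update (b ∘ Equiv.swap i.castSucc i.succ) i.castSucc c) := fun c => by
        rw [← update_comp_swap, hswap, neg_neg]
      rw [h1, h1, h1, smul_neg, smul_neg, smul_neg, ih _ x y z h, neg_add]⟩
  obtain ⟨Φ, hΦ⟩ := hL.exists_multilinearMap
  have hadjacent : ∀ i j : Fin (n + 1), (j : ℕ) = i + 1 →
      ∃ l : Fin n, i = l.castSucc ∧ j = l.succ := fun i j hij =>
    ⟨⟨i, by omega⟩, rfl, Fin.ext hij⟩
  have hΦswap : ∀ (i j : Fin (n + 1)) (_ : (j : ℕ) = i + 1) v, Φ (v ∘ Equiv.swap i j) = -Φ v := by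
    intro i j hij
    obtain ⟨l, rfl, rfl⟩ := hadjacent i j hij
    have h : Φ.domDomCongr (Equiv.swap l.castSucc l.succ) = -Φ :=
      multilinearMap_ext_dlog fun b => by
        have h1 := hΦ (b ∘ Equiv.swap l.castSucc l.succ)
        rw [hswap, ← hΦ] at h1
        exact h1
    intro v
    exact congrArg (fun Ψ => Ψ v) h
  refine ⟨{ Φ with map_eq_zero_of_eq' := fun v i j hv hij => ?_ }, hΦ⟩
  have hΦself : ∀ (i j : Fin (n + 1)) (_ : (j : ℕ) = i + 1) v, v i = v j → Φ v = 0 := by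
    intro i j hij v hv
    have hΦs := hΦswap i j hij
    obtain ⟨l, rfl, rfl⟩ := hadjacent i j hij
    exact map_eq_zero_of_dlog (hne l) hΦs (fun b hb => by rw [hΦ, hself l b hb]) v hv
  change Φ v = 0
  rcases lt_or_gt_of_ne hij with h | h
  · exact eq_zero_of_adjacent hΦswap hΦself (j - i - 1) i j (by
      have : (i : ℕ) < j := h
      omega) v hv
  · exact eq_zero_of_adjacent hΦswap hΦself (i - j - 1) j i (by
      have : (j : ℕ) < i := h
      omega) v hv.symm

/-- Alternating maps are invariant under unitriangular substitutions. -/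
theorem AlternatingMap.map_add_sum_Ioi {R V W : Type*} [CommRing R] [AddCommGroup V] [Module R V]
    [AddCommGroup W] [Module R W] {n : ℕ} (f : V [⋀^Fin n]→ₗ[R] W) (v : Fin n → V)
    (c : Fin n → Fin n → R) :
    f (fun i => v i + ∑ l ∈ Finset.Ioi i, c i l • v l) = f v := by
  let v' : Fin n → V := fun i => v i + ∑ l ∈ Finset.Ioi i, c i l • v l
  -- The entries are changed one at a time from the left. When an entry is changed the later ones
  -- are still the original ones, so the added multiples of them contribute nothing.
  have key : ∀ m : ℕ, m ≤ n → f (fun i => if (i : ℕ) < m then v' i else v i) = f v := fun m => by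
    induction m with
    | zero => simp
    | succ m ih =>
      intro hm
      rw [← ih (by omega)]
      let i : Fin n := ⟨m, by omega⟩
      let h : Fin n → V := fun i => if (i : ℕ) < m then v' i else v i
      have h1 : (fun i : Fin n => if (i : ℕ) < m + 1 then v' i else v i) =
          Function.update h i (h i + ∑ l ∈ Finset.Ioi i, c i l • h l) := by
        funext l
        by_cases hl : l = i
        · rw [hl, Function.update_self, if_pos (Nat.lt_succ_self m)]
          simp only [v', h]
          rw [if_neg (lt_irrefl m)]
          congr 1
          refine Finset.sum_congr rfl fun s hs => ?_
          have : m < (s : ℕ) := Fin.lt_def.1 (Finset.mem_Ioi.1 hs)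
          rw [if_neg (by omega)]
        · have : (l : ℕ) ≠ m := fun h => hl (Fin.ext h)
          rw [Function.update_of_ne hl]
          simp only [h]
          by_cases h2 : (l : ℕ) < m
          · rw [if_pos h2, if_pos (by omega)]
          · rw [if_neg h2, if_neg (by omega)]
      rw [h1, f.map_update_add, Function.update_eq_self, f.map_update_sum, Finset.sum_eq_zero,
        add_zero]
      intro l hl
      rw [f.map_update_smul, f.map_update_self _ (Finset.mem_Ioi.1 hl).ne, smul_zero]
  have := key n le_rfl
  simpa using this

end Alternating

/-! ### Identities between logarithmic forms -/

section LogarithmicForms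

variable {k : Type u} [Field k]

/-- Since b d log b = db, both sides are the differential of the sum. -/
theorem sum_smul_dlog {ι : Type*} (s : Finset ι) (b : ι → kˣ) {z : kˣ} (h : ∑ i ∈ s, (b i : k) = z) :
    ∑ i ∈ s, (b i : k) • dlog (b i) = (z : k) • dlog z := by
  simp only [dlog, smul_smul, Units.mul_inv, one_smul]
  rw [← map_sum, h]

theorem dlog_neg (x : kˣ) : dlog (-x) = dlog x := by
  rw [dlog, dlog, inv_neg, Units.val_neg, Units.val_neg, map_neg, smul_neg, neg_smul, neg_neg]

theorem dlog_one : dlog (1 : kˣ) = 0 := by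
  simp [dlog]

theorem dlog_div (x y : kˣ) : dlog (x / y) = dlog x - dlog y := by
  have := dlog_mul (x / y) y
  rw [div_mul_cancel] at this
  rw [this, add_sub_cancel_right]

/-- The logarithmic form is zero if some tail of the entries has the sum `1`. -/
theorem dlogWedge_eq_zero {n : ℕ} {b : Fin n → kˣ} {m : ℕ}
    (h : ∑ i ∈ Finset.univ.filter (fun i : Fin n => m ≤ i), (b i : k) = 1) : dlogWedge b = 0 := by
  refine AlternatingMap.map_linearDependent _ _ fun hli => ?_
  rw [Fintype.linearIndependent_iff] at hli
  -- ∑ b_i d log b_i = d1 = 0 over the tail is a nontrivial linear dependence.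
  have h1 := sum_smul_dlog _ b (z := 1) (by rw [h, Units.val_one])
  rw [dlog_one, smul_zero] at h1
  have hcoe := hli (fun i => if m ≤ (i : ℕ) then (b i : k) else 0) (by
    simp only [ite_smul, zero_smul]
    rw [← Finset.sum_filter]
    exact h1)
  have h0 : ∀ i ∈ Finset.univ.filter (fun i : Fin n => m ≤ i), (b i : k) = 0 := fun i hi => by
    have := hcoe i
    rwa [if_pos (Finset.mem_filter.1 hi).2] at this
  rw [Finset.sum_eq_zero h0] at h
  exact zero_ne_one h

/-- A logarithmic form does not change if its entries are divided by the tail sums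
`-1 + ∑_{l > i} b_l`. -/
theorem dlogWedge_eq {n : ℕ} {b β σ : Fin n → kˣ}
    (hσ : ∀ i, (σ i : k) = -1 + ∑ l ∈ Finset.Ioi i, (b l : k)) (hβ : ∀ i, β i = -b i / σ i) :
    dlogWedge β = dlogWedge b := by
  -- One has d log β_i = d log b_i - d log σ_i, and σ_i d log σ_i = dσ_i is the sum of b_l d log b_l
  -- over l > i.
  have h1 : ∀ i, dlog (β i) = dlog (b i) +
      ∑ l ∈ Finset.Ioi i, (-((σ i)⁻¹ : kˣ) * (b l : k)) • dlog (b l) := fun i => by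
    have h2 : ∑ l ∈ Finset.Ioi i, (b l : k) • dlog (b l) = (σ i : k) • dlog (σ i) := by
      have h3 : ∑ l ∈ Finset.Ioi i, KaehlerDifferential.D ℤ k (b l : k) =
          KaehlerDifferential.D ℤ k (σ i : k) := by
        rw [hσ, map_add, map_neg, Derivation.map_one_eq_zero, neg_zero, zero_add, map_sum]
      simpa only [dlog, smul_smul, Units.mul_inv, one_smul] using h3
    simp only [← smul_smul]
    rw [← Finset.smul_sum, h2, hβ, dlog_div, dlog_neg, smul_smul, neg_mul, Units.inv_mul, neg_smul,
      one_smul, sub_eq_add_neg]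
  unfold dlogWedge
  simp only [h1]
  exact AlternatingMap.map_add_sum_Ioi _ _ (fun i l => -((σ i)⁻¹ : kˣ) * (b l : k))

theorem linearMap_ext_dlogWedge {n : ℕ} {M : Type u} [AddCommGroup M] [Module k M]
    {f g : Forms k n →ₗ[k] M} (h : ∀ b, f (dlogWedge b) = g (dlogWedge b)) : f = g := by
  refine exteriorPower.linearMap_ext (AlternatingMap.coe_multilinearMap_injective
    (multilinearMap_ext_dlog fun b => ?_))
  exact h b

end LogarithmicForms

/-! ### The vector space structure, and finite fields -/

section FormClasses

variable {k : Type u} [Field k] {n : ℕ} {K : Type u} [Field K] [Algebra k K] [FiniteDimensional k K]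

/-- Either an inner tail sum vanishes, or the point is recovered from the ratios of its tail sums;
the resulting β i are nonzero because the coordinates are. -/
theorem torusClass_eq_zero_or_eq_formClass (v : Fin (n + 2) → K) : torusClass k v = 0 ∨
    ∃ (x : K) (β : Fin n → K), (∀ i, β i ≠ 0) ∧ torusClass k v = formClass k x β := by
  by_cases hv : IsTorusPoint v
  swap
  · exact Or.inl (torusClass_of_not hv)
  obtain ⟨R, h0, hn, rfl⟩ := exists_diffPoint hv.sum_eq
  by_cases hR : ∀ m, 1 ≤ m → m ≤ n + 1 → R m ≠ 0
  · refine Or.inr ⟨_, _, fun i => ?_, torusClass_diffPoint h0 hn hR⟩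
    have h1 : R (i + 2) ≠ 0 := hR _ (by omega) (by omega)
    have h2 : R (i + 1) - R (i + 2) ≠ 0 := hv.ne_zero i.succ.castSucc
    rw [one_sub_div h1]
    exact div_ne_zero (fun h => h2 (by linear_combination -h)) h1
  · push Not at hR
    obtain ⟨m, hm, hmn, h⟩ := hR
    exact Or.inl (torusClass_diffPoint_eq_zero hn hm hmn h)

theorem eq_top_of_formClass_mem (h : Infinite k ∨ n = 0) {H : AddSubgroup (SH k (n + 1) (n + 1))}
    (hH : ∀ (x : k) (β : Fin n → kˣ), formClass k x (fun i => (β i : k)) ∈ H) : H = ⊤ := by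
  rw [eq_top_iff, ← closure_pointClass h, AddSubgroup.closure_le]
  rintro _ ⟨v, hv, h0, rfl⟩
  rw [← torusClass_self hv h0]
  rcases torusClass_eq_zero_or_eq_formClass (k := k) v with h1 | ⟨x, β, hβ, h1⟩
  · rw [h1]
    exact zero_mem _
  · rw [h1]
    exact hH x (fun i => Units.mk0 (β i) (hβ i))

/-- It reduces the axioms of a vector space to identities in the argument x of `formClass k x β`. -/
theorem addMonoidHom_ext_formClass (h : Infinite k ∨ n = 0) {A : Type*} [AddCommGroup A]
    {f g : SH k (n + 1) (n + 1) →+ A}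
    (hfg : ∀ (x : k) (β : Fin n → k), f (formClass k x β) = g (formClass k x β)) : f = g := by
  have h1 : f.eqLocus g = ⊤ := eq_top_of_formClass_mem h fun x β => hfg x _
  exact AddMonoidHom.ext fun x => by
    have : x ∈ f.eqLocus g := h1 ▸ AddSubgroup.mem_top x
    exact this

open Classical in
/-- The action `x ↦ a ⋆ x`, extended by `0 ⋆ x = 0`. -/
def starOrZero (a : k) : SH k (n + 1) (n + 1) →+ SH k (n + 1) (n + 1) :=
  if h : a = 0 then 0 else star (Units.mk0 a h)

theorem starOrZero_unit (a : kˣ) :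
    (starOrZero (a : k) : SH k (n + 1) (n + 1) →+ SH k (n + 1) (n + 1)) = star a := by
  rw [starOrZero, dif_neg a.ne_zero, Units.mk0_val]

theorem starOrZero_formClass (a x : k) (β : Fin n → k) :
    starOrZero a (formClass k x β) = formClass k (a * x) β := by
  unfold starOrZero
  split_ifs with h
  · rw [h, zero_mul, formClass_zero, AddMonoidHom.zero_apply]
  · rw [star_formClass, Units.val_mk0]

theorem starOrZero_add (h : Infinite k ∨ n = 0) (a b : k) (x : SH k (n + 1) (n + 1)) :
    starOrZero (a + b) x = starOrZero a x + starOrZero b x := by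
  let f : SH k (n + 1) (n + 1) →+ SH k (n + 1) (n + 1) := starOrZero a
  let g : SH k (n + 1) (n + 1) →+ SH k (n + 1) (n + 1) := starOrZero b
  have : starOrZero (a + b) = f + g := addMonoidHom_ext_formClass h fun x β => by
    rw [AddMonoidHom.add_apply, starOrZero_formClass, starOrZero_formClass, starOrZero_formClass,
      add_mul, formClass_add]
  exact DFunLike.congr_fun this x

theorem starOrZero_mul (h : Infinite k ∨ n = 0) (a b : k) (x : SH k (n + 1) (n + 1)) :
    starOrZero (a * b) x = starOrZero a (starOrZero b x) := by
  have : starOrZero (a * b) = (starOrZero a).comp (starOrZero b) :=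
    addMonoidHom_ext_formClass (k := k) h fun x β => by
      rw [AddMonoidHom.comp_apply, starOrZero_formClass, starOrZero_formClass,
        starOrZero_formClass, mul_assoc]
  exact DFunLike.congr_fun this x

theorem starOrZero_one (h : Infinite k ∨ n = 0) (x : SH k (n + 1) (n + 1)) :
    starOrZero (1 : k) x = x := by
  have : starOrZero (1 : k) = AddMonoidHom.id _ := addMonoidHom_ext_formClass (k := k) h fun x β => by
    rw [starOrZero_formClass, one_mul, AddMonoidHom.id_apply]
  exact DFunLike.congr_fun this x

theorem starOrZero_zero (x : SH k (n + 1) (n + 1)) : starOrZero (0 : k) x = 0 := by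
  rw [starOrZero, dif_pos rfl, AddMonoidHom.zero_apply]

/-- The `k`-vector space structure of `SH^(n+1)(k, n+1)`. -/
abbrev moduleSH (h : Infinite k ∨ n = 0) : Module k (SH k (n + 1) (n + 1)) where
  smul a x := starOrZero a x
  one_smul := starOrZero_one h
  mul_smul := starOrZero_mul h
  smul_zero a := map_zero (starOrZero a)
  smul_add a := map_add (starOrZero a)
  add_smul := starOrZero_add h
  zero_smul := starOrZero_zero

/-- Let q be the order of `K`. As β_0^(q-1) = 1, the class is killed by q - 1; as q x = 0, it is
killed by q. -/
theorem formClass_eq_zero_of_finite [Finite K] (x : K) {β : Fin (n + 1) → K} (hβ : β 0 ≠ 0) :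
    formClass k x β = 0 := by
  have := Fintype.ofFinite K
  have h1 : ∀ j : ℕ, formClass k x (Function.update β 0 (β 0 ^ j)) = j • formClass k x β :=
      fun j => by
    induction j with
    | zero => rw [pow_zero, zero_nsmul, formClass_of_eq_one x _ (Function.update_self 0 1 β)]
    | succ j ih =>
      rw [pow_succ, formClass_update_mul x β 0 (pow_ne_zero j hβ) hβ, ih, Function.update_eq_self,
        succ_nsmul]
  have h2 : ∀ j : ℕ, formClass k (j * x) β = j • formClass k x β := fun j => by
    induction j with
    | zero => rw [Nat.cast_zero, zero_mul, formClass_zero, zero_nsmul]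
    | succ j ih => rw [Nat.cast_succ, add_mul, formClass_add, one_mul, ih, succ_nsmul]
  have h3 := h1 (Fintype.card K - 1)
  rw [FiniteField.pow_card_sub_one_eq_one _ hβ,
    formClass_of_eq_one x _ (Function.update_self 0 1 β)] at h3
  have h4 := h2 (Fintype.card K - 1 + 1)
  rw [succ_nsmul, ← h3, zero_add, Nat.sub_add_cancel Fintype.card_pos, Nat.cast_card_eq_zero,
    zero_mul, formClass_zero] at h4
  exact h4.symm

/-- Finite extensions of `k` are finite as well, so the vanishing applies directly to all closed
points and no reduction to rational points is needed. -/
theorem subsingleton_SH_of_finite [Finite k] : Subsingleton (SH k (n + 2) (n + 2)) := by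
  have h : goodCycles k (n + 2) (n + 2) ≤ boundaries k (n + 2) (n + 2) :=
    goodCycles_le _ fun K _ _ _ v hv _ => by
      have : Finite K := Module.finite_of_finite k
      have h1 : torusClass k v = 0 := by
        rcases torusClass_eq_zero_or_eq_formClass (k := k) v with h1 | ⟨x, β, hβ, h1⟩
        · exact h1
        · rw [h1, formClass_eq_zero_of_finite x (hβ 0)]
      rw [torusClass_of_isTorusPoint hv] at h1
      exact AddSubgroup.mem_addSubgroupOf.1 ((QuotientAddGroup.eq_zero_iff _).1 h1)
  have h0 : ∀ x : SH k (n + 2) (n + 2), x = 0 := fun x => by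
    obtain ⟨z, rfl⟩ := QuotientAddGroup.mk_surjective x
    exact (QuotientAddGroup.eq_zero_iff _).2 (AddSubgroup.mem_addSubgroupOf.2 (h z.2.1))
  exact ⟨fun x y => by rw [h0 x, h0 y]⟩

end FormClasses

/-! ### Existence, uniqueness and surjectivity of φ -/

section Phi

variable {k : Type u} [Field k] {n : ℕ}

/-- An abstract form of the argument, with `F` in the role of `formClass k` and `M` in that of the
additive Chow group. -/
theorem exists_alternatingMap_of_smul_mul [Infinite k] {M : Type u} [AddCommGroup M] [Module k M]
    {F : k → (Fin (n + 1) → k) → M} (hF : ∀ x y β, x • F y β = F (x * y) β)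
    (hmul : ∀ x β i {a b : k}, a ≠ 0 → b ≠ 0 → F x (Function.update β i (a * b)) =
      F x (Function.update β i a) + F x (Function.update β i b))
    (hadd : ∀ x y β, F (x + y) β = F x β + F y β)
    (hself : ∀ x β, β 0 ≠ 0 →
      F (β 0 * x) β + F ((1 - β 0) * x) (Function.update β 0 (1 - β 0)) = 0)
    (hadj : ∀ y β (i : Fin n) {x b : k}, x ≠ 1 → b ≠ 1 →
      F y (Function.update (Function.update β i.castSucc (x / (1 - b))) i.succ b) +
      F y (Function.update (Function.update β i.castSucc (b / (1 - x))) i.succ x) = 0) :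
    ∃ Φ : Ω[k⁄ℤ] [⋀^Fin (n + 1)]→ₗ[k] M,
      ∀ b : Fin (n + 1) → kˣ, Φ (fun i => dlog (b i)) = F 1 fun i => (b i : k) := by
  have hup : ∀ (b : Fin (n + 1) → kˣ) i x, (fun j => (Function.update b i x j : k)) =
      Function.update (fun j => (b j : k)) i x := fun b i x =>
    funext fun j => Function.apply_update (fun _ => Units.val) b i x j
  refine exists_alternatingMap_of_adjacent (L := fun b : Fin (n + 1) → kˣ => F 1 fun i => (b i : k))
    (fun i b x y => ?_) (fun b x y z hxyz => ?_) (fun i b x y u v hx hy hu hv => ?_)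
  · simp only [hup, Units.val_mul]
    exact hmul 1 _ i x.ne_zero y.ne_zero
  · simp only [hup, hF, mul_one]
    set β : Fin (n + 1) → k := fun j => (b j : k)
    -- For z = x + y, the relation a d log a + (1 - a) d log (1 - a) = 0 is used with a = x/z and
    -- scaled by z; then x/z and y/z are expanded multiplicatively to get x d log x + y d log y = z
    -- d log z.
    have hz := z.ne_zero
    have h1 := hself (z : k) (Function.update β 0 (x / z : k))
      (by rw [Function.update_self]; exact div_ne_zero x.ne_zero hz)
    have e : 1 - (x : k) / z = y / z := by
      rw [one_sub_div hz, ← hxyz, add_sub_cancel_left]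
    rw [Function.update_self, Function.update_idem, e, div_mul_cancel₀ _ hz,
      div_mul_cancel₀ _ hz] at h1
    have h2 : ∀ w : kˣ, F (w : k) (Function.update β 0 w) =
        F (w : k) (Function.update β 0 (w / z : k)) + F (w : k) (Function.update β 0 z) :=
      fun w => by
        rw [← hmul _ _ _ (div_ne_zero w.ne_zero hz) hz, div_mul_cancel₀ _ hz]
    rw [h2 x, h2 y, add_add_add_comm, h1, zero_add, ← hadd, hxyz]
  · have hx' : (x : k) ≠ 1 := fun h => hx (Units.ext h)
    have hy' : (y : k) ≠ 1 := fun h => hy (Units.ext h)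
    have hu' : (u : k) = x / (1 - y) := eq_div_of_mul_eq (sub_ne_zero.2 hy'.symm) hu
    have hv' : (v : k) = y / (1 - x) := eq_div_of_mul_eq (sub_ne_zero.2 hx'.symm) hv
    simp only [hup, hu', hv']
    exact hadj 1 _ i hx' hy'

theorem exists_linearMap_dlogWedge (h : Infinite k ∨ n = 0) :
    letI := moduleSH h
    ∃ φ : Forms k n →ₗ[k] SH k (n + 1) (n + 1),
      ∀ b, φ (dlogWedge b) = formClass k (1 : k) fun i => (b i : k) := by
  let := moduleSH h
  suffices hΦ : ∃ Φ : Ω[k⁄ℤ] [⋀^Fin n]→ₗ[k] SH k (n + 1) (n + 1),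
      ∀ b : Fin n → kˣ, Φ (fun i => dlog (b i)) = formClass k (1 : k) fun i => (b i : k) by
    obtain ⟨Φ, hΦ⟩ := hΦ
    exact ⟨exteriorPower.alternatingMapLinearEquiv Φ, fun b => by
      rw [dlogWedge, exteriorPower.alternatingMapLinearEquiv_apply_ιMulti, hΦ]⟩
  cases n with
  | zero =>
    refine ⟨AlternatingMap.constOfIsEmpty k _ (Fin 0) (formClass k (1 : k) Fin.elim0), fun b => ?_⟩
    change formClass k (1 : k) _ = _
    congr 1
    exact Subsingleton.elim _ _
  | succ n =>
    have : Infinite k := h.resolve_right (Nat.succ_ne_zero n)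
    exact exists_alternatingMap_of_smul_mul starOrZero_formClass formClass_update_mul formClass_add
      formClass_mul_self_add formClass_adjacent

/-- The tail sums of the point `(-1, b_1 / c, …, b_n / c, -1 / c)`. -/
theorem exists_symbolPoint_eq_diffPoint (b : Fin n → kˣ) (hc : -1 + ∑ i, (b i : k) ≠ 0) :
    ∃ R : ℕ → k, R 0 = 0 ∧ R (n + 2) = 0 ∧ (∀ m, m ≤ n → R (m + 1) =
      (-1 + ∑ i ∈ Finset.univ.filter (fun i : Fin n => m ≤ i), (b i : k)) /
        (-1 + ∑ i, (b i : k))) ∧ symbolPoint b = diffPoint (n + 2) R := by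
  let c := -1 + ∑ i, (b i : k)
  let σ : ℕ → k := fun m => -1 + ∑ i ∈ Finset.univ.filter (fun i : Fin n => m ≤ i), (b i : k)
  let R : ℕ → k := fun m => if m = 0 ∨ n + 2 ≤ m then 0 else σ (m - 1) / c
  have hσ0 : σ 0 = c := by simp [σ, c]
  have hσn : σ n = -1 := by
    simp only [σ]
    rw [Finset.filter_false_of_mem fun i _ => not_le.2 i.2, Finset.sum_empty, add_zero]
  have hσ : ∀ i : Fin n, σ i - σ (i + 1) = b i := fun i => by
    have : Finset.univ.filter (fun l : Fin n => (i : ℕ) ≤ l) =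
        insert i (Finset.univ.filter fun l : Fin n => (i : ℕ) + 1 ≤ l) := by
      ext l
      simp only [Finset.mem_filter, Finset.mem_univ, true_and, Finset.mem_insert, Fin.ext_iff]
      omega
    simp only [σ]
    rw [this, Finset.sum_insert (by simp)]
    ring
  have hR : ∀ m, m ≤ n → R (m + 1) = σ m / c := fun m hm => by
    simp only [R]
    rw [if_neg (by omega), Nat.add_sub_cancel]
  have hR0 : R 0 = 0 := by simp [R]
  have hRn : R (n + 2) = 0 := by simp [R]
  refine ⟨R, hR0, hRn, hR, funext fun j => ?_⟩
  unfold diffPoint symbolPoint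
  refine Fin.cases ?_ (fun j => ?_) j
  · rw [Fin.cons_zero, Fin.val_zero, hR0, hR 0 n.zero_le, hσ0, div_self hc, zero_sub]
  · rw [Fin.cons_succ, Fin.val_succ]
    refine Fin.lastCases ?_ (fun i => ?_) j
    · rw [Fin.snoc_last, Fin.val_last, hRn, hR n le_rfl, hσn, sub_zero]
    · rw [Fin.snoc_castSucc, Fin.val_castSucc, hR i i.2.le, hR (i + 1) i.2, ← sub_div, hσ]

/-- The tail sums of the prescribed point are quotients of -1 + ∑_{i ≥ m} b_i by c. If all are
nonzero, the point is that of 1 and β_i = -b_i / σ_i, whose logarithmic form is that of b. If one is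
zero, the form and the class both vanish. -/
theorem map_dlogWedge_eq_pointClass {φ : Forms k n →+ SH k (n + 1) (n + 1)}
    (hφ : ∀ b, φ (dlogWedge b) = formClass k (1 : k) fun i => (b i : k)) (b : Fin n → kˣ)
    (hc : -1 + ∑ i, (b i : k) ≠ 0) : φ (dlogWedge b) =
      pointClass (symbolPoint b) (symbolPoint_sum b hc) (symbolPoint_ne_zero b hc) := by
  obtain ⟨R, h0, hn, hR, hb⟩ := exists_symbolPoint_eq_diffPoint b hc
  rw [← torusClass_self, hb]
  by_cases hR' : ∀ m, 1 ≤ m → m ≤ n + 1 → R m ≠ 0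
  · let σ : Fin n → k := fun i => -1 + ∑ l ∈ Finset.Ioi i, (b l : k)
    have hσR : ∀ i : Fin n, R (i + 2) = σ i / (-1 + ∑ i, (b i : k)) := fun i => by
      rw [hR (i + 1) i.2]
      congr 3
      ext l
      simp only [Finset.mem_filter, Finset.mem_univ, true_and, Finset.mem_Ioi, Fin.lt_def]
      omega
    have hσ : ∀ i, σ i ≠ 0 := fun i h => hR' (i + 2) (by omega) (by omega) (by
      rw [hσR, h, zero_div])
    rw [torusClass_diffPoint h0 hn hR', ← dlogWedge_eq (σ := fun i => Units.mk0 (σ i) (hσ i))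
      (β := fun i => -b i / Units.mk0 (σ i) (hσ i)) (fun _ => rfl) (fun _ => rfl), hφ]
    have h1 : R 1 = 1 := by
      rw [hR 0 n.zero_le]
      simpa using div_self hc
    rw [h1, inv_one]
    congr 1
    funext i
    have h2 : R (i + 1) - R (i + 2) = b i / (-1 + ∑ i, (b i : k)) := by
      have := congrFun hb i.succ.castSucc
      rw [symbolPoint, ← Fin.succ_castSucc, Fin.cons_succ, Fin.snoc_castSucc] at this
      exact this.symm
    rw [one_sub_div (hR' _ (by omega) (by omega)), ← neg_sub, h2, hσR,
      Units.val_div_eq_div_val, Units.val_mk0, Units.val_neg, neg_div, neg_div,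
      div_div_div_cancel_right₀ hc]
  · push Not at hR'
    obtain ⟨m, hm, hmn, h⟩ := hR'
    rw [torusClass_diffPoint_eq_zero hn hm hmn h]
    obtain ⟨m, rfl⟩ : ∃ j, m = j + 1 := ⟨m - 1, by omega⟩
    rw [hR m (by omega), div_eq_zero_iff, or_iff_left hc, neg_add_eq_zero] at h
    rw [dlogWedge_eq_zero h.symm, map_zero]

/-- The second clause also covers the b with c = 0, and surjectivity uses this formula rather than
the one with points. -/
theorem exists_isPhi (h : Infinite k ∨ n = 0) : ∃ φ : Forms k n →+ SH k (n + 1) (n + 1),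
    IsPhi φ ∧ ∀ b, φ (dlogWedge b) = formClass k (1 : k) fun i => (b i : k) := by
  let := moduleSH h
  obtain ⟨φ, hφ⟩ := exists_linearMap_dlogWedge h
  refine ⟨φ.toAddMonoidHom, ⟨fun a ω => ?_, map_dlogWedge_eq_pointClass hφ⟩, hφ⟩
  rw [← starOrZero_unit]
  exact φ.map_smul _ _

/-- Compatibility with ⋆ is linearity for the vector space structure, so φ is determined on
logarithmic forms; those with c = 0, where nothing is prescribed, are zero. -/
theorem IsPhi.eq (h : Infinite k ∨ n = 0) {φ ψ : Forms k n →+ SH k (n + 1) (n + 1)}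
    (hφ : IsPhi φ) (hψ : IsPhi ψ) : φ = ψ := by
  let := moduleSH h
  have hlin : ∀ {χ : Forms k n →+ SH k (n + 1) (n + 1)}, IsPhi χ → ∀ (a : k) ω,
      χ (a • ω) = a • χ ω := fun {χ} hχ a ω => by
    by_cases ha : a = 0
    · rw [ha, zero_smul, map_zero]
      exact (starOrZero_zero _).symm
    · change χ ((Units.mk0 a ha : k) • ω) = starOrZero ((Units.mk0 a ha : kˣ) : k) _
      rw [hχ.map_smul, starOrZero_unit]
  let φ' : Forms k n →ₗ[k] SH k (n + 1) (n + 1) := { φ with map_smul' := hlin hφ }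
  let ψ' : Forms k n →ₗ[k] SH k (n + 1) (n + 1) := { ψ with map_smul' := hlin hψ }
  have : φ' = ψ' := linearMap_ext_dlogWedge fun b => by
    change φ (dlogWedge b) = ψ (dlogWedge b)
    by_cases hc : -1 + ∑ i, (b i : k) = 0
    · rw [dlogWedge_eq_zero (m := 0) (by simpa using (neg_add_eq_zero.1 hc).symm), map_zero,
        map_zero]
    · rw [hφ.map_dlogWedge b hc, hψ.map_dlogWedge b hc]
  exact AddMonoidHom.ext fun ω => congrArg (fun χ => χ ω) this

theorem IsPhi.surjective (h : Infinite k ∨ n = 0) {φ : Forms k n →+ SH k (n + 1) (n + 1)}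
    (hφ : IsPhi φ) : Function.Surjective φ := by
  obtain ⟨ψ, hψ, hb⟩ := exists_isPhi (k := k) (n := n) h
  obtain rfl := hφ.eq h hψ
  rw [← AddMonoidHom.range_eq_top]
  refine eq_top_of_formClass_mem h fun x β => ?_
  by_cases hx : x = 0
  · rw [hx, formClass_zero]
    exact zero_mem _
  · refine ⟨(Units.mk0 x hx : k) • dlogWedge β, ?_⟩
    rw [hφ.map_smul, hb, star_formClass, mul_one, Units.val_mk0]

end Phi

end AdditiveChow

end

open AdditiveChow in
/-- With `n + 1` in place of `n ≥ 1`: the map `φ : Ω^n_k → SH^(n+1)(k, n+1)` is well defined and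
surjective, and `SH^(n+1)(k, n+1)` is generated by the classes of `k`-rational points. -/
theorem proposition4p4 {k : Type*} [Field k] (n : ℕ) :
    (∃! φ : Forms k n →+ SH k (n + 1) (n + 1), IsPhi φ) ∧
    (∀ φ : Forms k n →+ SH k (n + 1) (n + 1), IsPhi φ → Function.Surjective φ) ∧
    AddSubgroup.closure
      {x : SH k (n + 1) (n + 1) | ∃ (v : Fin (n + 2) → k) (hv : ∑ i, v i = 0)
        (h0 : ∀ i, v i ≠ 0), x = pointClass v hv h0} = ⊤ := by
  by_cases h : Infinite k ∨ n = 0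
  · obtain ⟨φ, hφ, -⟩ := exists_isPhi (k := k) (n := n) h
    exact ⟨⟨φ, hφ, fun ψ hψ => hψ.eq h hφ⟩, fun ψ hψ => hψ.surjective h, closure_pointClass h⟩
  · rw [not_or] at h
    have : Finite k := not_infinite_iff_finite.1 h.1
    -- Over a finite field with n ≥ 1 the additive Chow group is zero, and every claim is trivial.
    obtain ⟨n, rfl⟩ := Nat.exists_eq_succ_of_ne_zero h.2
    have := subsingleton_SH_of_finite (k := k) (n := n)
    exact ⟨⟨0, ⟨fun _ _ => Subsingleton.elim _ _, fun _ _ => Subsingleton.elim _ _⟩,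
      fun _ _ => AddMonoidHom.ext fun _ => Subsingleton.elim _ _⟩,
      fun _ _ x => ⟨0, Subsingleton.elim _ _⟩, Subsingleton.elim _ _⟩
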